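/- **Setting.** Let $R$ be a commutative ring with pseudoinvolution, i.e. an additive map $x\mapsto\bar x$ with $\overline{xy}=\bar y\,\bar 1^{-1}\bar x$ and $\bar{\bar x}=x$ ($\bar 1$ invertible). An anti-Hermitian form on an $R$-module $V$ is a biadditive map $B:V\times V\to R$ with $B(vx,wy)=\bar x\bar 1^{-1}B(v,w)y$ and $B(v,w)=-\overline{B(w,v)}$. Its Heisenberg group is $\mathfrak H=V\times R$ with $(v,x)\dotplus(w,y)=(v+w,x+y+B(v,w))$; the monoid $(R,\cdot)$ acts on it by $(v,x)\leftharpoonup y=(vy,\bar y\bar 1^{-1}xy)$. An odd quadratic space $\mathcal V=(V,B,\mathfrak L)$ consists of such a $(V,B)$ and a subgroup $\mathfrak L\le\mathfrak H$ (odd form parameter), stable under $\leftharpoonup$, with $\{(0,x+\bar x)\mid x\in R\}\subseteq\mathfrak L\subseteq\{(v,x)\mid x-\bar x=B(v,v)\}$. Put $Q(v)=(v,0)$ and $V^{ev}=\{v\mid (v,x)\in\mathfrak L\text{ for some }x\}$. The odd unitary group $\mathrm U(\mathcal V)$ consists of all $\sigma\in\mathrm{GL}(V)$ that preserve $B$ and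 satisfy $Q(\sigma v)\equiv Q(v)\bmod\mathfrak L$ for all $v\in V$. If $u,v\in V$, $Q(u)\in\mathfrak L$, $(v,x)\in\mathfrak L$ and $B(u,v)=0$, let $T_{u,v}(x)\in \mathrm U(\mathcal V)$ be the map $w\mapsto w+u\bar 1^{-1}(B(v,w)+xB(u,w))+vB(u,w)$. An odd form ideal on $\mathcal V$ is a pair $\mathfrak I=(I,\mathfrak M)$, where $I$ is an ideal of $R$ with $\bar I=I$ and $\mathfrak M\le\mathfrak H$ is a subgroup, stable under $\leftharpoonup$, that contains $\mathfrak L\leftharpoonup I$ and all $(0,x+\bar x)$ with $x\in I$, and is contained in $\{(v,x)\in\mathfrak L\mid x\in I,\ B(v,w)\in I\ \forall w\in V^{ev}\}$. Put $\mathrm U(\mathcal V,\mathfrak I)=\{\sigma\in\mathrm U(\mathcal V)\mid Q(\sigma v)\equiv Q(v)\bmod \mathfrak M\ \forall v\in V^{ev}\}$ and let $\mathrm{NU}(\mathcal V,\mathfrak I)$ be its normalizer in $\mathrm U(\mathcal V)$. Let $\mathcal V_0=(V_0,B_0,\mathfrak L_0)$ be an arbitrary odd quadratic space, and let $\mathcal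 V=\mathcal H^3\perp\mathcal V_0$. Here $\mathcal H^3$ is the orthogonal sum of three hyperbolic planes: its module is free with basis $e_i$, $i\in\Theta=\{\pm1,\pm2,\pm3\}$; with $F_h(v,w)=\sum_{i=1}^3\bar v_i\bar1^{-1}w_{-i}$ its form is $B_h(v,w)=F_h(v,w)-\overline{F_h(w,v)}$ and its odd form parameter is $\mathfrak L_h=\{(v,F_h(v,v)+x+\bar x)\}$; and $\mathfrak L=\mathfrak L_h+\mathfrak L_0$. Put $\mathrm U_6(\mathcal V_0)=\mathrm U(\mathcal V)$, and $\epsilon_i=\bar1^{-1}$ for $i>0$, $\epsilon_i=-1$ for $i<0$. The elementary transvections are $$T_{ij}(x)=T_{e_{-j},\,-e_ix\epsilon_j}(0)\quad(i\ne\pm j,\ x\in R),\qquad T_i(v_0,x)=T_{e_i,\,v_0\epsilon_{-i}}(\bar\epsilon_{-i}\bar1^{-1}x\epsilon_{-i})\quad(i\in\Theta,\ (v_0,x)\in\mathfrak L_0);$$ they generate the elementary subgroup $\mathrm{EU}_6(\mathcal V_0)$. For an odd form ideal $\mathfrak I_0=(I,\mathfrak M_0)$ on $\mathcal V_0$, let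 $\mathrm{EU}_6(\mathcal V_0,\mathfrak I_0)$ be the normal closure in $\mathrm{EU}_6(\mathcal V_0)$ of the subgroup generated by all $T_{ij}(x)$ with $x\in I$ and all $T_i(\xi)$ with $\xi\in\mathfrak M_0$. Let $\mathfrak I=(I,\mathfrak M)$ with $\mathfrak M=(\mathfrak L_h\leftharpoonup I)\dotplus\mathfrak M_0$ (the subgroup generated) be the corresponding odd form ideal on $\mathcal V$, and put $$\mathrm{CU}_6(\mathcal V_0,\mathfrak I_0)=\{\sigma\in\mathrm{NU}(\mathcal V,\mathfrak I)\mid[\sigma,\tau]\in\mathrm U(\mathcal V,\mathfrak I)\ \forall\tau\in\mathrm{EU}_6(\mathcal V_0)\}.$$ **Theorem (Sandwich Classification).** Let $H$ be a subgroup of $\mathrm U_6(\mathcal V_0)$. Then $H$ is normalized by $\mathrm{EU}_6(\mathcal V_0)$ if and only if $$\mathrm{EU}_6(\mathcal V_0,\mathfrak I_0)\subseteq H\subseteq\mathrm{CU}_6(\mathcal V_0,\mathfrak I_0)$$ for some odd form ideal $\mathfrak I_0$ on $\mathcal V_0$. Moreover $\mathfrak I_0=(I,\mathfrak M_0)$ is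 then uniquely determined; it is the level of $H$, that is, $I=\{x\in R\mid T_{ij}(x)\in H\text{ for some }i,j\in\Theta,\ i\ne\pm j\}$ and $\mathfrak M_0=\{\xi\in\mathfrak L_0\mid T_i(\xi)\in H\text{ for some }i\in\Theta\}$. -/

import Mathlib

namespace OddUnitary

/-- A pseudoinvolution on a (commutative) ring: an additive map `bar` with
`bar (x y) = bar y * (bar 1)⁻¹ * bar x` and `bar (bar x) = x`. -/
structure Pseudoinvolution (R : Type*) [CommRing R] where
  bar : R →+ R
  isUnit_bar_one : IsUnit (bar 1)
  bar_mul : ∀ x y : R, bar (x * y) = bar y * Ring.inverse (bar 1) * bar x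
  bar_bar : ∀ x : R, bar (bar x) = x

namespace Pseudoinvolution

variable {R : Type*} [CommRing R] (J : Pseudoinvolution R)

/-- The element `(bar 1)⁻¹`. -/
noncomputable def inv1 : R := Ring.inverse (J.bar 1)

theorem inv1_mul : J.inv1 * J.bar 1 = 1 := Ring.inverse_mul_cancel _ J.isUnit_bar_one

theorem mul_inv1 : J.bar 1 * J.inv1 = 1 := Ring.mul_inverse_cancel _ J.isUnit_bar_one

theorem bar_mul' (x y : R) : J.bar (x * y) = J.bar y * J.inv1 * J.bar x := J.bar_mul x y

theorem bar_inv1 : J.bar J.inv1 = J.bar 1 * J.bar 1 := by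
  have h := J.bar_mul' J.inv1 (J.bar 1)
  rw [J.inv1_mul, J.bar_bar] at h
  linear_combination (-J.bar 1) * h - (J.bar J.inv1) * J.mul_inv1

theorem bar_sandwich (x y a : R) :
    J.bar (J.bar y * J.inv1 * a * x) = J.bar x * J.inv1 * J.bar a * y := by
  rw [J.bar_mul', J.bar_mul', J.bar_mul', J.bar_bar, J.bar_inv1]
  linear_combination (J.bar x * J.inv1 * J.bar a * y) * (J.inv1 * J.bar 1 + 1) * J.inv1_mul

end Pseudoinvolution

/-- An anti-Hermitian form on a module `V` over the commutative ring `R`. Right modules over a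
commutative ring are the same as modules, and `v x` is written `x • v`. -/
structure AntiHermitianForm {R : Type*} [CommRing R] (J : Pseudoinvolution R)
    (V : Type*) [AddCommGroup V] [Module R V] where
  toFun : V → V → R
  add_left : ∀ u v w : V, toFun (u + v) w = toFun u w + toFun v w
  add_right : ∀ u v w : V, toFun u (v + w) = toFun u v + toFun u w
  smul_smul : ∀ (x y : R) (v w : V),
    toFun (x • v) (y • w) = J.bar x * J.inv1 * toFun v w * y
  anti : ∀ v w : V, toFun v w = -J.bar (toFun w v)

section Forms

variable {R : Type*} [CommRing R] {J : Pseudoinvolution R}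
variable {V : Type*} [AddCommGroup V] [Module R V]

instance : CoeFun (AntiHermitianForm J V) (fun _ => V → V → R) := ⟨AntiHermitianForm.toFun⟩

namespace AntiHermitianForm

variable (B : AntiHermitianForm J V)

theorem smul_right (y : R) (v w : V) : B v (y • w) = B v w * y := by
  have h := B.smul_smul 1 y v w
  rw [one_smul, J.mul_inv1, one_mul] at h
  exact h

theorem smul_left (x : R) (v w : V) : B (x • v) w = J.bar x * J.inv1 * B v w := by
  have h := B.smul_smul x 1 v w
  rwa [one_smul, mul_one] at h

theorem zero_left (w : V) : B 0 w = 0 := by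
  have h := B.add_left 0 0 w
  rw [add_zero] at h
  exact left_eq_add.mp h

theorem zero_right (w : V) : B w 0 = 0 := by
  have h := B.add_right w 0 0
  rw [add_zero] at h
  exact left_eq_add.mp h

theorem neg_left (v w : V) : B (-v) w = -B v w := by
  have h := B.add_left v (-v) w
  rw [add_neg_cancel, zero_left] at h
  exact (neg_eq_of_add_eq_zero_right h.symm).symm

theorem neg_right (v w : V) : B v (-w) = -B v w := by
  have h := B.add_right v w (-w)
  rw [add_neg_cancel, zero_right] at h
  exact (neg_eq_of_add_eq_zero_right h.symm).symm

theorem bar_apply (v w : V) : J.bar (B v w) = -B w v := by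
  rw [B.anti w v, neg_neg]

end AntiHermitianForm

/-- The underlying set `V × R` of the Heisenberg group of `(V, B)`. -/
@[ext]
structure Heis (B : AntiHermitianForm J V) where
  vec : V
  scal : R

namespace Heis

variable {B : AntiHermitianForm J V}

instance : Add (Heis B) := ⟨fun ξ η => ⟨ξ.vec + η.vec, ξ.scal + η.scal + B ξ.vec η.vec⟩⟩
instance : Zero (Heis B) := ⟨⟨0, 0⟩⟩
instance : Neg (Heis B) := ⟨fun ξ => ⟨-ξ.vec, -ξ.scal + B ξ.vec ξ.vec⟩⟩

@[simp] theorem vec_add (ξ η : Heis B) : (ξ + η).vec = ξ.vec + η.vec := rfl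
@[simp] theorem scal_add (ξ η : Heis B) :
    (ξ + η).scal = ξ.scal + η.scal + B ξ.vec η.vec := rfl
@[simp] theorem vec_zero : (0 : Heis B).vec = 0 := rfl
@[simp] theorem scal_zero : (0 : Heis B).scal = 0 := rfl
@[simp] theorem vec_neg (ξ : Heis B) : (-ξ).vec = -ξ.vec := rfl
@[simp] theorem scal_neg (ξ : Heis B) : (-ξ).scal = -ξ.scal + B ξ.vec ξ.vec := rfl

/-- The (in general non-commutative, additively written) Heisenberg group. -/
instance : AddGroup (Heis B) :=
  AddGroup.ofLeftAxioms
    (fun a b c => by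
      ext
      · simp [add_assoc]
      · simp [B.add_left, B.add_right]; ring)
    (fun a => by ext <;> simp [B.zero_left])
    (fun a => by ext <;> simp [B.neg_left])

/-- The right action `(v, x) ↼ y = (v y, bar y (bar 1)⁻¹ x y)` of the monoid `(R, ·)`. -/
noncomputable def act (ξ : Heis B) (y : R) : Heis B :=
  ⟨y • ξ.vec, J.bar y * J.inv1 * ξ.scal * y⟩

@[simp] theorem vec_act (ξ : Heis B) (y : R) : (ξ.act y).vec = y • ξ.vec := rfl
@[simp] theorem scal_act (ξ : Heis B) (y : R) :
    (ξ.act y).scal = J.bar y * J.inv1 * ξ.scal * y := rfl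

theorem add_act (ξ η : Heis B) (y : R) : (ξ + η).act y = ξ.act y + η.act y := by
  ext
  · simp
  · simp [B.smul_smul]; ring

theorem zero_act (y : R) : (0 : Heis B).act y = 0 := by
  ext <;> simp

theorem neg_act (ξ : Heis B) (y : R) : (-ξ).act y = -(ξ.act y) := by
  ext
  · simp
  · simp [B.smul_smul]; ring

theorem act_act (ξ : Heis B) (a b : R) : (ξ.act a).act b = ξ.act (a * b) := by
  ext
  · simp [smul_smul, mul_comm]
  · simp [J.bar_mul']; ring

/-- The trace map `tr (v, x) = x - bar x - B (v, v)`. -/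
def tr : Heis B →+ R where
  toFun ξ := ξ.scal - J.bar ξ.scal - B ξ.vec ξ.vec
  map_zero' := by simp [B.zero_left]
  map_add' ξ η := by
    simp only [vec_add, scal_add, map_add, B.add_left, B.add_right, B.bar_apply]
    ring

/-- The smallest odd form parameter `{(0, x + bar x) | x ∈ R}`. -/
def Lmin (B : AntiHermitianForm J V) : AddSubgroup (Heis B) where
  carrier := {ξ | ∃ x : R, ξ = ⟨0, x + J.bar x⟩}
  zero_mem' := ⟨0, by ext <;> simp⟩
  add_mem' := by
    rintro _ _ ⟨x, rfl⟩ ⟨y, rfl⟩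
    refine ⟨x + y, ?_⟩
    ext
    · simp
    · simp [B.zero_left]; ring
  neg_mem' := by
    rintro _ ⟨x, rfl⟩
    refine ⟨-x, ?_⟩
    ext
    · simp
    · simp [B.zero_left]; ring

/-- The largest odd form parameter, the kernel of the trace map. -/
def Lmax (B : AntiHermitianForm J V) : AddSubgroup (Heis B) := (tr (B := B)).ker

end Heis

end Forms

/-- An odd quadratic space `(V, B, Q_L)` with underlying module `V`: an anti-Hermitian form `B`
and an odd form parameter `L`, i.e. a subgroup of the Heisenberg group that is stable under the
action of `R` and lies between `Lmin` and `Lmax`. -/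
structure OddQuadraticSpace {R : Type*} [CommRing R] (J : Pseudoinvolution R)
    (V : Type*) [AddCommGroup V] [Module R V] where
  form : AntiHermitianForm J V
  L : AddSubgroup (Heis form)
  act_mem : ∀ ξ ∈ L, ∀ y : R, ξ.act y ∈ L
  Lmin_le : Heis.Lmin form ≤ L
  le_Lmax : L ≤ Heis.Lmax form

namespace OddQuadraticSpace

variable {R : Type*} [CommRing R] {J : Pseudoinvolution R}
variable {V : Type*} [AddCommGroup V] [Module R V]
variable {V' : Type*} [AddCommGroup V'] [Module R V']

section Basic

variable (S : OddQuadraticSpace J V)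

/-- The map `Q : V → Heis`, `v ↦ (v, 0)`. -/
def Q (v : V) : Heis S.form := ⟨v, 0⟩

/-- The odd quadratic form `Q_L : V → Heis / L`. -/
def quad (v : V) : Heis S.form ⧸ S.L := QuotientAddGroup.mk (S.Q v)

theorem quad_eq_iff (v w : V) : S.quad v = S.quad w ↔
    (⟨w - v, S.form v v - S.form v w⟩ : Heis S.form) ∈ S.L := by
  have h : -S.Q v + S.Q w = ⟨w - v, S.form v v - S.form v w⟩ := by
    ext
    · simp only [Q, Heis.vec_add, Heis.vec_neg]; abel
    · simp only [Q, Heis.scal_add, Heis.scal_neg, Heis.vec_neg, S.form.neg_left]; ring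
  rw [quad, quad, QuotientAddGroup.eq, h]

/-- The odd unitary group `U(V, B, Q_L)`. -/
def unitaryGroup : Subgroup (V ≃ₗ[R] V) where
  carrier := {σ | (∀ v w, S.form (σ v) (σ w) = S.form v w) ∧ ∀ v, S.quad (σ v) = S.quad v}
  one_mem' := ⟨fun _ _ => rfl, fun _ => rfl⟩
  mul_mem' := by
    rintro σ τ ⟨h1, h2⟩ ⟨h3, h4⟩
    refine ⟨fun v w => ?_, fun v => ?_⟩
    · rw [LinearEquiv.mul_apply, LinearEquiv.mul_apply, h1, h3]
    · rw [LinearEquiv.mul_apply, h2, h4]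
  inv_mem' := by
    rintro σ ⟨h1, h2⟩
    have hs : ∀ v, σ (σ⁻¹ v) = v := fun v => σ.apply_symm_apply v
    refine ⟨fun v w => ?_, fun v => ?_⟩
    · rw [← h1, hs, hs]
    · rw [← h2, hs]

/-- The even part of `V`. -/
def even : Submodule R V where
  carrier := {v | ∃ x : R, (⟨v, x⟩ : Heis S.form) ∈ S.L}
  zero_mem' := ⟨0, S.L.zero_mem⟩
  add_mem' := by
    rintro _ _ ⟨x, hx⟩ ⟨y, hy⟩
    exact ⟨_, S.L.add_mem hx hy⟩
  smul_mem' := by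
    rintro c _ ⟨x, hx⟩
    exact ⟨_, S.act_mem _ hx c⟩

theorem map_mem_L (σ : S.unitaryGroup) {v : V} {x : R}
    (h : (⟨v, x⟩ : Heis S.form) ∈ S.L) :
    (⟨(σ : V ≃ₗ[R] V) v, x⟩ : Heis S.form) ∈ S.L := by
  have h2 := (S.quad_eq_iff _ _).1 (σ.2.2 v).symm
  have h3 := S.L.add_mem h h2
  convert h3 using 1
  ext
  · simp
  · simp only [Heis.scal_add, sub_eq_add_neg, S.form.add_right, S.form.neg_right]; ring

theorem map_mem_even (σ : S.unitaryGroup) {v : V} (h : v ∈ S.even) :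
    (σ : V ≃ₗ[R] V) v ∈ S.even := by
  obtain ⟨x, hx⟩ := h
  exact ⟨x, S.map_mem_L σ hx⟩

/-- The smallest relative odd form parameter of level `I`, the subgroup generated by the elements
`ξ ↼ a` (`ξ ∈ L`, `a ∈ I`) and `(0, x + bar x)` (`x ∈ I`). -/
def Mmin (I : Ideal R) : AddSubgroup (Heis S.form) :=
  AddSubgroup.closure ({η | ∃ ξ ∈ S.L, ∃ a ∈ I, η = ξ.act a} ∪
    {η | ∃ x ∈ I, η = ⟨0, x + J.bar x⟩})

/-- The largest relative odd form parameter of level `I`. -/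
def Mmax (I : Ideal R) : AddSubgroup (Heis S.form) where
  carrier := {ξ | ξ ∈ S.L ∧ ξ.scal ∈ I ∧ ∀ w ∈ S.even, S.form ξ.vec w ∈ I}
  zero_mem' := ⟨S.L.zero_mem, I.zero_mem, fun w _ => by simp [S.form.zero_left]⟩
  add_mem' := by
    rintro ξ η ⟨h1, h2, h3⟩ ⟨h4, h5, h6⟩
    refine ⟨S.L.add_mem h1 h4, I.add_mem (I.add_mem h2 h5) (h3 _ ⟨_, h4⟩), fun w hw => ?_⟩
    rw [Heis.vec_add, S.form.add_left]
    exact I.add_mem (h3 w hw) (h6 w hw)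
  neg_mem' := by
    rintro ξ ⟨h1, h2, h3⟩
    refine ⟨S.L.neg_mem h1, I.add_mem (I.neg_mem h2) (h3 _ ⟨_, h1⟩), fun w hw => ?_⟩
    rw [Heis.vec_neg, S.form.neg_left]
    exact I.neg_mem (h3 w hw)

end Basic

/-- An odd form ideal `(I, M)` on an odd quadratic space: an ideal `I` with `bar I = I` and a
relative odd form parameter `M` of level `I`. -/
@[ext]
structure OddFormIdeal (S : OddQuadraticSpace J V) where
  I : Ideal R
  M : AddSubgroup (Heis S.form)
  bar_image : J.bar '' (I : Set R) = I
  act_mem : ∀ ξ ∈ M, ∀ y : R, ξ.act y ∈ M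
  Mmin_le : S.Mmin I ≤ M
  le_Mmax : M ≤ S.Mmax I

namespace OddFormIdeal

variable {S : OddQuadraticSpace J V}

theorem bar_mem (K : S.OddFormIdeal) {x : R} (hx : x ∈ K.I) : J.bar x ∈ K.I := by
  have h : J.bar x ∈ J.bar '' (K.I : Set R) := ⟨x, hx, rfl⟩
  rw [K.bar_image] at h
  exact h

/-- The coset of `Q v` modulo `M`. On the even part of `V` this is the relative odd quadratic
form `Q_M`. -/
def relQuad (K : S.OddFormIdeal) (v : V) : Heis S.form ⧸ K.M := QuotientAddGroup.mk (S.Q v)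

/-- The principal congruence subgroup `U(V, (I, M))`. -/
def principalCongruence (K : S.OddFormIdeal) : Subgroup S.unitaryGroup where
  carrier := {σ | ∀ v ∈ S.even, K.relQuad ((σ : V ≃ₗ[R] V) v) = K.relQuad v}
  one_mem' := fun _ _ => rfl
  mul_mem' := by
    intro σ τ h1 h2 v hv
    exact (h1 _ (S.map_mem_even τ hv)).trans (h2 v hv)
  inv_mem' := by
    intro σ h1 v hv
    have h := h1 _ (S.map_mem_even σ⁻¹ hv)
    have hs : (σ : V ≃ₗ[R] V) (((σ⁻¹ : S.unitaryGroup) : V ≃ₗ[R] V) v) = v :=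
      (σ : V ≃ₗ[R] V).apply_symm_apply v
    exact h.symm.trans (congrArg K.relQuad hs)

/-- The normalized principal congruence subgroup `NU(V, (I, M))`. -/
def normalizedCongruence (K : S.OddFormIdeal) : Subgroup S.unitaryGroup :=
  Subgroup.normalizer (K.principalCongruence : Set S.unitaryGroup)

end OddFormIdeal

section Transvections

variable (S : OddQuadraticSpace J V)

/-- `w` is isotropic: `Q_L w` is the trivial coset. -/
def IsIsotropic (w : V) : Prop := S.quad w = S.quad 0

theorem isIsotropic_iff (w : V) : S.IsIsotropic w ↔ S.Q w ∈ S.L := by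
  have h : S.Q w = (⟨w - 0, S.form 0 0 - S.form 0 w⟩ : Heis S.form) := by
    ext <;> simp [Q, S.form.zero_left]
  rw [IsIsotropic, eq_comm, quad_eq_iff, ← h]

/-- The linear map `w ↦ w + u (bar 1)⁻¹ (B (v, w) + x B (u, w)) + v B (u, w)` for `ξ = (v, x)`. -/
noncomputable def esdMap (u : V) (ξ : Heis S.form) : V →ₗ[R] V where
  toFun w := w + (J.inv1 * (S.form ξ.vec w + ξ.scal * S.form u w)) • u + S.form u w • ξ.vec
  map_add' w w' := by
    simp only [S.form.add_right]
    module
  map_smul' c w := by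
    simp only [S.form.smul_right, RingHom.id_apply]
    module

theorem esdMap_apply (u : V) (ξ : Heis S.form) (w : V) : S.esdMap u ξ w =
    w + (J.inv1 * (S.form ξ.vec w + ξ.scal * S.form u w)) • u + S.form u w • ξ.vec := rfl

theorem form_self_of_mem {ξ : Heis S.form} (h : ξ ∈ S.L) :
    S.form ξ.vec ξ.vec = ξ.scal - J.bar ξ.scal := by
  have h1 : ξ.scal - J.bar ξ.scal - S.form ξ.vec ξ.vec = 0 := S.le_Lmax h
  linear_combination -h1

theorem form_self_of_isotropic {u : V} (hu : S.IsIsotropic u) : S.form u u = 0 := by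
  have h := S.form_self_of_mem ((S.isIsotropic_iff u).1 hu)
  simpa [Q] using h

theorem esdMap_add {u : V} (hu : S.IsIsotropic u) (ξ η : Heis S.form)
    (hη : S.form u η.vec = 0) (hξ' : S.form u ξ.vec = 0) (w : V) :
    S.esdMap u ξ (S.esdMap u η w) = S.esdMap u (ξ + η) w := by
  have huu := S.form_self_of_isotropic hu
  have hξ : S.form ξ.vec u = 0 := by rw [S.form.anti, hξ', map_zero, neg_zero]
  simp only [esdMap_apply, Heis.vec_add, Heis.scal_add, S.form.add_right, S.form.add_left,
    S.form.smul_right, huu, hη, hξ]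
  module

theorem esdMap_zero (u w : V) : S.esdMap u 0 w = w := by
  simp [esdMap_apply, S.form.zero_left]

/-- The Eichler-Siegel-Dickson transvection `T_{u v} (x)`, for an isotropic `u`, `ξ = (v, x) ∈ L`
and `u` orthogonal to `v`, as an element of the odd unitary group. -/
noncomputable def esd (u : V) (ξ : Heis S.form) (hu : S.IsIsotropic u) (hξ : ξ ∈ S.L)
    (h : S.form u ξ.vec = 0) : S.unitaryGroup :=
  ⟨{ S.esdMap u ξ with
      invFun := S.esdMap u (-ξ)
      left_inv := fun w => by
        have h' : S.form u (-ξ).vec = 0 := by rw [Heis.vec_neg, S.form.neg_right, h, neg_zero]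
        exact (S.esdMap_add hu (-ξ) ξ h h' w).trans (by rw [neg_add_cancel, esdMap_zero])
      right_inv := fun w => by
        have h' : S.form u (-ξ).vec = 0 := by rw [Heis.vec_neg, S.form.neg_right, h, neg_zero]
        exact (S.esdMap_add hu ξ (-ξ) h' h w).trans (by rw [add_neg_cancel, esdMap_zero]) },
    by
      have huu := S.form_self_of_isotropic hu
      have hv := S.form_self_of_mem hξ
      have h' : S.form ξ.vec u = 0 := by rw [S.form.anti, h, map_zero, neg_zero]
      constructor
      · intro w w'
        change S.form (S.esdMap u ξ w) (S.esdMap u ξ w') = S.form w w'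
        simp only [esdMap_apply, S.form.add_right, S.form.add_left, S.form.smul_right,
          S.form.smul_left, huu, h, h', hv, S.form.anti w u, S.form.anti w ξ.vec, J.bar_mul',
          map_add, J.bar_inv1]
        linear_combination
          ((J.bar (S.form ξ.vec w) + J.bar (S.form u w) * J.inv1 * J.bar ξ.scal) *
            (J.inv1 * J.bar 1 + 1) * S.form u w') * J.inv1_mul
      · intro w
        change S.quad (S.esdMap u ξ w) = S.quad w
        rw [eq_comm, quad_eq_iff]
        have h1 := S.act_mem _ ((S.isIsotropic_iff u).1 hu)
          (J.inv1 * (S.form ξ.vec w + ξ.scal * S.form u w))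
        have h2 := S.act_mem _ hξ (S.form u w)
        have h3 : (⟨0, J.bar (S.form u w) * J.inv1 * S.form ξ.vec w +
            J.bar (J.bar (S.form u w) * J.inv1 * S.form ξ.vec w)⟩ : Heis S.form) ∈ S.L :=
          S.Lmin_le ⟨_, rfl⟩
        have h4 := S.L.add_mem (S.L.add_mem h1 h2) h3
        convert h4 using 1
        have hs := J.bar_sandwich 1 (S.form u w) (S.form ξ.vec w)
        rw [mul_one] at hs
        ext
        · simp only [esdMap_apply, Heis.vec_add, Heis.vec_act, Q]; abel
        · simp only [esdMap_apply, Heis.scal_add, Heis.scal_act, Heis.vec_add, Heis.vec_act, Q, hs,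
            S.form.add_right, S.form.smul_right, S.form.smul_left, h, S.form.zero_right,
            S.form.anti w u, S.form.anti w ξ.vec]
          linear_combination (-J.bar (S.form ξ.vec w) * S.form u w) * J.mul_inv1⟩

end Transvections

section OrthogonalSum

/-- The anti-Hermitian form `B + B'` on `V ⊕ V'`. -/
def _root_.OddUnitary.AntiHermitianForm.prod (B : AntiHermitianForm J V)
    (B' : AntiHermitianForm J V') : AntiHermitianForm J (V × V') where
  toFun v w := B v.1 w.1 + B' v.2 w.2
  add_left u v w := by simp only [Prod.fst_add, Prod.snd_add, B.add_left, B'.add_left]; ring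
  add_right u v w := by simp only [Prod.fst_add, Prod.snd_add, B.add_right, B'.add_right]; ring
  smul_smul x y v w := by
    simp only [Prod.smul_fst, Prod.smul_snd, B.smul_smul, B'.smul_smul]; ring
  anti v w := by rw [map_add, B.anti, B'.anti]; ring

theorem prod_apply (B : AntiHermitianForm J V) (B' : AntiHermitianForm J V') (v w : V × V') :
    (B.prod B') v w = B v.1 w.1 + B' v.2 w.2 := rfl

/-- The orthogonal sum of two odd quadratic spaces, with odd form parameter
`{(v + v', x + x') | (v, x) ∈ L, (v', x') ∈ L'}`. -/
def orthSum (S : OddQuadraticSpace J V) (S' : OddQuadraticSpace J V') :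
    OddQuadraticSpace J (V × V') where
  form := S.form.prod S'.form
  L :=
    { carrier := {ξ | ∃ x x' : R, (⟨ξ.vec.1, x⟩ : Heis S.form) ∈ S.L ∧
        (⟨ξ.vec.2, x'⟩ : Heis S'.form) ∈ S'.L ∧ ξ.scal = x + x'}
      zero_mem' := ⟨0, 0, S.L.zero_mem, S'.L.zero_mem, by simp⟩
      add_mem' := by
        rintro ξ η ⟨x, x', h1, h2, h3⟩ ⟨y, y', h4, h5, h6⟩
        refine ⟨_, _, S.L.add_mem h1 h4, S'.L.add_mem h2 h5, ?_⟩
        simp only [Heis.scal_add, prod_apply, h3, h6]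
        ring
      neg_mem' := by
        rintro ξ ⟨x, x', h1, h2, h3⟩
        refine ⟨_, _, S.L.neg_mem h1, S'.L.neg_mem h2, ?_⟩
        simp only [Heis.scal_neg, prod_apply, h3]
        ring }
  act_mem := by
    rintro ξ ⟨x, x', h1, h2, h3⟩ y
    refine ⟨_, _, S.act_mem _ h1 y, S'.act_mem _ h2 y, ?_⟩
    simp only [Heis.scal_act, h3]
    ring
  Lmin_le := by
    rintro _ ⟨x, rfl⟩
    exact ⟨x + J.bar x, 0, S.Lmin_le ⟨x, rfl⟩, S'.L.zero_mem, by simp⟩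
  le_Lmax := by
    rintro ξ ⟨x, x', h1, h2, h3⟩
    have h4 := S.form_self_of_mem h1
    have h5 := S'.form_self_of_mem h2
    change ξ.scal - J.bar ξ.scal - (S.form ξ.vec.1 ξ.vec.1 + S'.form ξ.vec.2 ξ.vec.2) = 0
    simp only at h4 h5
    rw [h3, h4, h5, map_add]
    ring

variable (S : OddQuadraticSpace J V) (S' : OddQuadraticSpace J V')

/-- The embedding of the first Heisenberg group into that of the orthogonal sum. -/
def inl : Heis S.form →+ Heis (S.orthSum S').form where
  toFun ξ := ⟨(ξ.vec, 0), ξ.scal⟩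
  map_zero' := rfl
  map_add' ξ η := by
    ext
    · rfl
    · simp
    · change _ = ξ.scal + η.scal + (S.form ξ.vec η.vec + S'.form 0 0)
      simp [S'.form.zero_left]

/-- The embedding of the second Heisenberg group into that of the orthogonal sum. -/
def inr : Heis S'.form →+ Heis (S.orthSum S').form where
  toFun ξ := ⟨(0, ξ.vec), ξ.scal⟩
  map_zero' := rfl
  map_add' ξ η := by
    ext
    · simp
    · rfl
    · change _ = ξ.scal + η.scal + (S.form 0 0 + S'.form ξ.vec η.vec)
      simp [S.form.zero_left]

theorem inl_act (ξ : Heis S.form) (a : R) : (inl S S' ξ).act a = inl S S' (ξ.act a) := by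
  ext <;> simp [inl]

theorem inr_act (ξ : Heis S'.form) (a : R) : (inr S S' ξ).act a = inr S S' (ξ.act a) := by
  ext <;> simp [inr]

theorem inl_mem {ξ : Heis S.form} (h : ξ ∈ S.L) : inl S S' ξ ∈ (S.orthSum S').L :=
  ⟨ξ.scal, 0, h, S'.L.zero_mem, (add_zero _).symm⟩

theorem inr_mem {ξ : Heis S'.form} (h : ξ ∈ S'.L) : inr S S' ξ ∈ (S.orthSum S').L :=
  ⟨0, ξ.scal, S.L.zero_mem, h, (zero_add _).symm⟩

theorem exists_of_mem {ξ : Heis (S.orthSum S').form} (h : ξ ∈ (S.orthSum S').L) :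
    ∃ η ∈ S.L, ∃ η' ∈ S'.L, ξ = inl S S' η + inr S S' η' := by
  obtain ⟨x, x', h1, h2, h3⟩ := h
  refine ⟨_, h1, _, h2, ?_⟩
  ext
  · simp [inl, inr]
  · simp [inl, inr]
  · change _ = x + x' + (S.form ξ.vec.1 0 + S'.form 0 ξ.vec.2)
    simp [h3, S.form.zero_right, S'.form.zero_left]

variable {S'}

/-- The odd form ideal `(I, L ↼ I ∔ M')` on the orthogonal sum that corresponds to an odd form
ideal `(I, M')` on the second summand. -/
def OddFormIdeal.extend (K : S'.OddFormIdeal) : (S.orthSum S').OddFormIdeal where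
  I := K.I
  M := AddSubgroup.closure ({ζ | ∃ ξ ∈ S.L, ∃ a ∈ K.I, ζ = inl S S' (ξ.act a)} ∪
    {ζ | ∃ η ∈ K.M, ζ = inr S S' η})
  bar_image := K.bar_image
  act_mem := by
    intro ξ hξ y
    induction hξ using AddSubgroup.closure_induction with
    | mem ζ hζ =>
      apply AddSubgroup.subset_closure
      rcases hζ with ⟨ξ, hξ, a, ha, rfl⟩ | ⟨η, hη, rfl⟩
      · exact Or.inl ⟨ξ, hξ, a * y, K.I.mul_mem_right y ha, by rw [inl_act, Heis.act_act]⟩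
      · exact Or.inr ⟨_, K.act_mem _ hη y, inr_act _ _ _ _⟩
    | zero => rw [Heis.zero_act]; exact AddSubgroup.zero_mem _
    | add a b _ _ ha hb => rw [Heis.add_act]; exact AddSubgroup.add_mem _ ha hb
    | neg a _ ha => rw [Heis.neg_act]; exact AddSubgroup.neg_mem _ ha
  Mmin_le := by
    rw [Mmin, AddSubgroup.closure_le]
    rintro _ (⟨ξ, hξ, a, ha, rfl⟩ | ⟨x, hx, rfl⟩)
    · obtain ⟨η, hη, η', hη', rfl⟩ := exists_of_mem S S' hξ
      rw [Heis.add_act, inl_act, inr_act]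
      refine AddSubgroup.add_mem _ (AddSubgroup.subset_closure (Or.inl ⟨η, hη, a, ha, rfl⟩))
        (AddSubgroup.subset_closure (Or.inr ⟨_, K.Mmin_le ?_, rfl⟩))
      exact AddSubgroup.subset_closure (Or.inl ⟨η', hη', a, ha, rfl⟩)
    · refine AddSubgroup.subset_closure (Or.inr ⟨⟨0, x + J.bar x⟩, K.Mmin_le ?_, rfl⟩)
      exact AddSubgroup.subset_closure (Or.inr ⟨x, hx, rfl⟩)
  le_Mmax := by
    rw [AddSubgroup.closure_le]
    rintro _ (⟨ξ, hξ, a, ha, rfl⟩ | ⟨η, hη, rfl⟩)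
    · refine ⟨inl_mem S S' (S.act_mem _ hξ a), K.I.mul_mem_left _ ha, fun w _ => ?_⟩
      change S.form (a • ξ.vec) w.1 + S'.form 0 w.2 ∈ K.I
      rw [S'.form.zero_left, add_zero, S.form.smul_left, mul_assoc]
      exact K.I.mul_mem_right _ (K.bar_mem ha)
    · obtain ⟨h1, h2, h3⟩ := K.le_Mmax hη
      refine ⟨inr_mem S S' h1, h2, fun w hw => ?_⟩
      change S.form 0 w.1 + S'.form η.vec w.2 ∈ K.I
      rw [S.form.zero_left, zero_add]
      obtain ⟨z, x, x', -, h5, -⟩ := hw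
      exact h3 _ ⟨x', h5⟩

end OrthogonalSum

end OddQuadraticSpace

section Hyperbolic

/-- The index set `Θ = {1, …, n, -n, …, -1}`: `Sum.inl` gives the positive indices and `Sum.inr`
the negative ones; `Sum.swap` is `i ↦ -i`. -/
abbrev Theta (n : ℕ) : Type := Fin n ⊕ Fin n

variable {R : Type*} [CommRing R] (J : Pseudoinvolution R)

/-- `ε_i = (bar 1)⁻¹` for positive `i` and `ε_i = -1` for negative `i`. -/
noncomputable def eps {n : ℕ} : Theta n → R
  | Sum.inl _ => J.inv1
  | Sum.inr _ => -1

/-- The sesquilinear form `F_h (v, w) = ∑_{i = 1}^{n} bar v_i (bar 1)⁻¹ w_{-i}` on the free module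
`V_h = R^Θ`. -/
noncomputable def hypF {n : ℕ} (v w : Theta n → R) : R :=
  ∑ i : Fin n, J.bar (v (Sum.inl i)) * J.inv1 * w (Sum.inr i)

theorem hypF_add_left {n : ℕ} (u v w : Theta n → R) :
    hypF J (u + v) w = hypF J u w + hypF J v w := by
  simp only [hypF, Pi.add_apply, map_add, add_mul, Finset.sum_add_distrib]

theorem hypF_add_right {n : ℕ} (u v w : Theta n → R) :
    hypF J u (v + w) = hypF J u v + hypF J u w := by
  simp only [hypF, Pi.add_apply, mul_add, Finset.sum_add_distrib]

theorem hypF_smul_smul {n : ℕ} (x y : R) (v w : Theta n → R) :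
    hypF J (x • v) (y • w) = J.bar x * J.inv1 * hypF J v w * y := by
  simp only [hypF, Pi.smul_apply, smul_eq_mul, J.bar_mul', Finset.mul_sum, Finset.sum_mul]
  exact Finset.sum_congr rfl fun i _ => by ring

/-- The anti-Hermitian form `B_h (v, w) = F_h (v, w) - bar (F_h (w, v))`; it is the orthogonal sum
of `n` hyperbolic planes, i.e. `B_h (e_i, e_{-i}) = 1` for positive `i` and `B_h (e_i, e_j) = 0`
for `j ≠ -i`. -/
noncomputable def hypForm (n : ℕ) : AntiHermitianForm J (Theta n → R) where
  toFun v w := hypF J v w - J.bar (hypF J w v)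
  add_left u v w := by rw [hypF_add_left, hypF_add_right, map_add]; ring
  add_right u v w := by rw [hypF_add_left, hypF_add_right, map_add]; ring
  smul_smul x y v w := by rw [hypF_smul_smul, hypF_smul_smul, J.bar_sandwich]; ring
  anti v w := by rw [map_sub, J.bar_bar]; ring

theorem hypForm_apply {n : ℕ} (v w : Theta n → R) :
    (hypForm J n) v w = hypF J v w - J.bar (hypF J w v) := rfl

/-- The odd quadratic space `H^n`, the orthogonal sum of `n` hyperbolic planes, with odd form
parameter `{(v, F_h (v, v) + x + bar x) | v ∈ V_h, x ∈ R}`. -/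
noncomputable def hyp (n : ℕ) : OddQuadraticSpace J (Theta n → R) where
  form := hypForm J n
  L :=
    { carrier := {ξ | ∃ x : R, ξ.scal = hypF J ξ.vec ξ.vec + (x + J.bar x)}
      zero_mem' := ⟨0, by simp [hypF]⟩
      add_mem' := by
        rintro ξ η ⟨x, hx⟩ ⟨y, hy⟩
        refine ⟨x + y - hypF J η.vec ξ.vec, ?_⟩
        simp only [Heis.scal_add, Heis.vec_add, hx, hy, hypF_add_left, hypF_add_right, hypForm_apply,
          map_add, map_sub]
        ring
      neg_mem' := by
        rintro ξ ⟨x, hx⟩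
        refine ⟨-x - hypF J ξ.vec ξ.vec, ?_⟩
        have h : hypF J (-ξ.vec) (-ξ.vec) = hypF J ξ.vec ξ.vec := by
          simp [hypF]
        simp only [Heis.scal_neg, Heis.vec_neg, hx, h, hypForm_apply, map_sub, map_neg]
        ring }
  act_mem := by
    rintro ξ ⟨x, hx⟩ y
    refine ⟨J.bar y * J.inv1 * x * y, ?_⟩
    simp only [Heis.scal_act, Heis.vec_act, hypF_smul_smul, hx, J.bar_sandwich]
    ring
  Lmin_le := by
    rintro _ ⟨x, rfl⟩
    exact ⟨x, by simp [hypF]⟩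
  le_Lmax := by
    rintro ξ ⟨x, hx⟩
    change ξ.scal - J.bar ξ.scal - (hypF J ξ.vec ξ.vec - J.bar (hypF J ξ.vec ξ.vec)) = 0
    rw [hx, map_add, map_add, J.bar_bar]
    ring

variable {J} {V₀ : Type*} [AddCommGroup V₀] [Module R V₀]

/-- The odd hyperbolic unitary space `H^n ⟂ V₀` of rank `n`. -/
noncomputable def hypSpace (n : ℕ) (S₀ : OddQuadraticSpace J V₀) :
    OddQuadraticSpace J ((Theta n → R) × V₀) := (hyp J n).orthSum S₀

/-- The odd hyperbolic unitary group `U_{2n}(V₀)`. -/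
noncomputable abbrev hypU (n : ℕ) (S₀ : OddQuadraticSpace J V₀) :
    Subgroup (((Theta n → R) × V₀) ≃ₗ[R] ((Theta n → R) × V₀)) := (hypSpace n S₀).unitaryGroup

variable {n : ℕ} (S₀ : OddQuadraticSpace J V₀)

/-- The basis vector `e_i` of `V_h`, viewed in `V = V_h ⊕ V₀`. -/
def basisVec (R : Type*) [CommRing R] (V₀ : Type*) [AddCommGroup V₀] {n : ℕ} (i : Theta n) :
    (Theta n → R) × V₀ := (Pi.single i 1, 0)

theorem hypF_single {n : ℕ} (i j : Theta n) (h : j ≠ i.swap) :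
    hypF J (Pi.single i 1) (Pi.single j 1) = 0 := by
  refine Finset.sum_eq_zero fun k _ => ?_
  by_cases hi : Sum.inl k = i
  · have hj : (Sum.inr k : Theta n) ≠ j := by
      rintro rfl
      exact h (by rw [← hi]; rfl)
    simp [Pi.single_apply, hj]
  · simp [Pi.single_apply, hi]

theorem form_basisVec (i j : Theta n) (h : j ≠ i.swap) :
    (hypSpace n S₀).form (basisVec R V₀ i) (basisVec R V₀ j) = 0 := by
  change (hypF J (Pi.single i 1) (Pi.single j 1) - J.bar (hypF J (Pi.single j 1) (Pi.single i 1)))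
    + S₀.form 0 0 = 0
  have h' : i ≠ j.swap := by
    rintro rfl
    exact h (by simp)
  rw [hypF_single i j h, hypF_single j i h', S₀.form.zero_left]
  simp

theorem Q_basisVec_mem (i : Theta n) :
    (hypSpace n S₀).Q (basisVec R V₀ i) ∈ (hypSpace n S₀).L := by
  have h := hypF_single (J := J) i i (by cases i <;> simp)
  refine ⟨0, 0, ⟨0, ?_⟩, S₀.L.zero_mem, by simp [OddQuadraticSpace.Q]⟩
  change (0 : R) = hypF J (Pi.single i 1) (Pi.single i 1) + (0 + J.bar 0)
  rw [h]
  simp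

theorem isIsotropic_basisVec (i : Theta n) : (hypSpace n S₀).IsIsotropic (basisVec R V₀ i) :=
  ((hypSpace n S₀).isIsotropic_iff _).2 (Q_basisVec_mem S₀ i)

/-- The elementary short root transvection `T_{ij}(x) = T_{e_{-j}, -e_i x ε_j}(0)`, `i ≠ ± j`. -/
noncomputable def shortT (i j : Theta n) (hij : i ≠ j) (_hij' : i ≠ j.swap) (x : R) :
    hypU n S₀ :=
  (hypSpace n S₀).esd (basisVec R V₀ j.swap)
    ⟨-((x * eps J j) • basisVec R V₀ i), 0⟩
    (isIsotropic_basisVec S₀ _)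
    (by
      have h := (hypSpace n S₀).act_mem _ (Q_basisVec_mem S₀ i) (-(x * eps J j))
      convert h using 1
      ext1
      · simp [OddQuadraticSpace.Q]
      · simp [OddQuadraticSpace.Q])
    (by
      change (hypSpace n S₀).form _ (-((x * eps J j) • basisVec R V₀ i)) = 0
      rw [AntiHermitianForm.neg_right, AntiHermitianForm.smul_right,
        form_basisVec S₀ _ _ (by simpa using hij), zero_mul, neg_zero])

/-- The elementary extra short root transvection
`T_i(v₀, x) = T_{e_i, v₀ ε_{-i}}(bar ε_{-i} (bar 1)⁻¹ x ε_{-i})` for `ξ = (v₀, x) ∈ L₀`. -/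
noncomputable def extraT (i : Theta n) (ξ : Heis S₀.form) (hξ : ξ ∈ S₀.L) : hypU n S₀ :=
  (hypSpace n S₀).esd (basisVec R V₀ i)
    ⟨(0, eps J i.swap • ξ.vec), J.bar (eps J i.swap) * J.inv1 * ξ.scal * eps J i.swap⟩
    (isIsotropic_basisVec S₀ _)
    (OddQuadraticSpace.inr_mem (hyp J n) S₀ (S₀.act_mem _ hξ (eps J i.swap)))
    (by
      change (hyp J n).form _ 0 + S₀.form 0 _ = 0
      rw [AntiHermitianForm.zero_right, AntiHermitianForm.zero_left, add_zero])

/-- The elementary subgroup `EU_{2n}(V₀)`. -/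
noncomputable def EU (n : ℕ) (S₀ : OddQuadraticSpace J V₀) : Subgroup (hypU n S₀) :=
  Subgroup.closure
    ({σ | ∃ (i j : Theta n) (hij : i ≠ j) (hij' : i ≠ j.swap) (x : R),
        σ = shortT S₀ i j hij hij' x} ∪
     {σ | ∃ (i : Theta n) (ξ : Heis S₀.form) (hξ : ξ ∈ S₀.L), σ = extraT S₀ i ξ hξ})

variable {S₀}

/-- The preelementary subgroup `EU_{2n}(I₀)` of level `I₀ = (I, M₀)`. -/
noncomputable def preEU (n : ℕ) (K : S₀.OddFormIdeal) : Subgroup (hypU n S₀) :=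
  Subgroup.closure
    ({σ | ∃ (i j : Theta n) (hij : i ≠ j) (hij' : i ≠ j.swap), ∃ x ∈ K.I,
        σ = shortT S₀ i j hij hij' x} ∪
     {σ | ∃ (i : Theta n) (ξ : Heis S₀.form) (hξ : ξ ∈ S₀.L), ξ ∈ K.M ∧ σ = extraT S₀ i ξ hξ})

/-- The elementary subgroup `EU_{2n}(V₀, I₀)` of level `I₀`: the normal closure of the preelementary
subgroup in `EU_{2n}(V₀)`. -/
noncomputable def relEU (n : ℕ) (K : S₀.OddFormIdeal) : Subgroup (hypU n S₀) :=
  Subgroup.closure {σ | ∃ τ ∈ EU n S₀, ∃ ρ ∈ preEU n K, σ = τ * ρ * τ⁻¹}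

/-- The principal congruence subgroup `U_{2n}(V₀, I₀)`. -/
noncomputable def relU (n : ℕ) (K : S₀.OddFormIdeal) : Subgroup (hypU n S₀) :=
  (OddQuadraticSpace.OddFormIdeal.extend (hyp J n) K).principalCongruence

/-- The normalized principal congruence subgroup `NU_{2n}(V₀, I₀)`. -/
noncomputable def NU (n : ℕ) (K : S₀.OddFormIdeal) : Subgroup (hypU n S₀) :=
  (OddQuadraticSpace.OddFormIdeal.extend (hyp J n) K).normalizedCongruence

theorem NU_conj {K : S₀.OddFormIdeal} {σ τ : hypU n S₀} (hσ : σ ∈ NU n K) (hτ : τ ∈ relU n K) :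
    σ * τ * σ⁻¹ ∈ relU n K :=
  (Subgroup.mem_normalizer_iff.1 hσ τ).1 hτ

/-- The full congruence subgroup
`CU_{2n}(V₀, I₀) = {σ ∈ NU | [σ, EU_{2n}(V₀)] ⊆ U_{2n}(V₀, I₀)}`. -/
noncomputable def CU (n : ℕ) (K : S₀.OddFormIdeal) : Subgroup (hypU n S₀) where
  carrier := {σ | σ ∈ NU n K ∧ ∀ τ ∈ EU n S₀, σ * τ * σ⁻¹ * τ⁻¹ ∈ relU n K}
  one_mem' := ⟨Subgroup.one_mem _, fun τ _ => by
    simp⟩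
  mul_mem' := by
    rintro a b ⟨h1, h2⟩ ⟨h3, h4⟩
    refine ⟨Subgroup.mul_mem _ h1 h3, fun τ hτ => ?_⟩
    have h : a * b * τ * (a * b)⁻¹ * τ⁻¹ =
        a * (b * τ * b⁻¹ * τ⁻¹) * a⁻¹ * (a * τ * a⁻¹ * τ⁻¹) := by group
    rw [h]
    exact Subgroup.mul_mem _ (NU_conj h1 (h4 τ hτ)) (h2 τ hτ)
  inv_mem' := by
    rintro a ⟨h1, h2⟩
    refine ⟨Subgroup.inv_mem _ h1, fun τ hτ => ?_⟩
    have h : a⁻¹ * τ * a⁻¹⁻¹ * τ⁻¹ = a⁻¹ * (a * τ * a⁻¹ * τ⁻¹)⁻¹ * a⁻¹⁻¹ := by group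
    rw [h]
    exact NU_conj (Subgroup.inv_mem _ h1) (Subgroup.inv_mem _ (h2 τ hτ))

/-- `H` is E-normal: it is normalized by the elementary subgroup `EU_{2n}(V₀)`. -/
def IsENormal (H : Subgroup (hypU n S₀)) : Prop :=
  EU n S₀ ≤ Subgroup.normalizer (H : Set (hypU n S₀))

/-- The set `{x ∈ R | T_{ij}(x) ∈ H for some i ≠ ± j}`. -/
def levelIdeal (H : Subgroup (hypU n S₀)) : Set R :=
  {x | ∃ (i j : Theta n) (hij : i ≠ j) (hij' : i ≠ j.swap), shortT S₀ i j hij hij' x ∈ H}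

/-- The set `{(v₀, y) ∈ L₀ | T_i(v₀, y) ∈ H for some i}`. -/
def levelParam (H : Subgroup (hypU n S₀)) : Set (Heis S₀.form) :=
  {ξ | ∃ (hξ : ξ ∈ S₀.L) (i : Theta n), extraT S₀ i ξ hξ ∈ H}

/-- The odd form ideal `I₀ = (I, M₀)` is the level of `H`. -/
def IsLevel (H : Subgroup (hypU n S₀)) (K : S₀.OddFormIdeal) : Prop :=
  (K.I : Set R) = levelIdeal H ∧ (K.M : Set (Heis S₀.form)) = levelParam H

/-- The sandwich condition `EU_{2n}(V₀, I₀) ⊆ H ⊆ CU_{2n}(V₀, I₀)`. -/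
def IsSandwiched (H : Subgroup (hypU n S₀)) (K : S₀.OddFormIdeal) : Prop :=
  relEU n K ≤ H ∧ H ≤ CU n K

end Hyperbolic

end OddUnitary

/-!
The sandwich classification rests on one notion: an element `σ` of the unitary group *acts as the
scalar* `a` modulo `K = (I, M₀)` if `σ ξ ≡ ξ ↼ a` modulo `M` for every `ξ` in the odd form parameter
`L` of `V` (`OddFormIdeal.Scal`). Throughout, `T(u, ξ)` (`tv`) denotes the transvection along `u`
with parameter `ξ` in the Heisenberg group, which depends additively on `ξ` (`tv_add`) and is
compatible with conjugation (`tv_conj`). Since `x ↦ bar x (bar 1)⁻¹` is an honest ring involution,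
the pseudoinvolution causes no further complication.

**The level.** For `H` normalized by the elementary subgroup, the `c` with `T(e_i, e_j c) ∈ H` form
an ideal (`EClosed.levelI`), and together with the `ξ ∈ L₀` with `T(e_i, ξ) ∈ H` they form an odd
form ideal (`EClosed.level`), because three hyperbolic planes leave room to move a root element to
any other root by commutators. If `h ∈ H` fixes `e_k`, then `[h, T(e_k, ξ)] = T(e_k, h ξ - ξ)`
lies in `H` (`EClosed.fix_mem`), and such elements can be decomposed into root elements
(`EClosed.mem_ext3_level`).

**Normalized subgroups act by scalars modulo their level** (`EClosed.exists_Scal`). Let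
`b_a = B(h e_k, e_a)`. For `j, l` different from `±k` and from each other, the transvection `τ`
along `b_j e_{-k} - b_{-k} e_j` and `b_j e_l - b_l e_j` fixes `h e_k`. So `h⁻¹ τ h` fixes `e_k` and
is congruent to `τ` modulo `H`, which puts certain products of the `b_a` into the level ideal
(`EClosed.twist_mem`, `EClosed.pair_mem`, `EClosed.gen_mem`). As `B(h e_k, h e_{-k})` is a unit, all
`b_a` with `a ≠ -k` lie there (`EClosed.basis_mem_of_far`, `EClosed.form_mem_levelI`). The same kind
of transvection, now built from the coordinates of `h⁻¹ e_{-i}`, shows that `h` maps `e_j` to a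
multiple of itself modulo the level (`EClosed.exists_scalar`), and conjugation by elementary
transvections shows that the scalar is the same everywhere (`exists_Scal_of_basis`).

**Scalars commute with elementary transformations** modulo the relative elementary subgroup
(`Scal_comm_mem`). Fix `σ` acting by a scalar and consider the `T` with `[σ, T]` in the relative
elementary subgroup. For an isotropic triple of basis vectors `e_{t_a}`, the vectors
`(B(w, σ e_{t_a}))_a` for `w = e_k` and `w = e_{-k}` have a cross product `u` with coefficients in
`I`, such that `σ ∑ u_a e_{t_a}` is orthogonal to the plane of `e_k` and `e_{-k}`. A transvection
along `∑ u_a e_{t_a}` and its conjugate under `σ` are thus both relative elementary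
(`cross_mem_commVec`). Replacing `σ` by `η⁻¹ σ` with `η` relative elementary polarizes this to all
`w` in `M` (`cross_mem_commVec_of_mem`), whence `T(e_i, e_j c)` is obtained for all `c` in `I ^ 2`.
Finally, if the `T(e_i, e_j c x)` commute with `σ` for all `x ∈ I`, then so do the `T(e_i, e_j c)`
(`mem_commSub_of_mul_mem`). Two applications reach `c = 1`, and the general statement on levels
turns this into all of the elementary subgroup.

**Conclusion.** The full congruence subgroup is itself normalized by the elementary subgroup and
acts by scalars modulo `K` (`exists_Scal_of_mem_CU`); conversely, if `σ` and `σ⁻¹` act by scalars,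
then `σ` lies in it (`mem_CU_of_Scal`). Therefore a normalized `H` is sandwiched by its level, and a
sandwiched subgroup is normalized, since its commutators with elementary transformations are
relative elementary. An elementary transvection acting by a scalar modulo `K` has its parameter in
`K`, so `K` is recovered from `H` (`IsSandwiched.isLevel`).
-/

namespace OddUnitary

open OddQuadraticSpace

set_option linter.unusedSectionVars false
set_option linter.unusedSimpArgs false

/-! ### The normalised involution -/

namespace Pseudoinvolution

variable {R : Type*} [CommRing R] (J : Pseudoinvolution R)

/-- The unit `bar 1`; its inverse is `inv1`. -/
noncomputable def mu : R := J.bar 1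

/-- The ring involution `x ↦ bar x (bar 1)⁻¹` underlying a pseudoinvolution of a commutative
ring. -/
noncomputable def cj : R →+* R where
  toFun x := J.bar x * J.inv1
  map_one' := J.mul_inv1
  map_mul' x y := by rw [J.bar_mul']; ring
  map_zero' := by simp
  map_add' x y := by rw [map_add, add_mul]

theorem mu_mul_inv1 : J.mu * J.inv1 = 1 := J.mul_inv1

theorem bar_eq (x : R) : J.bar x = J.mu * J.cj x := by
  change _ = J.bar 1 * (J.bar x * J.inv1)
  linear_combination (-J.bar x) * J.mul_inv1

@[simp] theorem cj_mu : J.cj J.mu = J.inv1 := by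
  change J.bar (J.bar 1) * J.inv1 = _
  rw [J.bar_bar, one_mul]

@[simp] theorem cj_inv1 : J.cj J.inv1 = J.mu := by
  change J.bar J.inv1 * J.inv1 = J.bar 1
  rw [J.bar_inv1]; linear_combination J.bar 1 * J.mul_inv1

@[simp] theorem cj_cj (x : R) : J.cj (J.cj x) = x := by
  change J.bar (J.bar x * J.inv1) * J.inv1 = x
  rw [J.bar_mul', J.bar_bar, J.bar_inv1]
  linear_combination (x * (J.bar 1 * J.inv1 + 1)) * J.mul_inv1

theorem isUnit_mu : IsUnit J.mu := IsUnit.of_mul_eq_one _ J.mu_mul_inv1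

theorem isUnit_inv1 : IsUnit J.inv1 :=
  IsUnit.of_mul_eq_one J.mu (by rw [mul_comm]; exact J.mu_mul_inv1)

end Pseudoinvolution

/-! ### Transvections and the action on the Heisenberg group -/

section General

variable {R : Type*} [CommRing R] {J : Pseudoinvolution R}
variable {V : Type*} [AddCommGroup V] [Module R V]

namespace AntiHermitianForm

variable (B : AntiHermitianForm J V)

theorem smul_left' (x : R) (v w : V) : B (x • v) w = J.cj x * B v w := B.smul_left x v w

theorem anti' (v w : V) : B v w = -(J.mu * J.cj (B w v)) := by rw [B.anti, J.bar_eq]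

theorem eq_zero_comm {v w : V} (h : B v w = 0) : B w v = 0 := by
  rw [B.anti', h, map_zero, mul_zero, neg_zero]

end AntiHermitianForm

theorem Heis.scal_act' {B : AntiHermitianForm J V} (ξ : Heis B) (y : R) :
    (ξ.act y).scal = J.cj y * ξ.scal * y := rfl

namespace OddQuadraticSpace

variable (S : OddQuadraticSpace J V)

theorem form_smul_smul (σ : S.unitaryGroup) (v w : V) :
    S.form (σ • v) (σ • w) = S.form v w := σ.2.1 v w

theorem form_smul_left (σ : S.unitaryGroup) (v w : V) :
    S.form (σ • v) w = S.form v (σ⁻¹ • w) := by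
  rw [← S.form_smul_smul σ v, smul_inv_smul]

theorem ext_smul {S : OddQuadraticSpace J V} {σ τ : S.unitaryGroup}
    (h : ∀ v : V, σ • v = τ • v) : σ = τ :=
  Subtype.ext (LinearEquiv.ext h)

/-- The unitary group acts on the Heisenberg group through the first component. -/
instance : DistribMulAction S.unitaryGroup (Heis S.form) where
  smul σ ξ := ⟨σ • ξ.vec, ξ.scal⟩
  one_smul ξ := rfl
  mul_smul σ τ ξ := by
    change (⟨(σ * τ) • ξ.vec, ξ.scal⟩ : Heis S.form) = ⟨σ • τ • ξ.vec, ξ.scal⟩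
    rw [mul_smul]
  smul_zero σ := by
    change (⟨σ • (0 : V), 0⟩ : Heis S.form) = ⟨0, 0⟩
    rw [smul_zero]
  smul_add σ ξ η := by
    change (⟨σ • (ξ.vec + η.vec), _⟩ : Heis S.form) = ⟨σ • ξ.vec + σ • η.vec,
      ξ.scal + η.scal + S.form (σ • ξ.vec) (σ • η.vec)⟩
    rw [smul_add, S.form_smul_smul, Heis.scal_add]

@[simp] theorem vec_smul (σ : S.unitaryGroup) (ξ : Heis S.form) : (σ • ξ).vec = σ • ξ.vec := rfl
@[simp] theorem scal_smul (σ : S.unitaryGroup) (ξ : Heis S.form) : (σ • ξ).scal = ξ.scal := rfl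

theorem smul_act (σ : S.unitaryGroup) (ξ : Heis S.form) (a : R) :
    σ • ξ.act a = (σ • ξ).act a := by
  ext
  · exact smul_comm σ a ξ.vec
  · rfl

@[simp] theorem vec_Q (v : V) : (S.Q v).vec = v := rfl
@[simp] theorem scal_Q (v : V) : (S.Q v).scal = 0 := rfl

theorem Q_zero : S.Q 0 = 0 := rfl

theorem Q_act (v : V) (a : R) : (S.Q v).act a = S.Q (a • v) := by ext <;> simp

theorem smul_Q (σ : S.unitaryGroup) (v : V) : σ • S.Q v = S.Q (σ • v) := rfl

theorem Q_add {v w : V} (h : S.form v w = 0) : S.Q (v + w) = S.Q v + S.Q w := by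
  ext <;> simp [h]

theorem neg_Q {v : V} (h : S.form v v = 0) : -S.Q v = S.Q (-v) := by
  ext <;> simp [h]

theorem smul_mem_L (σ : S.unitaryGroup) {ξ : Heis S.form} (h : ξ ∈ S.L) : σ • ξ ∈ S.L :=
  S.map_mem_L σ h

theorem Q_smul_mem {v : V} (h : S.Q v ∈ S.L) (a : R) : S.Q (a • v) ∈ S.L := by
  rw [← Q_act]; exact S.act_mem _ h a

theorem form_self_of_Q_mem {u : V} (h : S.Q u ∈ S.L) : S.form u u = 0 :=
  S.form_self_of_isotropic ((S.isIsotropic_iff u).2 h)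

theorem mem_even_of_mem {ξ : Heis S.form} (h : ξ ∈ S.L) : ξ.vec ∈ S.even := ⟨_, h⟩

/-- The conditions under which the transvection `T(u, ξ)` is defined. -/
structure Adm (u : V) (ξ : Heis S.form) : Prop where
  iso : S.Q u ∈ S.L
  mem : ξ ∈ S.L
  orth : S.form u ξ.vec = 0

open Classical in
/-- The Eichler–Siegel–Dickson transvection `T(u, ξ)` as a total function: the identity for
arguments that are not admissible. -/
noncomputable def tv (u : V) (ξ : Heis S.form) : S.unitaryGroup :=
  if h : S.Adm u ξ then S.esd u ξ ((S.isIsotropic_iff u).2 h.iso) h.mem h.orth else 1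

variable {S}

theorem tv_eq_esd {u : V} {ξ : Heis S.form} (hu : S.IsIsotropic u) (hξ : ξ ∈ S.L)
    (h : S.form u ξ.vec = 0) : S.tv u ξ = S.esd u ξ hu hξ h :=
  dif_pos ⟨(S.isIsotropic_iff u).1 hu, hξ, h⟩

namespace Adm

variable {u : V} {ξ η : Heis S.form}

theorem self (h : S.Adm u ξ) : S.form u u = 0 := S.form_self_of_Q_mem h.iso

theorem orth' (h : S.Adm u ξ) : S.form ξ.vec u = 0 := S.form.eq_zero_comm h.orth

theorem add (h : S.Adm u ξ) (h' : S.Adm u η) : S.Adm u (ξ + η) :=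
  ⟨h.iso, S.L.add_mem h.mem h'.mem, by rw [Heis.vec_add, S.form.add_right, h.orth, h'.orth,
    add_zero]⟩

theorem neg (h : S.Adm u ξ) : S.Adm u (-ξ) :=
  ⟨h.iso, S.L.neg_mem h.mem, by rw [Heis.vec_neg, S.form.neg_right, h.orth, neg_zero]⟩

theorem smul (h : S.Adm u ξ) (σ : S.unitaryGroup) : S.Adm (σ • u) (σ • ξ) :=
  ⟨S.smul_mem_L σ h.iso, S.smul_mem_L σ h.mem, by rw [vec_smul, S.form_smul_smul, h.orth]⟩

theorem act (h : S.Adm u ξ) (a : R) : S.Adm u (ξ.act a) :=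
  ⟨h.iso, S.act_mem _ h.mem a, by rw [Heis.vec_act, S.form.smul_right, h.orth, zero_mul]⟩

theorem smul_left (h : S.Adm u ξ) (a : R) : S.Adm (a • u) ξ :=
  ⟨S.Q_smul_mem h.iso a, h.mem, by rw [S.form.smul_left', h.orth, mul_zero]⟩

theorem symm {v : V} (h : S.Adm u (S.Q v)) : S.Adm v (S.Q u) :=
  ⟨h.mem, h.iso, h.orth'⟩

theorem smul_right {v : V} (h : S.Adm u (S.Q v)) (a : R) : S.Adm u (S.Q (a • v)) := by
  rw [← Q_act]; exact h.act a

end Adm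

theorem Adm.zero {u : V} (h : S.Q u ∈ S.L) : S.Adm u 0 :=
  ⟨h, S.L.zero_mem, S.form.zero_right _⟩

theorem tv_smul {u : V} {ξ : Heis S.form} (h : S.Adm u ξ) (w : V) :
    S.tv u ξ • w = w + (J.inv1 * (S.form ξ.vec w + ξ.scal * S.form u w)) • u +
      S.form u w • ξ.vec := by
  rw [tv, dif_pos h]; rfl

theorem tv_add {u : V} {ξ η : Heis S.form} (h : S.Adm u ξ) (h' : S.Adm u η) :
    S.tv u (ξ + η) = S.tv u ξ * S.tv u η := by
  refine ext_smul fun w => ?_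
  have := S.esdMap_add ((S.isIsotropic_iff u).2 h.iso) ξ η h'.orth h.orth w
  rw [mul_smul, tv_smul h, tv_smul h', tv_smul (h.add h')]
  exact this.symm

theorem tv_zero (u : V) : S.tv u 0 = 1 := by
  by_cases h : S.Adm u 0
  · refine ext_smul fun w => ?_
    rw [tv_smul h]
    simp [S.form.zero_left]
  · rw [tv, dif_neg h]

theorem tv_neg {u : V} {ξ : Heis S.form} (h : S.Adm u ξ) : S.tv u (-ξ) = (S.tv u ξ)⁻¹ := by
  rw [eq_inv_iff_mul_eq_one, ← tv_add h.neg h, neg_add_cancel, tv_zero]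

theorem tv_conj (σ : S.unitaryGroup) (u : V) (ξ : Heis S.form) :
    σ * S.tv u ξ * σ⁻¹ = S.tv (σ • u) (σ • ξ) := by
  by_cases h : S.Adm u ξ
  · refine ext_smul fun w => ?_
    rw [mul_smul, mul_smul, tv_smul h, tv_smul (h.smul σ), smul_add, smul_add, smul_inv_smul,
      smul_comm σ, smul_comm σ, vec_smul, S.form_smul_left, S.form_smul_left, scal_smul]
  · have h' : ¬S.Adm (σ • u) (σ • ξ) := fun h' => h (by simpa using h'.smul σ⁻¹)
    rw [tv, tv, dif_neg h, dif_neg h', mul_one, mul_inv_cancel]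

theorem tv_smul_left {u : V} {ξ : Heis S.form} (h : S.Adm u ξ) (a : R) :
    S.tv (a • u) ξ = S.tv u (ξ.act (J.cj a)) := by
  refine ext_smul fun w => ?_
  rw [tv_smul (h.smul_left a), tv_smul (h.act _)]
  simp only [Heis.vec_act, Heis.scal_act', S.form.smul_left', J.cj_cj]
  module

/-- On orthogonal isotropic vectors the transvection is symmetric up to the unit `(bar 1)⁻¹`. -/
theorem tv_swap {u v : V} (h : S.Adm u (S.Q v)) :
    S.tv u (S.Q v) = S.tv v (S.Q (J.inv1 • u)) := by
  refine ext_smul fun w => ?_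
  rw [tv_smul h, tv_smul (h.symm.smul_right _)]
  simp only [vec_Q, scal_Q, S.form.smul_left', J.cj_inv1]
  linear_combination (norm := module) (-(S.form u w) * J.mu_mul_inv1) • v

/-- The transvection `T(u, (v, 0))` is additive in `u` as long as everything is orthogonal. -/
theorem tv_add_left {u u' v : V} (h : S.Adm u (S.Q v)) (h' : S.Adm u' (S.Q v))
    (hu : S.form u u' = 0) : S.tv (u + u') (S.Q v) = S.tv u (S.Q v) * S.tv u' (S.Q v) := by
  have h2 : S.Adm (u + u') (S.Q v) :=
    ⟨by rw [S.Q_add hu]; exact S.L.add_mem h.iso h'.iso, h.mem, by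
      rw [S.form.add_left, h.orth, h'.orth, add_zero]⟩
  refine ext_smul fun w => ?_
  rw [mul_smul, tv_smul h2, tv_smul h', tv_smul h]
  have e1 : S.form v v = 0 := h.symm.self
  have e2 : S.form v u' = 0 := h'.orth'
  have e3 : S.form u v = 0 := h.orth
  simp only [vec_Q, scal_Q, S.form.add_left, S.form.add_right, S.form.smul_right, hu, e1, e2, e3]
  module

/-- The action of a transvection on `Q w`, written in the Heisenberg group. -/
theorem tv_smul_Q {u : V} {ξ : Heis S.form} (h : S.Adm u ξ) (w : V) :
    S.tv u ξ • S.Q w = S.Q w +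
      (S.Q u).act (J.inv1 * (S.form ξ.vec w + ξ.scal * S.form u w)) + ξ.act (S.form u w) +
      ⟨0, J.cj (S.form u w) * S.form ξ.vec w + J.bar (J.cj (S.form u w) * S.form ξ.vec w)⟩ := by
  ext
  · simp only [vec_smul, vec_Q, tv_smul h, Heis.vec_add, Heis.vec_act, add_zero]
  · simp only [scal_smul, scal_Q, vec_Q, Heis.vec_add, Heis.vec_act, Heis.scal_add, Heis.scal_act',
      S.form.add_left, S.form.smul_left', S.form.smul_right, S.form.zero_right, h.orth, J.bar_eq,
      map_mul, J.cj_cj, S.form.anti' w]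
    linear_combination (J.cj (S.form u w) * (S.form ξ.vec w + ξ.scal * S.form u w)) * J.mu_mul_inv1

end OddQuadraticSpace

end General

/-! ### Congruences modulo an odd form ideal -/

section Congruence

variable {R : Type*} [CommRing R] {J : Pseudoinvolution R}
variable {V : Type*} [AddCommGroup V] [Module R V]

namespace OddQuadraticSpace

variable {S : OddQuadraticSpace J V}

theorem tv_smul_heis {u : V} {ξ : Heis S.form} (h : S.Adm u ξ) (η : Heis S.form) :
    S.tv u ξ • η = η +
      ((S.Q u).act (J.inv1 * (S.form ξ.vec η.vec + ξ.scal * S.form u η.vec)) +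
      ξ.act (S.form u η.vec) +
      ⟨0, J.cj (S.form u η.vec) * S.form ξ.vec η.vec +
        J.bar (J.cj (S.form u η.vec) * S.form ξ.vec η.vec)⟩) := by
  have h1 : ∀ ζ : Heis S.form, ζ = S.Q ζ.vec + ⟨0, ζ.scal⟩ := fun ζ => by
    ext <;> simp [S.form.zero_right]
  have h2 : S.tv u ξ • η = S.tv u ξ • S.Q η.vec + ⟨0, η.scal⟩ := by
    ext <;> simp [S.form.zero_right]
  rw [h2, tv_smul_Q h]
  ext
  · simp only [Heis.vec_add, add_zero, vec_Q]; abel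
  · simp only [Heis.scal_add, Heis.vec_add, S.form.add_right, S.form.zero_right,
      S.form.add_left, scal_Q, vec_Q]
    ring

namespace OddFormIdeal

variable (K : S.OddFormIdeal)

theorem cj_mem {x : R} (hx : x ∈ K.I) : J.cj x ∈ K.I := K.I.mul_mem_right _ (K.bar_mem hx)

theorem mem_L {ξ : Heis S.form} (h : ξ ∈ K.M) : ξ ∈ S.L := (K.le_Mmax h).1

theorem act_mem_M {ξ : Heis S.form} (h : ξ ∈ S.L) {a : R} (ha : a ∈ K.I) : ξ.act a ∈ K.M :=
  K.Mmin_le (AddSubgroup.subset_closure (Or.inl ⟨ξ, h, a, ha, rfl⟩))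

theorem add_bar_mem_M {x : R} (hx : x ∈ K.I) : (⟨0, x + J.bar x⟩ : Heis S.form) ∈ K.M :=
  K.Mmin_le (AddSubgroup.subset_closure (Or.inr ⟨x, hx, rfl⟩))

theorem form_mem {ξ : Heis S.form} (h : ξ ∈ K.M) {w : V} (hw : w ∈ S.even) :
    S.form ξ.vec w ∈ K.I := (K.le_Mmax h).2.2 w hw

theorem form_mem' {ξ : Heis S.form} (h : ξ ∈ K.M) {w : V} (hw : w ∈ S.even) :
    S.form w ξ.vec ∈ K.I := by
  rw [S.form.anti']
  exact K.I.neg_mem (K.I.mul_mem_left _ (K.cj_mem (K.form_mem h hw)))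

/-- Commutators in the Heisenberg group have the form `(0, x + bar x)` with `x` a value of `B`. -/
theorem comm_mem {ξ η : Heis S.form} (h : S.form ξ.vec η.vec ∈ K.I) :
    -(η + ξ) + (ξ + η) ∈ K.M := by
  convert K.add_bar_mem_M h using 1
  ext
  · simp only [Heis.vec_add, Heis.vec_neg]; abel
  · simp only [Heis.scal_add, Heis.vec_add, Heis.vec_neg, Heis.scal_neg, S.form.neg_left,
      S.form.add_left, S.form.add_right, J.bar_eq]
    linear_combination -S.form.anti' η.vec ξ.vec

theorem conj_mem {ξ η : Heis S.form} (h : ξ ∈ K.M) (hη : η ∈ S.L) : -η + ξ + η ∈ K.M := by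
  have h1 : -η + ξ + η = ξ + (-(η + ξ) + (ξ + η)) := by simp [neg_add_rev, add_assoc]
  rw [h1]
  exact K.M.add_mem h (K.comm_mem (K.form_mem h (S.mem_even_of_mem hη)))

/-- Congruence of elements of `L` modulo `M`. Since `M` is normal in `L`, left and right cosets
agree. -/
structure Cg (ξ η : Heis S.form) : Prop where
  left : ξ ∈ S.L
  right : η ∈ S.L
  mem : -ξ + η ∈ K.M

namespace Cg

variable {K} {ξ η ζ ξ' η' : Heis S.form}

theorem refl (h : ξ ∈ S.L) : K.Cg ξ ξ := ⟨h, h, by rw [neg_add_cancel]; exact K.M.zero_mem⟩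

theorem symm (h : K.Cg ξ η) : K.Cg η ξ :=
  ⟨h.right, h.left, by simpa using K.M.neg_mem h.mem⟩

theorem trans (h : K.Cg ξ η) (h' : K.Cg η ζ) : K.Cg ξ ζ :=
  ⟨h.left, h'.right, by simpa [add_assoc] using K.M.add_mem h.mem h'.mem⟩

theorem add (h : K.Cg ξ η) (h' : K.Cg ξ' η') : K.Cg (ξ + ξ') (η + η') :=
  ⟨S.L.add_mem h.left h'.left, S.L.add_mem h.right h'.right, by
    simpa [add_assoc] using K.M.add_mem (K.conj_mem h.mem h'.left) h'.mem⟩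

theorem neg (h : K.Cg ξ η) : K.Cg (-ξ) (-η) :=
  ⟨S.L.neg_mem h.left, S.L.neg_mem h.right, by
    have := K.conj_mem (K.M.neg_mem h.mem) (S.L.neg_mem h.left)
    simpa [add_assoc] using this⟩

theorem act (h : K.Cg ξ η) (a : R) : K.Cg (ξ.act a) (η.act a) :=
  ⟨S.act_mem _ h.left a, S.act_mem _ h.right a, by
    rw [← Heis.neg_act, ← Heis.add_act]; exact K.act_mem _ h.mem a⟩

theorem zero_left (h : ξ ∈ K.M) : K.Cg 0 ξ := ⟨S.L.zero_mem, K.mem_L h, by simpa using h⟩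

theorem mem_iff (h : K.Cg ξ η) : ξ ∈ K.M ↔ η ∈ K.M := by
  constructor
  · intro h1; simpa using K.M.add_mem h1 h.mem
  · intro h1; simpa using K.M.add_mem h1 h.symm.mem

theorem form_mem (h : K.Cg ξ η) {w : V} (hw : w ∈ S.even) :
    S.form ξ.vec w - S.form η.vec w ∈ K.I := by
  have := K.I.neg_mem (K.form_mem h.mem hw)
  rw [Heis.vec_add, Heis.vec_neg, S.form.add_left, S.form.neg_left] at this
  convert this using 1; ring

theorem form_mem' (h : K.Cg ξ η) {w : V} (hw : w ∈ S.even) :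
    S.form w ξ.vec - S.form w η.vec ∈ K.I := by
  have := K.I.neg_mem (K.form_mem' h.mem hw)
  rw [Heis.vec_add, Heis.vec_neg, S.form.add_right, S.form.neg_right] at this
  convert this using 1; ring

theorem add_left_cancel (h : K.Cg (ξ + η) (ξ' + η')) (h' : K.Cg ξ ξ') : K.Cg η η' := by
  simpa using h'.neg.add h

theorem add_mem_right (h : ξ ∈ S.L) (hη : η ∈ K.M) : K.Cg ξ (ξ + η) := by
  simpa using (refl h).add (zero_left hη)

theorem add_mem_left (h : ξ ∈ S.L) (hη : η ∈ K.M) : K.Cg ξ (η + ξ) := by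
  simpa using (zero_left hη).add (refl h)

/-- Modulo `M`, the action of the monoid `R` on `L` only depends on residue classes modulo `I`:
the two sides differ by an element of `L ↼ I` and one of the form `(0, x + bar x)`, `x ∈ I`. -/
theorem act_right (h : ξ ∈ S.L) {a b : R} (hab : a - b ∈ K.I) : K.Cg (ξ.act a) (ξ.act b) := by
  refine ⟨S.act_mem _ h a, S.act_mem _ h b, ?_⟩
  have hba : b - a ∈ K.I := by simpa using K.I.neg_mem hab
  have h1 := K.M.add_mem (K.act_mem_M h hba) (K.add_bar_mem_M
    (x := J.cj (b - a) * ξ.scal * a) (K.I.mul_mem_right _ (K.I.mul_mem_right _ (K.cj_mem hba))))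
  convert h1 using 1
  have h2 := S.form_self_of_mem h
  ext
  · simp only [Heis.vec_add, Heis.vec_neg, Heis.vec_act]; module
  · simp only [Heis.scal_add, Heis.vec_neg, Heis.vec_act, Heis.scal_neg, Heis.scal_act',
      S.form.neg_left, S.form.smul_left', S.form.smul_right, S.form.zero_right, J.bar_eq, map_mul,
      map_sub, J.cj_cj, h2]
    ring

theorem act_one (h : ξ ∈ S.L) {a : R} (ha : a - 1 ∈ K.I) : K.Cg (ξ.act a) ξ := by
  have h1 : ξ.act 1 = ξ := by ext <;> simp [J.mul_inv1]
  have := act_right h ha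
  rwa [h1] at this

end Cg

theorem tv_smul_mem {u : V} {ξ : Heis S.form} (h : S.Adm u ξ) {η : Heis S.form} (hη : η ∈ K.M) :
    S.tv u ξ • η ∈ K.M := by
  have hB := K.form_mem' hη ⟨_, h.iso⟩
  have hB' := K.form_mem' hη (S.mem_even_of_mem h.mem)
  rw [tv_smul_heis h]
  refine K.M.add_mem hη (K.M.add_mem (K.M.add_mem (K.act_mem_M h.iso ?_) (K.act_mem_M h.mem hB))
    (K.add_bar_mem_M (K.I.mul_mem_left _ hB')))
  exact K.I.mul_mem_left _ (K.I.add_mem hB' (K.I.mul_mem_left _ hB))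

/-- The principal congruence subgroup, described on `L` instead of the even part of `V`: the
difference of `σ ξ` and `ξ` only depends on the first component of `ξ`. -/
theorem mem_principalCongruence_iff {σ : S.unitaryGroup} :
    σ ∈ K.principalCongruence ↔ ∀ ξ ∈ S.L, K.Cg ξ (σ • ξ) := by
  have key : ∀ ξ : Heis S.form, -(σ • ξ) + ξ = -(S.Q (σ • ξ.vec)) + S.Q ξ.vec := fun ξ => by
    ext
    · simp
    · simp [S.form_smul_smul]
  have key2 : ∀ v : V, K.relQuad ((σ : V ≃ₗ[R] V) v) = K.relQuad v ↔
      -(S.Q (σ • v)) + S.Q v ∈ K.M := fun v => QuotientAddGroup.eq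
  constructor
  · intro h ξ hξ
    refine Cg.symm ⟨S.smul_mem_L σ hξ, hξ, ?_⟩
    rw [key]
    exact (key2 _).1 (h ξ.vec ⟨_, hξ⟩)
  · rintro h v ⟨x, hx⟩
    refine (key2 v).2 ?_
    have h1 := (h _ hx).symm.mem
    rwa [key] at h1

/-- `σ` acts on `L` modulo `M` as the scalar `a`. -/
def Scal (σ : S.unitaryGroup) (a : R) : Prop := ∀ ξ ∈ S.L, K.Cg (σ • ξ) (ξ.act a)

theorem Scal.smul_mem {K : S.OddFormIdeal} {σ : S.unitaryGroup} {a : R} (h : K.Scal σ a)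
    {ξ : Heis S.form} (hξ : ξ ∈ K.M) : σ • ξ ∈ K.M :=
  (h ξ (K.mem_L hξ)).mem_iff.2 (K.act_mem _ hξ a)

theorem Cg.smul {K : S.OddFormIdeal} {ξ η : Heis S.form} (h : K.Cg ξ η) {σ : S.unitaryGroup}
    (hσ : ∀ ζ ∈ K.M, σ • ζ ∈ K.M) : K.Cg (σ • ξ) (σ • η) :=
  ⟨S.smul_mem_L σ h.left, S.smul_mem_L σ h.right, by
    rw [← smul_neg, ← smul_add]; exact hσ _ h.mem⟩

theorem normalizer_of_smul_mem {σ : S.unitaryGroup} (h : ∀ ζ ∈ K.M, σ • ζ ∈ K.M)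
    (h' : ∀ ζ ∈ K.M, σ⁻¹ • ζ ∈ K.M) : σ ∈ K.normalizedCongruence := by
  have key : ∀ {ρ : S.unitaryGroup}, (∀ ζ ∈ K.M, ρ • ζ ∈ K.M) →
      ∀ τ ∈ K.principalCongruence, ρ * τ * ρ⁻¹ ∈ K.principalCongruence := by
    intro ρ hρ τ hτ
    rw [mem_principalCongruence_iff] at hτ ⊢
    intro ξ hξ
    have := (hτ _ (S.smul_mem_L ρ⁻¹ hξ)).smul hρ
    rwa [smul_inv_smul, ← mul_smul, ← mul_smul] at this
  refine Subgroup.mem_normalizer_iff.2 fun τ => ⟨key h τ, fun hτ => ?_⟩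
  have := key h' _ hτ
  simpa [mul_assoc] using this

end OddFormIdeal
end OddQuadraticSpace
end Congruence

/-! ### Coordinates in the hyperbolic space -/

section Coordinates

variable {R : Type*} [CommRing R] {J : Pseudoinvolution R}
variable {V₀ : Type*} [AddCommGroup V₀] [Module R V₀] (S₀ : OddQuadraticSpace J V₀)

local notation "𝐞" => basisVec R V₀
local notation "𝕊" => hypSpace 3 S₀

variable (J) in
/-- The value `B(e_i, e_{-i})`. -/
noncomputable def hsgn : Theta 3 → R
  | Sum.inl _ => 1
  | Sum.inr _ => -J.mu

variable (J) in
theorem isUnit_hsgn (i : Theta 3) : IsUnit (hsgn J i) := by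
  cases i
  · exact isUnit_one
  · exact J.isUnit_mu.neg

variable (J) in
/-- Antisymmetry of the form, in terms of the values `B(e_i, e_{-i})`. -/
theorem mu_cj_hsgn (i : Theta 3) : J.mu * J.cj (hsgn J i) = -hsgn J i.swap := by
  cases i
  · simp [hsgn]
  · simp [hsgn, J.mu_mul_inv1]

theorem hypSpace_form (v w : (Theta 3 → R) × V₀) :
    (𝕊).form v w = hypF J v.1 w.1 - J.bar (hypF J w.1 v.1) + S₀.form v.2 w.2 := rfl

theorem form_basis_left (i : Theta 3) (w : (Theta 3 → R) × V₀) :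
    (𝕊).form (𝐞 i) w = hsgn J i * w.1 i.swap := by
  rw [hypSpace_form]
  cases i with
  | inl k =>
    simp [basisVec, hypF, hsgn, S₀.form.zero_left, Pi.single_apply, J.bar_eq, J.mu_mul_inv1,
      apply_ite]
  | inr k =>
    simp [basisVec, hypF, hsgn, S₀.form.zero_left, Pi.single_apply, J.bar_eq]
    linear_combination (J.mu * w.1 (Sum.inl k)) * J.mu_mul_inv1

theorem form_basis_right (i : Theta 3) (w : (Theta 3 → R) × V₀) :
    (𝕊).form w (𝐞 i) = hsgn J i.swap * J.cj (w.1 i.swap) := by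
  rw [AntiHermitianForm.anti', form_basis_left, map_mul]
  linear_combination (-J.cj (w.1 i.swap)) * mu_cj_hsgn J i

theorem basis_coord_self (i : Theta 3) : (𝐞 i).1 i = 1 := Pi.single_eq_same _ _

theorem basis_coord_ne {i j : Theta 3} (h : j ≠ i) : (𝐞 i).1 j = 0 := Pi.single_eq_of_ne h _

theorem form_basis_swap (i : Theta 3) : (𝕊).form (𝐞 i) (𝐞 i.swap) = hsgn J i := by
  rw [form_basis_left, basis_coord_self, mul_one]

theorem form_basis_swap' (i : Theta 3) : (𝕊).form (𝐞 i.swap) (𝐞 i) = hsgn J i.swap := by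
  have := form_basis_swap S₀ i.swap
  rwa [Sum.swap_swap] at this

/-- The projection of the Heisenberg group of `V` to that of `V₀` which corrects the second
component by the value of `F_h`; it is a homomorphism modulo elements `(0, x + bar x)`. -/
noncomputable def pi0 (ξ : Heis (𝕊).form) : Heis S₀.form :=
  ⟨ξ.vec.2, ξ.scal - hypF J ξ.vec.1 ξ.vec.1⟩

/-- The embedding of the Heisenberg group of `V₀`. -/
noncomputable abbrev inr0 : Heis S₀.form →+ Heis (𝕊).form := inr (hyp J 3) S₀

@[simp] theorem vec_inr0 (ξ : Heis S₀.form) : (inr0 S₀ ξ).vec = (0, ξ.vec) := rfl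
@[simp] theorem scal_inr0 (ξ : Heis S₀.form) : (inr0 S₀ ξ).scal = ξ.scal := rfl

theorem heis_decomp (ξ : Heis (𝕊).form) :
    ξ = (𝕊).Q (ξ.vec.1 (Sum.inl 0) • 𝐞 (Sum.inl 0)) + (𝕊).Q (ξ.vec.1 (Sum.inl 1) • 𝐞 (Sum.inl 1)) +
      (𝕊).Q (ξ.vec.1 (Sum.inl 2) • 𝐞 (Sum.inl 2)) + (𝕊).Q (ξ.vec.1 (Sum.inr 0) • 𝐞 (Sum.inr 0)) +
      (𝕊).Q (ξ.vec.1 (Sum.inr 1) • 𝐞 (Sum.inr 1)) + (𝕊).Q (ξ.vec.1 (Sum.inr 2) • 𝐞 (Sum.inr 2)) +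
      inr0 S₀ (pi0 S₀ ξ) := by
  ext
  · rename_i k
    rcases k with k | k <;> fin_cases k <;> simp [basisVec, Pi.single_apply]
  · simp [basisVec, pi0]
  · simp [pi0, form_basis_right, form_basis_left, AntiHermitianForm.add_left,
      AntiHermitianForm.smul_right, hsgn, basisVec, Pi.single_apply, hypF, Fin.sum_univ_three]
    simp [hypSpace_form, hypF, Pi.single_apply, S₀.form.zero_left, S₀.form.zero_right,
      Pseudoinvolution.cj]
/-- To show that `ξ` lies in a subgroup of the Heisenberg group it suffices to treat its
hyperbolic components and its component in `V₀`. -/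
theorem mem_of_components {D : AddSubgroup (Heis (𝕊).form)} {ξ : Heis (𝕊).form}
    (h : ∀ i, (𝕊).Q (ξ.vec.1 i • 𝐞 i) ∈ D) (h0 : inr0 S₀ (pi0 S₀ ξ) ∈ D) : ξ ∈ D := by
  rw [heis_decomp S₀ ξ]
  exact D.add_mem (D.add_mem (D.add_mem (D.add_mem (D.add_mem (D.add_mem (h _) (h _)) (h _)) (h _))
    (h _)) (h _)) h0

/-- The component in `V₀` lies in a subgroup containing the element and its hyperbolic
components. -/
theorem inr0_pi0_mem {D : AddSubgroup (Heis (𝕊).form)} {ξ : Heis (𝕊).form}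
    (h : ∀ i, (𝕊).Q (ξ.vec.1 i • 𝐞 i) ∈ D) (h0 : ξ ∈ D) : inr0 S₀ (pi0 S₀ ξ) ∈ D := by
  rw [heis_decomp S₀ ξ] at h0
  exact (D.add_mem_cancel_left (D.add_mem (D.add_mem (D.add_mem (D.add_mem (D.add_mem (h _) (h _))
    (h _)) (h _)) (h _)) (h _))).1 h0

end Coordinates

/-! ### Elementary transvections -/

section Elementary

variable {R : Type*} [CommRing R] {J : Pseudoinvolution R}
variable {V₀ : Type*} [AddCommGroup V₀] [Module R V₀] (S₀ : OddQuadraticSpace J V₀)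

local notation "𝐞" => basisVec R V₀
local notation "𝕊" => hypSpace 3 S₀

theorem pi0_add (ξ η : Heis (𝕊).form) : pi0 S₀ (ξ + η) = pi0 S₀ ξ + pi0 S₀ η +
    ⟨0, -hypF J η.vec.1 ξ.vec.1 + J.bar (-hypF J η.vec.1 ξ.vec.1)⟩ := by
  ext
  · simp [pi0]
  · simp only [pi0, Heis.vec_add, Heis.scal_add, hypSpace_form, Prod.fst_add, Prod.snd_add,
      hypF_add_left, hypF_add_right, S₀.form.zero_right, map_neg]
    ring

theorem pi0_neg (ξ : Heis (𝕊).form) : pi0 S₀ (-ξ) = -pi0 S₀ ξ +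
    ⟨0, -hypF J ξ.vec.1 ξ.vec.1 + J.bar (-hypF J ξ.vec.1 ξ.vec.1)⟩ := by
  ext
  · simp [pi0]
  · have h : hypF J (-ξ.vec).1 (-ξ.vec).1 = hypF J ξ.vec.1 ξ.vec.1 := by simp [hypF]
    simp only [pi0, Heis.vec_neg, Heis.scal_add, Heis.scal_neg, hypSpace_form,
      S₀.form.zero_right, h, map_neg]
    ring

theorem pi0_inr0 (ξ : Heis S₀.form) : pi0 S₀ (inr0 S₀ ξ) = ξ := by
  ext <;> simp [pi0, hypF]

theorem inr0_act (ξ : Heis S₀.form) (a : R) : (inr0 S₀ ξ).act a = inr0 S₀ (ξ.act a) :=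
  inr_act _ _ _ _

theorem mem_L_iff {ξ : Heis (𝕊).form} : ξ ∈ (𝕊).L ↔ pi0 S₀ ξ ∈ S₀.L := by
  constructor
  · rintro ⟨x, x', ⟨y, hy⟩, h2, h3⟩
    have h4 := S₀.L.add_mem h2 (S₀.Lmin_le ⟨y, rfl⟩)
    convert h4 using 1
    ext
    · simp [pi0]
    · simp only at hy
      simp only [pi0, Heis.scal_add, S₀.form.zero_right, h3, hy]; ring
  · intro h
    exact ⟨hypF J ξ.vec.1 ξ.vec.1, _, ⟨0, by simp⟩, h, by simp [pi0]⟩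

theorem inr0_mem_L {ξ : Heis S₀.form} (h : ξ ∈ S₀.L) : inr0 S₀ ξ ∈ (𝕊).L := inr_mem _ _ h

theorem Q_basis_mem (i : Theta 3) : (𝕊).Q (𝐞 i) ∈ (𝕊).L := Q_basisVec_mem S₀ i

theorem Q_smul_basis_mem (c : R) (i : Theta 3) : (𝕊).Q (c • 𝐞 i) ∈ (𝕊).L :=
  (𝕊).Q_smul_mem (Q_basis_mem S₀ i) c

theorem basis_mem_even (i : Theta 3) : 𝐞 i ∈ (𝕊).even := ⟨0, Q_basis_mem S₀ i⟩

theorem form_basis {i j : Theta 3} (h : j ≠ i.swap) : (𝕊).form (𝐞 i) (𝐞 j) = 0 :=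
  form_basisVec S₀ i j h

theorem form_basis_self (i : Theta 3) : (𝕊).form (𝐞 i) (𝐞 i) = 0 :=
  form_basis S₀ (by cases i <;> simp)

variable {S₀}

/-- The odd form ideal on `V` that corresponds to an odd form ideal on `V₀`. -/
noncomputable def ext3 (K : S₀.OddFormIdeal) : (𝕊).OddFormIdeal :=
  OddFormIdeal.extend (hyp J 3) K

/-- The parameter `M` of the extended odd form ideal, in coordinates. -/
theorem mem_ext3_iff (K : S₀.OddFormIdeal) {ξ : Heis (𝕊).form} :
    ξ ∈ (ext3 K).M ↔ (∀ i, ξ.vec.1 i ∈ K.I) ∧ pi0 S₀ ξ ∈ K.M := by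
  have hF : ∀ {v w : Theta 3 → R}, (∀ i, v i ∈ K.I) → hypF J v w ∈ K.I := fun {v w} hv =>
    K.I.sum_mem fun i _ => K.I.mul_mem_right _ (K.I.mul_mem_right _ (K.bar_mem (hv _)))
  constructor
  · intro h
    have hM : (ext3 K).M = AddSubgroup.closure
        ({ζ : Heis (𝕊).form | ∃ ξ ∈ (hyp J 3).L, ∃ a ∈ K.I,
          ζ = (⟨((ξ.act a).vec, 0), (ξ.act a).scal⟩ : Heis (𝕊).form)} ∪
        {ζ | ∃ η ∈ K.M, ζ = inr0 S₀ η}) := rfl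
    rw [hM] at h
    induction h using AddSubgroup.closure_induction with
    | mem ζ hζ =>
      rcases hζ with ⟨ξ, ⟨x, hx⟩, a, ha, rfl⟩ | ⟨η, hη, rfl⟩
      · refine ⟨fun i => K.I.mul_mem_right _ ha, ?_⟩
        convert K.add_bar_mem_M (x := J.cj a * x * a) (K.I.mul_mem_left _ ha) using 1
        ext
        · rfl
        · change J.cj a * ξ.scal * a - hypF J (a • ξ.vec) (a • ξ.vec) = _
          rw [hypF_smul_smul, hx]
          change _ - J.cj a * _ * _ = _
          rw [J.bar_eq, J.bar_eq, map_mul, map_mul, J.cj_cj]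
          ring
      · refine ⟨fun i => K.I.zero_mem, ?_⟩
        rwa [pi0_inr0]
    | zero => exact ⟨fun i => K.I.zero_mem, by
        convert K.M.zero_mem using 1
        ext <;> simp [pi0, hypF]⟩
    | add a b _ _ ha hb =>
      refine ⟨fun i => K.I.add_mem (ha.1 i) (hb.1 i), ?_⟩
      rw [pi0_add]
      exact K.M.add_mem (K.M.add_mem ha.2 hb.2) (K.add_bar_mem_M (K.I.neg_mem (hF hb.1)))
    | neg a _ ha =>
      refine ⟨fun i => K.I.neg_mem (ha.1 i), ?_⟩
      rw [pi0_neg]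
      exact K.M.add_mem (K.M.neg_mem ha.2) (K.add_bar_mem_M (K.I.neg_mem (hF ha.1)))
  · rintro ⟨h1, h2⟩
    refine mem_of_components S₀ (fun i => ?_) ?_
    · rw [← Q_act]
      exact (ext3 K).act_mem_M (Q_basis_mem S₀ i) (h1 i)
    · exact AddSubgroup.subset_closure (Or.inr ⟨_, h2, rfl⟩)

theorem inr0_mem_ext3 (K : S₀.OddFormIdeal) {ξ : Heis S₀.form} (h : ξ ∈ K.M) :
    inr0 S₀ ξ ∈ (ext3 K).M := AddSubgroup.subset_closure (Or.inr ⟨_, h, rfl⟩)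

theorem Q_smul_basis_mem_ext3 (K : S₀.OddFormIdeal) {c : R} (h : c ∈ K.I) (i : Theta 3) :
    (𝕊).Q (c • 𝐞 i) ∈ (ext3 K).M := by
  rw [← Q_act]
  exact (ext3 K).act_mem_M (Q_basis_mem S₀ i) h

theorem coord_mem_of_Cg {K : S₀.OddFormIdeal} {ξ η : Heis (𝕊).form} (h : (ext3 K).Cg ξ η)
    (i : Theta 3) : ξ.vec.1 i - η.vec.1 i ∈ K.I := by
  have := K.I.neg_mem (((mem_ext3_iff K).1 h.mem).1 i)
  have h2 : (-ξ + η).vec.1 i = -ξ.vec.1 i + η.vec.1 i := rfl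
  rw [h2] at this
  convert this using 1; ring

theorem isUnit_eps (i : Theta 3) : IsUnit (eps J i) := by
  cases i
  · exact J.isUnit_inv1
  · exact isUnit_one.neg

variable (S₀) in
theorem shortT_eq_tv (i j : Theta 3) (hij : i ≠ j) (hij' : i ≠ j.swap) (x : R) :
    shortT S₀ i j hij hij' x = (𝕊).tv (𝐞 j.swap) ((𝕊).Q (-(x * eps J j) • 𝐞 i)) := by
  rw [neg_smul]
  exact (tv_eq_esd _ _ _).symm

variable (S₀) in
theorem extraT_eq_tv (i : Theta 3) (ξ : Heis S₀.form) (hξ : ξ ∈ S₀.L) :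
    extraT S₀ i ξ hξ = (𝕊).tv (𝐞 i) (inr0 S₀ (ξ.act (eps J i.swap))) :=
  (tv_eq_esd _ _ _).symm

theorem adm_short {i j : Theta 3} (h : j ≠ i.swap) (c : R) :
    (𝕊).Adm (𝐞 i) ((𝕊).Q (c • 𝐞 j)) :=
  ⟨Q_basis_mem S₀ i, Q_smul_basis_mem S₀ c j, by
    rw [vec_Q, AntiHermitianForm.smul_right, form_basis S₀ h, zero_mul]⟩

theorem adm_extra (i : Theta 3) {ξ : Heis S₀.form} (h : ξ ∈ S₀.L) :
    (𝕊).Adm (𝐞 i) (inr0 S₀ ξ) :=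
  ⟨Q_basis_mem S₀ i, inr0_mem_L S₀ h, by rw [form_basis_left]; simp⟩

/-- A transvection `T(e_k, (e_k c, 0))` is a long root transvection, i.e. one with parameter
`(0, x + bar x)`. -/
theorem tv_self (k : Theta 3) (c : R) : (𝕊).tv (𝐞 k) ((𝕊).Q (c • 𝐞 k)) =
    (𝕊).tv (𝐞 k) (inr0 S₀ ⟨0, J.mu * c + J.bar (J.mu * c)⟩) := by
  have h1 : (𝕊).Adm (𝐞 k) ((𝕊).Q (c • 𝐞 k)) := adm_short (by cases k <;> simp) c
  refine ext_smul fun w => ?_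
  rw [tv_smul h1, tv_smul (adm_extra k (S₀.Lmin_le ⟨_, rfl⟩))]
  have h0 : (inr0 S₀ ⟨0, J.mu * c + J.bar (J.mu * c)⟩).vec = 0 := rfl
  rw [h0]
  simp only [vec_Q, scal_Q, scal_inr0, (𝕊).form.smul_left', (𝕊).form.zero_left, J.bar_eq,
    map_mul, J.cj_mu]
  linear_combination (norm := module)
    (-((𝕊).form (𝐞 k) w * (c + J.inv1 * J.cj c)) * J.mu_mul_inv1) • (𝐞 k)

/-- The elements `ξ` of the Heisenberg group such that `T(e_k, ξ)` is defined and lies in `G`. -/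
def rootSub (G : Subgroup (hypU 3 S₀)) (k : Theta 3) : AddSubgroup (Heis (𝕊).form) where
  carrier := {ξ | (𝕊).Adm (𝐞 k) ξ ∧ (𝕊).tv (𝐞 k) ξ ∈ G}
  zero_mem' := ⟨Adm.zero (Q_basis_mem S₀ k), by rw [tv_zero]; exact G.one_mem⟩
  add_mem' := by
    rintro ξ η ⟨h1, h2⟩ ⟨h3, h4⟩
    exact ⟨h1.add h3, by rw [tv_add h1 h3]; exact G.mul_mem h2 h4⟩
  neg_mem' := by
    rintro ξ ⟨h1, h2⟩
    exact ⟨h1.neg, by rw [tv_neg h1]; exact G.inv_mem h2⟩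

theorem coord_swap_eq_zero {k : Theta 3} {ξ : Heis (𝕊).form} (h : (𝕊).Adm (𝐞 k) ξ) :
    ξ.vec.1 k.swap = 0 := by
  have h1 := h.orth
  rw [form_basis_left] at h1
  exact (isUnit_hsgn J k).mul_right_eq_zero.1 h1

theorem Q_zero_smul_mem (D : AddSubgroup (Heis (𝕊).form)) (i : Theta 3) :
    (𝕊).Q ((0 : R) • 𝐞 i) ∈ D := by rw [zero_smul, Q_zero]; exact D.zero_mem

/-- A transvection based at `e_k` is a product of short root, long root and extra short root
transvections. -/
theorem mem_rootSub_of_components {G : Subgroup (hypU 3 S₀)} {k : Theta 3} {ξ : Heis (𝕊).form}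
    (h : (𝕊).Adm (𝐞 k) ξ)
    (h1 : ∀ j, j ≠ k → j ≠ k.swap → (𝕊).tv (𝐞 k) ((𝕊).Q (ξ.vec.1 j • 𝐞 j)) ∈ G)
    (h2 : (𝕊).tv (𝐞 k) (inr0 S₀ ⟨0, J.mu * ξ.vec.1 k + J.bar (J.mu * ξ.vec.1 k)⟩) ∈ G)
    (h3 : (𝕊).tv (𝐞 k) (inr0 S₀ (pi0 S₀ ξ)) ∈ G) : (𝕊).tv (𝐞 k) ξ ∈ G := by
  have : ξ ∈ rootSub G k := by
    refine mem_of_components S₀ (fun j => ?_) ⟨adm_extra k ((mem_L_iff S₀).1 h.mem), h3⟩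
    by_cases hj : j = k.swap
    · rw [hj, coord_swap_eq_zero h]; exact Q_zero_smul_mem _ _
    · refine ⟨adm_short hj _, ?_⟩
      by_cases hj' : j = k
      · rw [hj', tv_self]; exact h2
      · exact h1 j hj' hj
  exact this.2

theorem tv_short_mem_EU {i j : Theta 3} (h : j ≠ i) (h' : j ≠ i.swap) (c : R) :
    (𝕊).tv (𝐞 i) ((𝕊).Q (c • 𝐞 j)) ∈ EU 3 S₀ := by
  obtain ⟨u, hu⟩ := isUnit_eps (J := J) i.swap
  refine Subgroup.subset_closure (Or.inl ⟨j, i.swap, h', by simpa using h, -(c * ↑u⁻¹), ?_⟩)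
  rw [shortT_eq_tv, Sum.swap_swap, ← hu]
  simp [mul_assoc]

theorem tv_extra_mem_EU (i : Theta 3) {ξ : Heis S₀.form} (h : ξ ∈ S₀.L) :
    (𝕊).tv (𝐞 i) (inr0 S₀ ξ) ∈ EU 3 S₀ := by
  obtain ⟨u, hu⟩ := isUnit_eps (J := J) i.swap
  refine Subgroup.subset_closure (Or.inr ⟨i, ξ.act ↑u⁻¹, S₀.act_mem _ h _, ?_⟩)
  rw [extraT_eq_tv, Heis.act_act, ← hu]
  congr 2
  ext <;> simp [J.mul_inv1]

theorem tv_mem_EU {k : Theta 3} {ξ : Heis (𝕊).form} (h : (𝕊).Adm (𝐞 k) ξ) :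
    (𝕊).tv (𝐞 k) ξ ∈ EU 3 S₀ :=
  mem_rootSub_of_components h (fun _ hj hj' => tv_short_mem_EU hj hj' _)
    (tv_extra_mem_EU k (S₀.Lmin_le ⟨_, rfl⟩)) (tv_extra_mem_EU k ((mem_L_iff S₀).1 h.mem))

theorem tv_short_mem_preEU (K : S₀.OddFormIdeal) {i j : Theta 3} (h : j ≠ i) (h' : j ≠ i.swap)
    {c : R} (hc : c ∈ K.I) : (𝕊).tv (𝐞 i) ((𝕊).Q (c • 𝐞 j)) ∈ preEU 3 K := by
  obtain ⟨u, hu⟩ := isUnit_eps (J := J) i.swap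
  refine Subgroup.subset_closure (Or.inl ⟨j, i.swap, h', by simpa using h, -(c * ↑u⁻¹),
    K.I.neg_mem (K.I.mul_mem_right _ hc), ?_⟩)
  rw [shortT_eq_tv, Sum.swap_swap, ← hu]
  simp [mul_assoc]

theorem tv_extra_mem_preEU (K : S₀.OddFormIdeal) (i : Theta 3) {ξ : Heis S₀.form}
    (h : ξ ∈ K.M) : (𝕊).tv (𝐞 i) (inr0 S₀ ξ) ∈ preEU 3 K := by
  obtain ⟨u, hu⟩ := isUnit_eps (J := J) i.swap
  refine Subgroup.subset_closure (Or.inr ⟨i, ξ.act ↑u⁻¹, S₀.act_mem _ (K.mem_L h) _,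
    K.act_mem _ h _, ?_⟩)
  rw [extraT_eq_tv, Heis.act_act, ← hu]
  congr 2
  ext <;> simp [J.mul_inv1]

theorem preEU_le_EU (K : S₀.OddFormIdeal) : preEU 3 K ≤ EU 3 S₀ := by
  refine Subgroup.closure_mono ?_
  rintro σ (⟨i, j, h, h', x, -, rfl⟩ | ⟨i, ξ, h, -, rfl⟩)
  · exact Or.inl ⟨i, j, h, h', x, rfl⟩
  · exact Or.inr ⟨i, ξ, h, rfl⟩

theorem preEU_le_relEU (K : S₀.OddFormIdeal) : preEU 3 K ≤ relEU 3 K := fun ρ hρ =>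
  Subgroup.subset_closure ⟨1, Subgroup.one_mem _, ρ, hρ, by simp⟩

theorem relEU_le_EU (K : S₀.OddFormIdeal) : relEU 3 K ≤ EU 3 S₀ := by
  refine (Subgroup.closure_le _).2 ?_
  rintro σ ⟨τ, hτ, ρ, hρ, rfl⟩
  exact Subgroup.mul_mem _ (Subgroup.mul_mem _ hτ (preEU_le_EU K hρ)) (Subgroup.inv_mem _ hτ)

theorem conj_mem_relEU (K : S₀.OddFormIdeal) {τ ν : hypU 3 S₀} (hτ : τ ∈ EU 3 S₀)
    (hν : ν ∈ relEU 3 K) : τ * ν * τ⁻¹ ∈ relEU 3 K := by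
  induction hν using Subgroup.closure_induction with
  | mem σ h =>
    obtain ⟨ρ, hρ, π, hπ, rfl⟩ := h
    refine Subgroup.subset_closure ⟨τ * ρ, Subgroup.mul_mem _ hτ hρ, π, hπ, by group⟩
  | one => simp
  | mul a b _ _ ha hb =>
    have : τ * (a * b) * τ⁻¹ = τ * a * τ⁻¹ * (τ * b * τ⁻¹) := by group
    rw [this]; exact Subgroup.mul_mem _ ha hb
  | inv a _ ha =>
    have : τ * a⁻¹ * τ⁻¹ = (τ * a * τ⁻¹)⁻¹ := by group
    rw [this]; exact Subgroup.inv_mem _ ha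

theorem tv_mem_relEU (K : S₀.OddFormIdeal) {k : Theta 3} {ξ : Heis (𝕊).form}
    (h : (𝕊).Adm (𝐞 k) ξ) (hξ : ξ ∈ (ext3 K).M) : (𝕊).tv (𝐞 k) ξ ∈ relEU 3 K := by
  obtain ⟨h1, h2⟩ := (mem_ext3_iff K).1 hξ
  exact preEU_le_relEU K <| mem_rootSub_of_components h
    (fun _ hj hj' => tv_short_mem_preEU K hj hj' (h1 _))
    (tv_extra_mem_preEU K k (K.add_bar_mem_M (K.I.mul_mem_left _ (h1 _))))
    (tv_extra_mem_preEU K k h2)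

/-- The elementary subgroup is generated by elements whose inverses are transvections as well, so
a property of its elements can be checked on transvections based at basis vectors. -/
theorem EU_induction {p : hypU 3 S₀ → Prop} (one : p 1) (mul : ∀ a b, p a → p b → p (a * b))
    (tv : ∀ (k : Theta 3) (ξ : Heis (𝕊).form), (𝕊).Adm (𝐞 k) ξ → p ((𝕊).tv (𝐞 k) ξ))
    {τ : hypU 3 S₀} (h : τ ∈ EU 3 S₀) : p τ := by
  have h2 : p τ ∧ p τ⁻¹ := by
    induction h using Subgroup.closure_induction with
    | mem σ h =>
      rcases h with ⟨i, j, hij, hij', x, rfl⟩ | ⟨i, ξ, hξ, rfl⟩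
      · have h1 : (𝕊).Adm (𝐞 j.swap) ((𝕊).Q (-(x * eps J j) • 𝐞 i)) := adm_short (by simpa) _
        rw [shortT_eq_tv, ← tv_neg h1]
        exact ⟨tv _ _ h1, tv _ _ h1.neg⟩
      · have h1 := adm_extra i (S₀.act_mem _ hξ (eps J i.swap))
        rw [extraT_eq_tv, ← tv_neg h1]
        exact ⟨tv _ _ h1, tv _ _ h1.neg⟩
    | one => simpa using one
    | mul a b _ _ ha hb => exact ⟨mul _ _ ha.1 hb.1, by rw [mul_inv_rev]; exact mul _ _ hb.2 ha.2⟩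
    | inv a _ ha => exact ⟨ha.2, by simpa using ha.1⟩
  exact h2.1

theorem EU_smul_mem (K : S₀.OddFormIdeal) {τ : hypU 3 S₀} (hτ : τ ∈ EU 3 S₀) :
    ∀ ξ ∈ (ext3 K).M, τ • ξ ∈ (ext3 K).M := by
  refine EU_induction (p := fun τ => ∀ ξ ∈ (ext3 K).M, τ • ξ ∈ (ext3 K).M) ?_ ?_ ?_ hτ
  · intro ξ hξ; rwa [one_smul]
  · intro a b ha hb ξ hξ; rw [mul_smul]; exact ha _ (hb _ hξ)
  · intro k ξ h η hη; exact (ext3 K).tv_smul_mem h hη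

theorem mem_relU_iff {K : S₀.OddFormIdeal} {σ : hypU 3 S₀} :
    σ ∈ relU 3 K ↔ ∀ ξ ∈ (𝕊).L, (ext3 K).Cg ξ (σ • ξ) :=
  (ext3 K).mem_principalCongruence_iff

theorem conj_mem_relU {K : S₀.OddFormIdeal} {τ σ : hypU 3 S₀} (hτ : τ ∈ EU 3 S₀)
    (hσ : σ ∈ relU 3 K) : τ * σ * τ⁻¹ ∈ relU 3 K := by
  rw [mem_relU_iff] at hσ ⊢
  intro ξ hξ
  have := (hσ _ ((𝕊).smul_mem_L τ⁻¹ hξ)).smul (EU_smul_mem K hτ)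
  rwa [smul_inv_smul, ← mul_smul, ← mul_smul] at this

theorem tv_mem_principalCongruence (K : (𝕊).OddFormIdeal) {u : (Theta 3 → R) × V₀}
    {ξ : Heis (𝕊).form} (h : (𝕊).Adm u ξ) (hξ : ξ ∈ K.M) :
    (𝕊).tv u ξ ∈ K.principalCongruence := by
  rw [OddFormIdeal.mem_principalCongruence_iff]
  intro η hη
  have h1 := K.form_mem hξ ((𝕊).mem_even_of_mem hη)
  rw [tv_smul_heis h]
  refine OddFormIdeal.Cg.add_mem_right hη (K.M.add_mem (K.M.add_mem (K.act_mem_M h.iso ?_)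
    (K.act_mem _ hξ _)) (K.add_bar_mem_M (K.I.mul_mem_left _ h1)))
  exact K.I.mul_mem_left _ (K.I.add_mem h1 (K.I.mul_mem_right _ (K.le_Mmax hξ).2.1))

theorem relEU_le_relU (K : S₀.OddFormIdeal) : relEU 3 K ≤ relU 3 K := by
  refine (Subgroup.closure_le _).2 ?_
  rintro σ ⟨τ, hτ, ρ, hρ, rfl⟩
  refine conj_mem_relU hτ ?_
  revert ρ
  change preEU 3 K ≤ relU 3 K
  refine (Subgroup.closure_le _).2 ?_
  rintro σ (⟨i, j, h, h', x, hx, rfl⟩ | ⟨i, ξ, h, hξ, rfl⟩)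
  · rw [shortT_eq_tv]
    exact tv_mem_principalCongruence (ext3 K) (adm_short (by simpa) _)
      (Q_smul_basis_mem_ext3 K (K.I.neg_mem (K.I.mul_mem_right _ hx)) _)
  · rw [extraT_eq_tv]
    exact tv_mem_principalCongruence (ext3 K) (adm_extra _ (S₀.act_mem _ h _))
      (inr0_mem_ext3 K (K.act_mem _ hξ _))

end Elementary

/-! ### The level of an E-normal subgroup: the ideal -/

/-- Two indices whose basis vectors belong to different hyperbolic planes. -/
def Far (i j : Theta 3) : Prop := j ≠ i ∧ j ≠ i.swap

instance (i j : Theta 3) : Decidable (Far i j) := inferInstanceAs (Decidable (_ ∧ _))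

namespace Far

variable {i j : Theta 3}

theorem symm : Far i j → Far j i := by revert i j; decide
theorem swap_left : Far i j → Far i.swap j := by revert i j; decide
theorem swap_right : Far i j → Far i j.swap := by revert i j; decide

theorem of_not {l : Theta 3} : ¬Far i l → Far i j → Far j l := by revert i j l; decide

end Far

theorem exists_far (i j : Theta 3) : ∃ l, Far i l ∧ Far j l := by revert i j; decide

theorem Theta.swap_ne (i : Theta 3) : i.swap ≠ i := by cases i <;> simp

theorem Theta.ne_swap (i : Theta 3) : i ≠ i.swap := (Theta.swap_ne i).symm

theorem Theta.eq_or (i j : Theta 3) : j = i ∨ j = i.swap ∨ Far i j := by revert i j; decide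

section Level

variable {R : Type*} [CommRing R] {J : Pseudoinvolution R}

section

variable {V : Type*} [AddCommGroup V] [Module R V] {S : OddQuadraticSpace J V}

theorem smul_add_neg_eq_Q {σ : S.unitaryGroup} {ζ : Heis S.form} {v : V}
    (h : σ • ζ.vec = ζ.vec + v) (h' : S.form v ζ.vec = 0) : σ • ζ + -ζ = S.Q v := by
  ext
  · simp [h]
  · simp [h, h', S.form.neg_right, S.form.add_left]

theorem tv_smul_eq_self {u w : V} {ξ : Heis S.form} (h : S.Adm u ξ) (h1 : S.form u w = 0)
    (h2 : S.form ξ.vec w = 0) : S.tv u ξ • w = w := by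
  rw [tv_smul h, h1, h2]; simp

end

variable {V₀ : Type*} [AddCommGroup V₀] [Module R V₀] {S₀ : OddQuadraticSpace J V₀}

local notation "𝐞" => basisVec R V₀
local notation "𝕊" => hypSpace 3 S₀

theorem basis_coord_far {i j : Theta 3} (h : Far i j) : (𝐞 i).1 j = 0 := basis_coord_ne h.1

theorem basis_coord_swap (i : Theta 3) : (𝐞 i).1 i.swap = 0 := basis_coord_ne (Theta.swap_ne i)

theorem basis_coord_swap' (i : Theta 3) : (𝐞 i.swap).1 i = 0 := basis_coord_ne (Theta.ne_swap i)

theorem adm_basis {i j : Theta 3} (h : j ≠ i.swap) : (𝕊).Adm (𝐞 i) ((𝕊).Q (𝐞 j)) :=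
  ⟨Q_basis_mem S₀ i, Q_basis_mem S₀ j, form_basis S₀ h⟩

theorem form_far {i j : Theta 3} (h : Far i j) : (𝕊).form (𝐞 i) (𝐞 j) = 0 := form_basis S₀ h.2

/-- `H` is closed under conjugation by the elementary subgroup. -/
def EClosed (H : Subgroup (hypU 3 S₀)) : Prop := ∀ τ ∈ EU 3 S₀, ∀ h ∈ H, τ * h * τ⁻¹ ∈ H

theorem isENormal_iff (H : Subgroup (hypU 3 S₀)) : IsENormal H ↔ EClosed H := by
  constructor
  · intro h τ hτ x hx
    exact (Subgroup.mem_normalizer_iff.1 (h hτ) x).1 hx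
  · intro h τ hτ
    refine Subgroup.mem_normalizer_iff.2 fun x => ⟨h τ hτ x, fun hx => ?_⟩
    have := h τ⁻¹ (Subgroup.inv_mem _ hτ) _ hx
    simpa [mul_assoc] using this

namespace EClosed

variable {H : Subgroup (hypU 3 S₀)}

theorem comm_mem (hH : EClosed H) {h τ : hypU 3 S₀} (hh : h ∈ H) (hτ : τ ∈ EU 3 S₀) :
    h * τ * h⁻¹ * τ⁻¹ ∈ H := by
  have := H.mul_mem hh (hH τ hτ _ (H.inv_mem hh))
  simpa [mul_assoc] using this

theorem smul_mem_rootSub (hH : EClosed H) {k : Theta 3} {ξ : Heis (𝕊).form}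
    (hξ : ξ ∈ rootSub H k) {τ : hypU 3 S₀} (hτ : τ ∈ EU 3 S₀) (hk : τ • 𝐞 k = 𝐞 k) :
    τ • ξ ∈ rootSub H k := by
  have h1 := hξ.1.smul τ
  have h2 := hH τ hτ _ hξ.2
  rw [tv_conj] at h2
  rw [hk] at h1 h2
  exact ⟨h1, h2⟩

/-- An element of `H` fixing `e_k` yields transvections in `H` based at `e_k`. -/
theorem fix_mem (hH : EClosed H) {k : Theta 3} {h : hypU 3 S₀} (hh : h ∈ H) (hk : h • 𝐞 k = 𝐞 k)
    {ξ : Heis (𝕊).form} (hξ : (𝕊).Adm (𝐞 k) ξ) : h • ξ + -ξ ∈ rootSub H k := by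
  have h1 := hξ.smul h
  rw [hk] at h1
  refine ⟨h1.add hξ.neg, ?_⟩
  have h2 := comm_mem hH hh (tv_mem_EU hξ)
  rwa [tv_conj, hk, ← tv_neg hξ, ← tv_add h1 hξ.neg] at h2

/-- Commutators move the base index `i` of a short root element to an index `l`, with an
arbitrary factor. -/
theorem short_move (hH : EClosed H) {i j l : Theta 3} (hij : Far i j) (hil : Far i l)
    (hjl : Far j l) {c : R} (h : (𝕊).tv (𝐞 i) ((𝕊).Q (c • 𝐞 j)) ∈ H) (a : R) :
    (𝕊).tv (𝐞 l) ((𝕊).Q ((a * c) • 𝐞 j)) ∈ H := by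
  obtain ⟨u, hu⟩ := isUnit_hsgn J i
  have hA : (𝕊).Adm (𝐞 i) ((𝕊).Q (c • 𝐞 j)) := adm_short hij.2 c
  have h1 : (𝕊).tv (𝐞 i) ((𝕊).Q (c • 𝐞 j)) • 𝐞 l = 𝐞 l :=
    tv_smul_eq_self hA (form_basis S₀ hil.2) (by
      rw [vec_Q, (𝕊).form.smul_left', form_basis S₀ hjl.2, mul_zero])
  have h2 := fix_mem hH h h1
    (adm_short (S₀ := S₀) (i := l) (j := i.swap) hil.symm.swap_right.2 (↑u⁻¹ * a))
  rw [smul_add_neg_eq_Q (v := (a * c) • 𝐞 j)] at h2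
  · exact h2.2
  · rw [tv_smul hA]
    simp only [vec_Q, scal_Q, (𝕊).form.smul_left', (𝕊).form.smul_right, form_basis_swap, ← hu,
      form_far hij.symm.swap_right]
    rw [smul_smul, show ↑u * (↑u⁻¹ * a) * c = a * c by rw [← mul_assoc, Units.mul_inv, one_mul]]
    simp
  · rw [vec_Q, (𝕊).form.smul_left', (𝕊).form.smul_right,
      form_far hij.symm.swap_right]
    simp

theorem short_first (hH : EClosed H) {i j l : Theta 3} (hij : Far i j) (hjl : Far j l) {c : R}
    (h : (𝕊).tv (𝐞 i) ((𝕊).Q (c • 𝐞 j)) ∈ H) (a : R) :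
    (𝕊).tv (𝐞 l) ((𝕊).Q ((a * c) • 𝐞 j)) ∈ H := by
  by_cases hil : Far i l
  · exact short_move hH hij hil hjl h a
  · obtain ⟨m, him, hjm⟩ := exists_far i j
    have h1 := short_move hH hij him hjm h 1
    rw [one_mul] at h1
    exact short_move hH hjm.symm (Far.of_not hil him) hjl h1 a

theorem short_swap {i j : Theta 3} (hij : Far i j) {c : R}
    (h : (𝕊).tv (𝐞 i) ((𝕊).Q (c • 𝐞 j)) ∈ H) :
    (𝕊).tv (𝐞 j) ((𝕊).Q ((J.inv1 * J.cj c) • 𝐞 i)) ∈ H := by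
  rw [tv_swap (adm_short hij.2 c), tv_smul_left, Q_act, smul_smul, mul_comm] at h
  · exact h
  · exact adm_short hij.symm.2 _

theorem short_all (hH : EClosed H) {i j i' j' : Theta 3} (hij : Far i j) (hij' : Far i' j')
    {c : R} (h : (𝕊).tv (𝐞 i) ((𝕊).Q (c • 𝐞 j)) ∈ H) (a : R) :
    (𝕊).tv (𝐞 i') ((𝕊).Q ((a * c) • 𝐞 j')) ∈ H := by
  obtain ⟨m, hm, hm'⟩ := exists_far j j'
  have h1 := short_first hH hij hm h 1
  have h2 := short_swap hm.symm h1
  have h3 := short_first hH hm hm'.symm h2 1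
  have h4 := short_swap hm' h3
  have h5 := short_first hH hm'.symm hij'.symm h4 a
  convert h5 using 4
  simp only [one_mul, map_mul, J.cj_inv1, J.cj_cj]
  linear_combination (-a * c) * J.mu_mul_inv1

/-- The ideal of all `c` such that `H` contains the transvections `T(e_i, e_j c)`, `j ≠ ±i`. -/
noncomputable def levelI (hH : EClosed H) : Ideal R where
  carrier := {c | ∀ i j, Far i j → (𝕊).tv (𝐞 i) ((𝕊).Q (c • 𝐞 j)) ∈ H}
  zero_mem' := fun i j _ => by rw [zero_smul, Q_zero, tv_zero]; exact H.one_mem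
  add_mem' := by
    intro a b ha hb i j hij
    have h1 := adm_short (S₀ := S₀) hij.2
    rw [add_smul, Q_add, tv_add (h1 _) (h1 _)]
    · exact H.mul_mem (ha i j hij) (hb i j hij)
    · rw [(𝕊).form.smul_left', (𝕊).form.smul_right, form_basis_self]; simp
  smul_mem' := fun a c hc i j hij => short_all hH hij hij (hc i j hij) a

variable {hH : EClosed H}

theorem mem_levelI_of {i j : Theta 3} (hij : Far i j) {c : R}
    (h : (𝕊).tv (𝐞 i) ((𝕊).Q (c • 𝐞 j)) ∈ H) : c ∈ levelI hH := fun i' j' hij' => by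
  simpa using short_all hH hij hij' h 1

theorem cj_mem_levelI {c : R} (h : c ∈ levelI hH) : J.cj c ∈ levelI hH := by
  have hij : Far (Sum.inl 0) (Sum.inl 1) := by decide
  have h1 := (levelI hH).mul_mem_left J.mu (mem_levelI_of hij.symm (short_swap hij (h _ _ hij)))
  rwa [← mul_assoc, J.mu_mul_inv1, one_mul] at h1

theorem Q_mem_rootSub {k j : Theta 3} (h : Far k j) {c : R} (hc : c ∈ levelI hH) :
    (𝕊).Q (c • 𝐞 j) ∈ rootSub H k := ⟨adm_short h.2 c, hc k j h⟩

/-- The coordinates away from `±r` of the parameter of a transvection in `H` based at `e_r` lie in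
the level ideal: two commutators with short root elements isolate one coordinate. -/
theorem coord_mem_levelI {r l : Theta 3} (hrl : Far r l) {ζ : Heis (𝕊).form}
    (hζ : ζ ∈ rootSub H r) : ζ.vec.1 l ∈ levelI hH := by
  obtain ⟨j, hrj, hlj⟩ := exists_far r l
  have a1 : (𝕊).Adm (𝐞 j) ((𝕊).Q (𝐞 l.swap)) := adm_basis hlj.symm.swap_right.2
  have a2 : (𝕊).Adm (𝐞 j.swap) ((𝕊).Q (𝐞 l.swap)) := adm_basis hlj.symm.swap_right.swap_left.2
  have e1 : (𝕊).form (𝐞 l.swap) (𝐞 r) = 0 := form_basis S₀ hrl.symm.swap_left.2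
  have f1 := smul_mem_rootSub hH hζ (tv_mem_EU a1)
    (tv_smul_eq_self a1 (form_basis S₀ hrj.symm.2) e1)
  -- The first commutator leaves the components at `j` and `-l`; the second, with a transvection
  -- based at `e_{-j}`, turns the former into one at `-l` and kills the latter.
  set ζ1 := (𝕊).tv (𝐞 j) ((𝕊).Q (𝐞 l.swap)) • ζ + -ζ with hζ1
  have g1 : ζ1 ∈ rootSub H r := (rootSub H r).add_mem f1 ((rootSub H r).neg_mem hζ)
  set x := J.inv1 * (𝕊).form (𝐞 l.swap) ζ.vec with hx
  have v1 : ζ1.vec = x • 𝐞 j + (𝕊).form (𝐞 j) ζ.vec • 𝐞 l.swap := by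
    rw [hζ1, Heis.vec_add, vec_smul, Heis.vec_neg, tv_smul a1, vec_Q, scal_Q, zero_mul, add_zero]
    abel
  have f2 := smul_mem_rootSub hH g1 (tv_mem_EU a2)
    (tv_smul_eq_self a2 (form_basis S₀ hrj.symm.swap_left.2) e1)
  have g2 := (rootSub H r).add_mem f2 ((rootSub H r).neg_mem g1)
  have e2 : (𝕊).form (𝐞 l.swap) ζ1.vec = 0 := by
    rw [v1, (𝕊).form.add_right, (𝕊).form.smul_right, (𝕊).form.smul_right, form_basis_self,
      form_basis S₀ hlj.swap_left.2]
    simp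
  have e3 : (𝕊).form (𝐞 j.swap) ζ1.vec = hsgn J j.swap * x := by
    rw [v1, (𝕊).form.add_right, (𝕊).form.smul_right, (𝕊).form.smul_right,
      form_basis S₀ hlj.symm.swap_right.swap_left.2, form_basis_swap']
    simp
  rw [smul_add_neg_eq_Q (v := (hsgn J j.swap * x) • 𝐞 l.swap)] at g2
  · have := mem_levelI_of (hH := hH) hrl.swap_right g2.2
    rw [hx, form_basis_left, Sum.swap_swap] at this
    have h3 := (((isUnit_hsgn J j.swap).mul J.isUnit_inv1).mul (isUnit_hsgn J l.swap))
    refine (Ideal.unit_mul_mem_iff_mem (levelI hH) h3).1 ?_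
    convert this using 1
    ring
  · rw [tv_smul a2, vec_Q, e2, e3]; simp
  · rw [(𝕊).form.smul_left', e2, mul_zero]

end EClosed

end Level

/-! ### The level of an E-normal subgroup: the form parameter -/

section LevelM

variable {R : Type*} [CommRing R] {J : Pseudoinvolution R}
variable {V₀ : Type*} [AddCommGroup V₀] [Module R V₀] {S₀ : OddQuadraticSpace J V₀}

local notation "𝐞" => basisVec R V₀
local notation "𝕊" => hypSpace 3 S₀

namespace EClosed

variable {H : Subgroup (hypU 3 S₀)} {hH : EClosed H}

/-- The level ideal also parametrizes long root elements: apply a short root transvection to a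
parameter at another index. -/
theorem Q_self_mem_rootSub (i : Theta 3) {c : R} (hc : c ∈ levelI hH) :
    (𝕊).Q (c • 𝐞 i) ∈ rootSub H i := by
  obtain ⟨j, hij, -⟩ := exists_far i i
  obtain ⟨u, hu⟩ := J.isUnit_inv1.mul (isUnit_hsgn J j.swap)
  have h1 := Q_mem_rootSub hij ((levelI hH).mul_mem_left (↑u⁻¹) hc)
  have a1 : (𝕊).Adm (𝐞 i) ((𝕊).Q (𝐞 j.swap)) := adm_basis hij.swap_right.2
  have h2 := (rootSub H i).add_mem (smul_mem_rootSub hH h1 (tv_mem_EU a1)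
    (tv_smul_eq_self a1 (form_basis_self S₀ i) (form_far hij.symm.swap_left)))
    ((rootSub H i).neg_mem h1)
  rwa [smul_add_neg_eq_Q (v := c • 𝐞 i)] at h2
  · rw [tv_smul a1]
    simp only [vec_Q, scal_Q, (𝕊).form.smul_right, form_basis_swap', form_far hij]
    simp only [zero_mul, zero_smul, add_zero]
    rw [show J.inv1 * (hsgn J j.swap * (↑u⁻¹ * c)) = c by
        rw [← mul_assoc, ← hu, ← mul_assoc, Units.mul_inv, one_mul]]
  · rw [vec_Q, (𝕊).form.smul_left', (𝕊).form.smul_right, form_far hij]; simp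

theorem Q_mem_rootSub' {k j : Theta 3} (h : j ≠ k.swap) {c : R} (hc : c ∈ levelI hH) :
    (𝕊).Q (c • 𝐞 j) ∈ rootSub H k := by
  by_cases hj : j = k
  · rw [hj]; exact Q_self_mem_rootSub k hc
  · exact Q_mem_rootSub ⟨hj, h⟩ hc

theorem inr0_pi0_mem_rootSub {r : Theta 3} {ζ : Heis (𝕊).form} (hζ : ζ ∈ rootSub H r)
    (hr : ζ.vec.1 r ∈ levelI hH) : inr0 S₀ (pi0 S₀ ζ) ∈ rootSub H r := by
  refine inr0_pi0_mem S₀ (fun j => ?_) hζ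
  rcases Theta.eq_or r j with rfl | rfl | hj
  · exact Q_self_mem_rootSub _ hr
  · rw [coord_swap_eq_zero hζ.1]; exact Q_zero_smul_mem _ _
  · exact Q_mem_rootSub (hH := hH) hj (coord_mem_levelI (hH := hH) hj hζ)

/-- The difference between `Q(e_{-i} b)` and its image under an extra short root transvection based
at `e_i`, in coordinates. -/
theorem extra_smul_add_neg (i : Theta 3) {ξ : Heis S₀.form} (hξ : ξ ∈ S₀.L) (b : R) :
    (((𝕊).tv (𝐞 i) (inr0 S₀ ξ) • (𝕊).Q (b • 𝐞 i.swap) + -(𝕊).Q (b • 𝐞 i.swap)).vec.1 =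
      (J.inv1 * ξ.scal * (hsgn J i * b)) • (𝐞 i).1) ∧
    pi0 S₀ ((𝕊).tv (𝐞 i) (inr0 S₀ ξ) • (𝕊).Q (b • 𝐞 i.swap) + -(𝕊).Q (b • 𝐞 i.swap)) =
      (-ξ).act (-(hsgn J i * b)) := by
  have hA := adm_extra (S₀ := S₀) i hξ
  have h1 : (𝕊).form (inr0 S₀ ξ).vec (b • 𝐞 i.swap) = 0 := by
    rw [(𝕊).form.smul_right, form_basis_right]; simp
  set σ := (𝕊).tv (𝐞 i) (inr0 S₀ ξ) with hσ
  have hv : σ • (b • 𝐞 i.swap) = b • 𝐞 i.swap + ((J.inv1 * ξ.scal * (hsgn J i * b)) • 𝐞 i +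
      (hsgn J i * b) • (0, ξ.vec)) := by
    rw [hσ, tv_smul hA, h1, (𝕊).form.smul_right, form_basis_swap, zero_add, scal_inr0, vec_inr0,
      mul_assoc, add_assoc]
  have hvec : (σ • (𝕊).Q (b • 𝐞 i.swap) + -(𝕊).Q (b • 𝐞 i.swap)).vec =
      (J.inv1 * ξ.scal * (hsgn J i * b)) • 𝐞 i + (hsgn J i * b) • (0, ξ.vec) := by
    rw [Heis.vec_add, vec_smul, Heis.vec_neg, vec_Q, hv]; abel
  have hsc : (σ • (𝕊).Q (b • 𝐞 i.swap) + -(𝕊).Q (b • 𝐞 i.swap)).scal =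
      -(J.mu * J.cj ξ.scal * J.cj (hsgn J i * b) * (hsgn J i * b)) := by
    have h2 : (𝕊).form (0, ξ.vec) (𝐞 i.swap) = 0 := by
      rw [form_basis_right]; simp
    rw [Heis.scal_add, vec_smul, Heis.vec_neg, Heis.scal_neg, scal_smul, scal_Q, vec_Q, hv,
      (𝕊).form.neg_right]
    simp only [(𝕊).form.add_left, (𝕊).form.smul_left', (𝕊).form.smul_right, form_basis_self,
      form_basis_swap, h2, map_mul, J.cj_inv1]
    ring
  have h1' : (σ • (𝕊).Q (b • 𝐞 i.swap) + -(𝕊).Q (b • 𝐞 i.swap)).vec.1 =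
      (J.inv1 * ξ.scal * (hsgn J i * b)) • (𝐞 i).1 := by
    rw [hvec, Prod.fst_add, Prod.smul_fst, Prod.smul_fst, smul_zero, add_zero]
  refine ⟨h1', ?_⟩
  ext
  · change (σ • (𝕊).Q (b • 𝐞 i.swap) + -(𝕊).Q (b • 𝐞 i.swap)).vec.2 = _
    rw [hvec]
    simp [basisVec]
  · change (σ • (𝕊).Q (b • 𝐞 i.swap) + -(𝕊).Q (b • 𝐞 i.swap)).scal - hypF J _ _ = _
    have h3 : hypF J (𝐞 i).1 (𝐞 i).1 = 0 := hypF_single i i (Theta.ne_swap i)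
    rw [h1', hypF_smul_smul, h3, hsc, Heis.scal_act',
      Heis.scal_neg, S₀.form_self_of_mem hξ, J.bar_eq ξ.scal, map_neg]
    ring

/-- An extra short root element at `i` yields such elements at `k`, and short root elements with
parameter its second component: evaluate `fix_mem` at multiples of `e_{-i}`. -/
theorem extra_move (hH : EClosed H) {i k : Theta 3} (hik : Far i k) {ξ : Heis S₀.form}
    (hξ : ξ ∈ S₀.L) (h : (𝕊).tv (𝐞 i) (inr0 S₀ ξ) ∈ H) :
    ξ.scal ∈ levelI hH ∧ ∀ b : R, (𝕊).tv (𝐞 k) (inr0 S₀ ((-ξ).act b)) ∈ H := by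
  have hA := adm_extra (S₀ := S₀) i hξ
  have hk : (𝕊).tv (𝐞 i) (inr0 S₀ ξ) • 𝐞 k = 𝐞 k :=
    tv_smul_eq_self hA (form_far hik) (by rw [form_basis_right]; simp)
  obtain ⟨u, hu⟩ := isUnit_hsgn J i
  have key := fun b : R => fix_mem hH h hk (adm_short (S₀ := S₀) (j := i.swap)
    hik.symm.swap_right.2 b)
  constructor
  · have h2 := coord_mem_levelI (hH := hH) hik.symm (key (↑u⁻¹))
    rw [(extra_smul_add_neg i hξ _).1, ← hu, Units.mul_inv, mul_one, Pi.smul_apply, smul_eq_mul,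
      basis_coord_self, mul_one] at h2
    exact (Ideal.unit_mul_mem_iff_mem _ J.isUnit_inv1).1 h2
  · intro b
    have h2 := inr0_pi0_mem_rootSub (hH := hH) (key (-(↑u⁻¹ * b))) (by
      rw [(extra_smul_add_neg i hξ _).1, Pi.smul_apply, basis_coord_far hik, smul_zero]
      exact (levelI hH).zero_mem)
    rw [(extra_smul_add_neg i hξ _).2, ← hu, mul_neg, ← mul_assoc, Units.mul_inv, one_mul,
      neg_neg] at h2
    exact h2.2

theorem extra_all (hH : EClosed H) {i : Theta 3} {ξ : Heis S₀.form} (hξ : ξ ∈ S₀.L)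
    (h : (𝕊).tv (𝐞 i) (inr0 S₀ ξ) ∈ H) (l : Theta 3) (b : R) :
    (𝕊).tv (𝐞 l) (inr0 S₀ (ξ.act b)) ∈ H := by
  obtain ⟨k, hik, hlk⟩ := exists_far i l
  have h1 := (extra_move hH hik hξ h).2 (-1)
  have h2 := (extra_move hH hlk.symm (S₀.act_mem _ (S₀.L.neg_mem hξ) _) h1).2 (-b)
  rw [← Heis.neg_act, neg_neg, Heis.act_act] at h2
  simpa using h2

/-- The subgroup of all `ξ` in `L₀` such that `H` contains `T(e_i, ξ)` for every `i`. -/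
noncomputable def levelM (H : Subgroup (hypU 3 S₀)) : AddSubgroup (Heis S₀.form) where
  carrier := {ξ | ξ ∈ S₀.L ∧ ∀ i, (𝕊).tv (𝐞 i) (inr0 S₀ ξ) ∈ H}
  zero_mem' := ⟨S₀.L.zero_mem, fun i => by rw [map_zero, tv_zero]; exact H.one_mem⟩
  add_mem' := by
    rintro ξ η ⟨h1, h2⟩ ⟨h3, h4⟩
    refine ⟨S₀.L.add_mem h1 h3, fun i => ?_⟩
    rw [map_add, tv_add (adm_extra i h1) (adm_extra i h3)]
    exact H.mul_mem (h2 i) (h4 i)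
  neg_mem' := by
    rintro ξ ⟨h1, h2⟩
    refine ⟨S₀.L.neg_mem h1, fun i => ?_⟩
    rw [map_neg, tv_neg (adm_extra i h1)]
    exact H.inv_mem (h2 i)

theorem mem_levelM_of (hH : EClosed H) {i : Theta 3} {ξ : Heis S₀.form} (hξ : ξ ∈ S₀.L)
    (h : (𝕊).tv (𝐞 i) (inr0 S₀ ξ) ∈ H) : ξ ∈ levelM H := by
  refine ⟨hξ, fun l => ?_⟩
  have := extra_all hH hξ h l 1
  rwa [show ξ.act 1 = ξ by ext <;> simp [J.mul_inv1]] at this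

/-- The level of an E-normal subgroup, as an odd form ideal on `V₀`. -/
noncomputable def level (hH : EClosed H) : S₀.OddFormIdeal where
  I := levelI hH
  M := levelM H
  bar_image := by
    have h : ∀ x ∈ levelI hH, J.bar x ∈ levelI hH := fun x hx => by
      rw [J.bar_eq]; exact (levelI hH).mul_mem_left _ (cj_mem_levelI hx)
    ext x
    constructor
    · rintro ⟨y, hy, rfl⟩; exact h y hy
    · intro hx; exact ⟨J.bar x, h x hx, J.bar_bar x⟩
  act_mem := fun ξ hξ y => ⟨S₀.act_mem _ hξ.1 y, fun i => extra_all hH hξ.1 (hξ.2 i) i y⟩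
  Mmin_le := by
    refine (AddSubgroup.closure_le _).2 ?_
    rintro _ (⟨ξ, hξ, a, ha, rfl⟩ | ⟨x, hx, rfl⟩)
    · obtain ⟨i, j, hij⟩ : ∃ i j : Theta 3, Far i j := ⟨Sum.inl 0, Sum.inl 1, by decide⟩
      obtain ⟨u, hu⟩ := isUnit_hsgn J j.swap
      have hξ' := S₀.L.neg_mem hξ
      have hA := adm_extra (S₀ := S₀) j.swap hξ'
      have h1 := Q_mem_rootSub (H := H) hij ((levelI hH).mul_mem_left (-↑u⁻¹) ha)
      have h2 := (rootSub H i).add_mem (smul_mem_rootSub hH h1 (tv_mem_EU hA)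
        (tv_smul_eq_self hA (form_far hij.symm.swap_left) (by rw [form_basis_right]; simp)))
        ((rootSub H i).neg_mem h1)
      -- The parameter `Q(e_j a)`, up to a unit, is moved by the transvection with parameter `-ξ`
      -- based at `e_{-j}`; the component in `V₀` of the difference is `ξ ↼ a`.
      have h3 := extra_smul_add_neg (S₀ := S₀) j.swap hξ' (-↑u⁻¹ * a)
      rw [Sum.swap_swap] at h3
      have h4 := inr0_pi0_mem_rootSub (hH := hH) h2 (by
        rw [h3.1, Pi.smul_apply, basis_coord_far hij.symm.swap_left, smul_zero]
        exact (levelI hH).zero_mem)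
      rw [h3.2, ← hu, neg_neg, neg_mul, mul_neg, neg_neg, ← mul_assoc, Units.mul_inv,
        one_mul] at h4
      exact mem_levelM_of hH (S₀.act_mem _ hξ _) h4.2
    · have h1 := (Q_self_mem_rootSub (H := H) (Sum.inl 0)
        ((levelI hH).mul_mem_left J.inv1 hx)).2
      rw [tv_self, ← mul_assoc, J.mu_mul_inv1, one_mul] at h1
      exact mem_levelM_of hH (S₀.Lmin_le ⟨x, rfl⟩) h1
  le_Mmax := by
    rintro ξ ⟨hξ, h⟩
    obtain ⟨i, k, hik⟩ : ∃ i j : Theta 3, Far i j := ⟨Sum.inl 0, Sum.inl 1, by decide⟩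
    refine ⟨hξ, (extra_move hH hik hξ (h i)).1, ?_⟩
    rintro w ⟨y, hy⟩
    have hA := adm_extra (S₀ := S₀) i hξ
    have hk : (𝕊).tv (𝐞 i) (inr0 S₀ ξ) • 𝐞 k = 𝐞 k :=
      tv_smul_eq_self hA (form_far hik) (by rw [form_basis_right]; simp)
    have h1 := fix_mem hH (h i) hk (adm_extra k hy)
    have e1 : (𝕊).form (𝐞 i) (0, w) = 0 := by rw [form_basis_left]; simp
    rw [smul_add_neg_eq_Q (v := (J.inv1 * S₀.form ξ.vec w) • 𝐞 i)] at h1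
    · exact (Ideal.unit_mul_mem_iff_mem _ J.isUnit_inv1).1 (mem_levelI_of hik.symm h1.2)
    · rw [tv_smul hA, vec_inr0, e1, hypSpace_form]
      simp [hypF]
    · rw [(𝕊).form.smul_left', vec_inr0, e1, mul_zero]

/-- The parameter of a transvection in `H` based at `e_r` lies in the relative odd form parameter of
the level, provided that this is known for its component along `e_r`. -/
theorem mem_ext3_level {r : Theta 3} {ζ : Heis (𝕊).form} (hζ : ζ ∈ rootSub H r)
    (hr : ζ.vec.1 r ∈ levelI hH) : ζ ∈ (ext3 (level hH)).M := by
  refine (mem_ext3_iff _).2 ⟨fun j => ?_, ?_⟩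
  · rcases Theta.eq_or r j with rfl | rfl | hj
    · exact hr
    · rw [coord_swap_eq_zero hζ.1]; exact (levelI hH).zero_mem
    · exact coord_mem_levelI (hH := hH) hj hζ
  · exact mem_levelM_of hH ((mem_L_iff S₀).1 hζ.1.mem) (inr0_pi0_mem_rootSub hζ hr).2

theorem relEU_level_le (hH : EClosed H) : relEU 3 (level hH) ≤ H := by
  refine (Subgroup.closure_le _).2 ?_
  rintro σ ⟨τ, hτ, ρ, hρ, rfl⟩
  refine hH τ hτ ρ ?_
  revert ρ
  change preEU 3 (level hH) ≤ H
  refine (Subgroup.closure_le _).2 ?_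
  rintro σ (⟨i, j, h, h', x, hx, rfl⟩ | ⟨i, ξ, h, hξ, rfl⟩)
  · rw [shortT_eq_tv]
    refine (levelI hH).neg_mem ((levelI hH).mul_mem_right _ hx) _ _ ⟨h', by simpa using h⟩
  · rw [extraT_eq_tv]
    exact ((level hH).act_mem _ hξ _).2 i

end EClosed

end LevelM

/-! ### Transvections along vectors orthogonal to a hyperbolic plane -/

section Twist

variable {R : Type*} [CommRing R] {J : Pseudoinvolution R}

section

variable {V : Type*} [AddCommGroup V] [Module R V] {S : OddQuadraticSpace J V}

/-- The deviation of `T(u, ξ)` from additivity in `u` is a transvection along a totally isotropic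
plane. -/
theorem tv_add_left_eq {u u' : V} {ξ : Heis S.form} (h : S.Adm u ξ) (h' : S.Adm u' ξ)
    (hu : S.form u u' = 0) : S.tv (u + u') ξ =
      S.tv u ξ * S.tv u' ξ * S.tv u (S.Q ((J.inv1 * ξ.scal) • u')) := by
  have h2 : S.Adm (u + u') ξ :=
    ⟨by rw [S.Q_add hu]; exact S.L.add_mem h.iso h'.iso, h.mem, by
      rw [S.form.add_left, h.orth, h'.orth, add_zero]⟩
  have h3 : S.Adm u (S.Q ((J.inv1 * ξ.scal) • u')) :=
    Adm.smul_right ⟨h.iso, h'.iso, hu⟩ _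
  refine ext_smul fun w => ?_
  rw [mul_smul, mul_smul, tv_smul h2, tv_smul h3, tv_smul h', tv_smul h]
  have e0 := S.form_self_of_mem h.mem
  have e1 := h.orth
  have e2 := h'.orth
  have e3 := h.orth'
  have e4 := h'.orth'
  have e5 := h.self
  have e6 := h'.self
  have e7 := S.form.eq_zero_comm hu
  simp only [vec_Q, scal_Q, S.form.add_left, S.form.add_right, S.form.smul_right,
    S.form.smul_left', hu, e0, e1, e2, e3, e4, e5, e6, e7, map_mul, J.cj_inv1, J.bar_eq]
  module

end

variable {V₀ : Type*} [AddCommGroup V₀] [Module R V₀] {S₀ : OddQuadraticSpace J V₀}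

local notation "𝐞" => basisVec R V₀
local notation "𝕊" => hypSpace 3 S₀

theorem EClosed_EU : EClosed (EU 3 S₀) := fun _ hτ _ hh =>
  Subgroup.mul_mem _ (Subgroup.mul_mem _ hτ hh) (Subgroup.inv_mem _ hτ)

theorem EClosed_relEU (K : S₀.OddFormIdeal) : EClosed (relEU 3 K) := fun _ hτ _ hh =>
  conj_mem_relEU K hτ hh

theorem Q_sub_component_mem {ξ : Heis (𝕊).form} (hξ : ξ ∈ (𝕊).L) (a : R) (i : Theta 3) :
    ξ + -(𝕊).Q (a • 𝐞 i) ∈ (𝕊).L :=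
  (𝕊).L.add_mem hξ ((𝕊).L.neg_mem (Q_smul_basis_mem S₀ a i))

/-- A transvection `T(x, ξ)` along a vector `x` orthogonal to a hyperbolic plane `H_l` is a
product of commutators of transvections based at `e_l` and `e_{-l}`. -/
theorem EClosed.tv_mem {G : Subgroup (hypU 3 S₀)} (hG : EClosed G) {l : Theta 3}
    {x : (Theta 3 → R) × V₀} (hl : (𝕊).form (𝐞 l) x = 0) (hl' : (𝕊).form (𝐞 l.swap) x = 0)
    (h : ∀ c : R, (𝕊).tv (𝐞 l) ((𝕊).Q (c • x)) ∈ G)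
    (h' : ∀ c : R, (𝕊).tv (𝐞 l.swap) ((𝕊).Q (c • x)) ∈ G)
    {ξ : Heis (𝕊).form} (hξ : (𝕊).Adm x ξ) : (𝕊).tv x ξ ∈ G := by
  have hlx : (𝕊).Adm (𝐞 l) ((𝕊).Q x) := ⟨Q_basis_mem S₀ l, hξ.iso, hl⟩
  have hlx' : (𝕊).Adm (𝐞 l.swap) ((𝕊).Q x) := ⟨Q_basis_mem S₀ l.swap, hξ.iso, hl'⟩
  -- The components of `ξ` at `l` and `-l` are dealt with by exchanging `x` and the basis vector.
  have single : ∀ a : R, (𝕊).tv x ((𝕊).Q (a • 𝐞 l)) ∈ G := fun a => by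
    rw [tv_swap (hlx.symm.smul_right a), tv_smul_left (hlx.smul_right _), Q_act, smul_smul]
    exact h _
  have single' : ∀ a : R, (𝕊).tv x ((𝕊).Q (a • 𝐞 l.swap)) ∈ G := fun a => by
    rw [tv_swap (hlx'.symm.smul_right a), tv_smul_left (hlx'.smul_right _), Q_act, smul_smul]
    exact h' _
  set a := ξ.vec.1 l with ha
  set b := ξ.vec.1 l.swap with hb
  set ξ' := ξ + -(𝕊).Q (a • 𝐞 l) + -(𝕊).Q (b • 𝐞 l.swap) with hξ'
  have hmem : ξ' ∈ (𝕊).L := Q_sub_component_mem (Q_sub_component_mem hξ.mem _ _) _ _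
  have hvec : ξ'.vec = ξ.vec + -(a • 𝐞 l) + -(b • 𝐞 l.swap) := rfl
  have o1 : (𝕊).form (𝐞 l) ξ'.vec = 0 := by
    rw [hvec]
    simp only [(𝕊).form.add_right, (𝕊).form.neg_right, (𝕊).form.smul_right, form_basis_self,
      form_basis_swap]
    rw [form_basis_left, hb]; ring
  have o2 : (𝕊).form (𝐞 l.swap) ξ'.vec = 0 := by
    rw [hvec]
    simp only [(𝕊).form.add_right, (𝕊).form.neg_right, (𝕊).form.smul_right, form_basis_self,
      form_basis_swap']
    rw [form_basis_left, Sum.swap_swap, ha]; ring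
  have a1 : (𝕊).Adm x ((𝕊).Q (a • 𝐞 l)) := hlx.symm.smul_right a
  have a2 : (𝕊).Adm x ((𝕊).Q (b • 𝐞 l.swap)) := hlx'.symm.smul_right b
  have a3 : (𝕊).Adm x ξ' := (hξ.add a1.neg).add a2.neg
  have dec : ξ = ξ' + ((𝕊).Q (b • 𝐞 l.swap) + (𝕊).Q (a • 𝐞 l)) := by
    rw [hξ']; simp [add_assoc]
  rw [dec, tv_add a3 (a2.add a1), tv_add a2 a1]
  refine G.mul_mem ?_ (G.mul_mem (single' b) (single a))
  obtain ⟨u, hu⟩ := isUnit_hsgn J l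
  -- What remains is orthogonal to `H_l`. The element `ρ` of `G` maps `e_{-l}` to `e_{-l} + x` and
  -- fixes `ξ'`, so that `T⁻¹ (ρ T ρ⁻¹)` is `T(x, ξ')` up to the error term of `tv_add_left_eq`.
  set ρ := (𝕊).tv (𝐞 l) ((𝕊).Q ((↑u⁻¹ : R) • x)) with hρ
  have a4 : (𝕊).Adm (𝐞 l.swap) ξ' := ⟨Q_basis_mem S₀ _, hmem, o2⟩
  set T := (𝕊).tv (𝐞 l.swap) ξ' with hT
  have r1 : ρ • 𝐞 l.swap = 𝐞 l.swap + x := by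
    rw [hρ, tv_smul (hlx.smul_right _), vec_Q, scal_Q, form_basis_swap, smul_smul, ← hu,
      Units.mul_inv, (𝕊).form.smul_left', (𝕊).form.eq_zero_comm hl']
    simp
  have r2 : ρ • ξ' = ξ' := by
    ext1
    · exact tv_smul_eq_self (hlx.smul_right _) o1 (by
        rw [vec_Q, (𝕊).form.smul_left', a3.orth, mul_zero])
    · rfl
  have c1 : ρ * T * ρ⁻¹ * T⁻¹ ∈ G := hG.comm_mem (h _) (tv_mem_EU a4)
  have c2 := hG T⁻¹ (Subgroup.inv_mem _ (tv_mem_EU a4)) _ c1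
  rw [hT, tv_conj, r1, r2, tv_add_left_eq a4 a3 hl', ← hT] at c2
  have c3 := G.mul_mem c2 (G.inv_mem (h' (J.inv1 * ξ'.scal)))
  convert c3 using 1
  group

theorem tv_mem_EU_of_orth {l : Theta 3} {x : (Theta 3 → R) × V₀} (hl : (𝕊).form (𝐞 l) x = 0)
    (hl' : (𝕊).form (𝐞 l.swap) x = 0) {ξ : Heis (𝕊).form} (hξ : (𝕊).Adm x ξ) :
    (𝕊).tv x ξ ∈ EU 3 S₀ :=
  EClosed_EU.tv_mem hl hl'
    (fun c => tv_mem_EU (Adm.smul_right ⟨Q_basis_mem S₀ l, hξ.iso, hl⟩ c))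
    (fun c => tv_mem_EU (Adm.smul_right ⟨Q_basis_mem S₀ l.swap, hξ.iso, hl'⟩ c)) hξ

theorem Q_pair_mem {i j : Theta 3} (h : j ≠ i.swap) (a b : R) :
    (𝕊).Q (a • 𝐞 i + b • 𝐞 j) ∈ (𝕊).L := by
  rw [Q_add]
  · exact (𝕊).L.add_mem (Q_smul_basis_mem S₀ a i) (Q_smul_basis_mem S₀ b j)
  · rw [(𝕊).form.smul_left', (𝕊).form.smul_right, form_basis S₀ h]; simp

/-! ### Images of basis vectors under an E-normal subgroup -/

namespace EClosed

variable {H : Subgroup (hypU 3 S₀)}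

theorem conj_inv_mem (hH : EClosed H) {τ h : hypU 3 S₀} (hτ : τ ∈ EU 3 S₀)
    (hh : h ∈ H) : τ⁻¹ * h * τ ∈ H := by
  simpa using hH τ⁻¹ (Subgroup.inv_mem _ hτ) h hh

/-- Let `τ` be elementary and fix the image `h e_k` of `e_k` under `h ∈ H`. Then `h⁻¹ τ h` differs
from `τ` by an element of `H`, and it fixes `e_k`, so that `T(τ⁻¹ e_k, e_m)` is congruent modulo
`H` to a transvection based at `e_k`. This forces `τ⁻¹ e_k` to be congruent to `e_k` in the sense
of its pairings with `L`. -/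
theorem twist_mem (hH : EClosed H) {h τ : hypU 3 S₀} (hh : h ∈ H) {k m : Theta 3} (hkm : Far k m)
    (hτ : τ ∈ EU 3 S₀) (hp : τ • h • 𝐞 k = h • 𝐞 k) (hm : τ • 𝐞 m = 𝐞 m)
    (hf : (𝕊).form (𝐞 k) (τ⁻¹ • 𝐞 k) ∈ levelI hH) {ξ : Heis (𝕊).form} (hξ : ξ ∈ (𝕊).L)
    (hk : (𝕊).form (𝐞 k) ξ.vec = 0) (hm' : (𝕊).form (𝐞 m) ξ.vec = 0) :
    (𝕊).form (τ⁻¹ • 𝐞 k) ξ.vec ∈ levelI hH := by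
  set g := h⁻¹ * τ⁻¹ * h with hg
  have hgk : g • 𝐞 k = 𝐞 k := by
    rw [hg, mul_smul, mul_smul, inv_smul_eq_iff, inv_smul_eq_iff, hp]
  have hgH : τ * g ∈ H := by
    have := H.mul_mem (hH τ hτ _ (H.inv_mem hh)) hh
    convert this using 1
    rw [hg]; group
  have hm1 : τ⁻¹ • 𝐞 m = 𝐞 m := by rw [inv_smul_eq_iff, hm]
  have a0 : (𝕊).Adm (𝐞 k) ((𝕊).Q (𝐞 m)) := adm_basis hkm.2
  set f := τ⁻¹ • 𝐞 k with hfdef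
  have a1 : (𝕊).Adm f ((𝕊).Q (𝐞 m)) := by
    have := a0.smul τ⁻¹
    rwa [smul_Q, hm1] at this
  have a2 : (𝕊).Adm (𝐞 k) ((𝕊).Q (g • 𝐞 m)) := by
    have := a0.smul g
    rwa [smul_Q, hgk] at this
  have a3 : (𝕊).Adm (𝐞 m) ((𝕊).Q (J.inv1 • f)) := a1.symm.smul_right _
  have c1 := hH τ⁻¹ (Subgroup.inv_mem _ hτ) _ (hH.comm_mem hgH (tv_mem_EU a0))
  -- The quotient of the conjugates of `T(e_k, e_m)` under `g` and `τ⁻¹`, the second one being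
  -- written as a transvection based at `e_m`.
  have c2 : (𝕊).tv (𝐞 k) ((𝕊).Q (g • 𝐞 m)) * (𝕊).tv (𝐞 m) (-(𝕊).Q (J.inv1 • f)) ∈ H := by
    rw [tv_neg a3, ← tv_swap a1]
    have e1 := tv_conj g (𝐞 k) ((𝕊).Q (𝐞 m))
    have e2 := tv_conj τ⁻¹ (𝐞 k) ((𝕊).Q (𝐞 m))
    rw [smul_Q, hgk] at e1
    rw [smul_Q, hm1, ← hfdef] at e2
    rw [← e1, ← e2]
    convert c1 using 1
    group
  set t := f.1 k.swap with ht
  have ht' : t ∈ levelI hH := by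
    rw [form_basis_left] at hf
    exact (Ideal.unit_mul_mem_iff_mem _ (isUnit_hsgn J k)).1 hf
  have a4 : (𝕊).Adm (𝐞 m) ((𝕊).Q ((J.inv1 * t) • 𝐞 k.swap)) :=
    adm_short hkm.symm.swap_right.2 _
  -- Correcting by the component of `f` at `-k`, which is in the level ideal, makes the product fix
  -- `e_k`, so that `fix_mem` applies to it.
  set ω := -(𝕊).Q (J.inv1 • f) + (𝕊).Q ((J.inv1 * t) • 𝐞 k.swap) with hω
  have a5 : (𝕊).Adm (𝐞 m) ω := a3.neg.add a4
  have c3 : (𝕊).tv (𝐞 k) ((𝕊).Q (g • 𝐞 m)) * (𝕊).tv (𝐞 m) ω ∈ H := by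
    rw [hω, tv_add a3.neg a4, ← mul_assoc]
    exact H.mul_mem c2 ((levelI hH).mul_mem_left _ ht' _ _ hkm.symm.swap_right)
  have wv : ω.vec = -(J.inv1 • f) + (J.inv1 * t) • 𝐞 k.swap := rfl
  have ωk : (𝕊).form ω.vec (𝐞 k) = 0 := by
    rw [wv]
    simp only [(𝕊).form.add_left, (𝕊).form.neg_left, (𝕊).form.smul_left', form_basis_swap',
      form_basis_right, map_mul, ← ht, basis_coord_self, map_one]
    ring
  have c4 : ((𝕊).tv (𝐞 k) ((𝕊).Q (g • 𝐞 m)) * (𝕊).tv (𝐞 m) ω) • 𝐞 k = 𝐞 k := by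
    rw [mul_smul, tv_smul_eq_self a5 (form_far hkm.symm) ωk,
      tv_smul_eq_self a2 (form_basis_self S₀ k) a2.orth']
  have c5 := coord_mem_levelI (hH := hH) hkm (hH.fix_mem c3 c4 ⟨Q_basis_mem S₀ k, hξ, hk⟩)
  have c6 : (((𝕊).tv (𝐞 k) ((𝕊).Q (g • 𝐞 m)) * (𝕊).tv (𝐞 m) ω) • ξ + -ξ).vec =
      (J.inv1 * (𝕊).form ω.vec ξ.vec) • 𝐞 m + (J.inv1 * (𝕊).form (g • 𝐞 m)
        (ξ.vec + (J.inv1 * (𝕊).form ω.vec ξ.vec) • 𝐞 m)) • 𝐞 k := by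
    have hk2 : ∀ c : R, (𝕊).form (𝐞 k) (ξ.vec + c • 𝐞 m) = 0 := fun c => by
      rw [(𝕊).form.add_right, hk, (𝕊).form.smul_right, form_far hkm, zero_mul, add_zero]
    rw [Heis.vec_add, vec_smul, Heis.vec_neg, mul_smul, tv_smul a5, hm', mul_zero, add_zero,
      zero_smul, add_zero, tv_smul a2, vec_Q, scal_Q, zero_mul, add_zero, hk2]
    rw [zero_smul, add_zero]; abel
  rw [c6] at c5
  have c7 : J.inv1 * (𝕊).form ω.vec ξ.vec ∈ levelI hH := by
    have e1 : (𝐞 k).1 m = 0 := basis_coord_far hkm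
    have e2 : (𝐞 m).1 m = 1 := basis_coord_self m
    simpa [e1, e2] using c5
  have c8 := (Ideal.unit_mul_mem_iff_mem _ J.isUnit_inv1).1 c7
  rw [wv] at c8
  simp only [(𝕊).form.add_left, (𝕊).form.neg_left, (𝕊).form.smul_left', map_mul, J.cj_inv1] at c8
  rw [Ideal.add_mem_iff_left _ ((levelI hH).mul_mem_right _ ((levelI hH).mul_mem_left _
    (cj_mem_levelI ht'))), neg_mem_iff] at c8
  exact (Ideal.unit_mul_mem_iff_mem _ J.isUnit_mu).1 c8

end EClosed

end Twist

section Images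

variable {R : Type*} [CommRing R] {J : Pseudoinvolution R}
variable {V₀ : Type*} [AddCommGroup V₀] [Module R V₀] {S₀ : OddQuadraticSpace J V₀}

local notation "𝐞" => basisVec R V₀
local notation "𝕊" => hypSpace 3 S₀

theorem Far.swap_left_iff {i j : Theta 3} : Far i.swap j ↔ Far i j := by revert i j; decide
theorem Far.swap_right_iff {i j : Theta 3} : Far i j.swap ↔ Far i j := by revert i j; decide

namespace EClosed

variable {H : Subgroup (hypU 3 S₀)}

/-- The case of `twist_mem` in which `τ` is a transvection along a vector orthogonal to `H_l`. -/
theorem twist_tv_mem (hH : EClosed H) {h : hypU 3 S₀} (hh : h ∈ H) {k l m : Theta 3}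
    (hkm : Far k m) {u : (Theta 3 → R) × V₀} {η : Heis (𝕊).form} (hA : (𝕊).Adm u η)
    (hl : (𝕊).form (𝐞 l) u = 0) (hl' : (𝕊).form (𝐞 l.swap) u = 0)
    (hup : (𝕊).form (h • 𝐞 k) u = 0) (hvp : (𝕊).form (h • 𝐞 k) η.vec = 0)
    (hum : (𝕊).form u (𝐞 m) = 0) (hvm : (𝕊).form η.vec (𝐞 m) = 0)
    (hf : (𝕊).form (𝐞 k) ((𝕊).tv u (-η) • 𝐞 k) ∈ levelI hH)
    {w : (Theta 3 → R) × V₀} (hw : (𝕊).Q w ∈ (𝕊).L) (hk : (𝕊).form (𝐞 k) w = 0)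
    (hm : (𝕊).form (𝐞 m) w = 0) : (𝕊).form ((𝕊).tv u (-η) • 𝐞 k) w ∈ levelI hH := by
  rw [tv_neg hA] at hf ⊢
  exact hH.twist_mem (ξ := (𝕊).Q w) hh hkm (tv_mem_EU_of_orth hl hl' hA)
    (tv_smul_eq_self hA ((𝕊).form.eq_zero_comm hup) ((𝕊).form.eq_zero_comm hvp))
    (tv_smul_eq_self hA hum hvm) hf hw hk hm

/-- The vectors `u` and `v` below are orthogonal to `h e_k` by the choice of their coefficients, so
that `twist_tv_mem` applies to `T(u, v)`, which moves `e_k` by a multiple of `v`. -/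
theorem pair_mem (hH : EClosed H) {h : hypU 3 S₀} (hh : h ∈ H) {k j l : Theta 3}
    (hkj : Far k j) (hkl : Far k l) (hjl : Far j l) :
    J.cj ((𝕊).form (h • 𝐞 k) (𝐞 j)) * (𝕊).form (h • 𝐞 k) (𝐞 j) ∈ levelI hH ∧
    J.cj ((𝕊).form (h • 𝐞 k) (𝐞 l)) * (𝕊).form (h • 𝐞 k) (𝐞 j) ∈ levelI hH := by
  set bj := (𝕊).form (h • 𝐞 k) (𝐞 j) with hbj
  set bl := (𝕊).form (h • 𝐞 k) (𝐞 l) with hbl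
  set bi := (𝕊).form (h • 𝐞 k) (𝐞 k.swap) with hbi
  set u : (Theta 3 → R) × V₀ := bj • 𝐞 k.swap + (-bi) • 𝐞 j with hu
  set v : (Theta 3 → R) × V₀ := bj • 𝐞 l + (-bl) • 𝐞 j with hv
  have hA : (𝕊).Adm u ((𝕊).Q v) :=
    ⟨Q_pair_mem hkj.swap_left.2 _ _, Q_pair_mem hjl.symm.2 _ _, by
      simp only [vec_Q, hu, hv, (𝕊).form.add_left, (𝕊).form.add_right, (𝕊).form.smul_left',
        (𝕊).form.smul_right, form_far, Far.swap_left_iff, Far.swap_right_iff, hkj, hkl, hjl,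
        form_basis_self]
      ring⟩
  have hvv : (𝕊).form v v = 0 := hA.symm.self
  have hf : (𝕊).tv u (-(𝕊).Q v) • 𝐞 k = 𝐞 k + (-(J.cj bj * hsgn J k.swap)) • v := by
    rw [tv_smul hA.neg, neg_Q _ hvv, vec_Q, scal_Q]
    have e1 : (𝕊).form (-v) (𝐞 k) = 0 := by
      simp only [hv, (𝕊).form.neg_left, (𝕊).form.add_left, (𝕊).form.smul_left', form_far,
        hkj.symm, hkl.symm]
      ring
    have e2 : (𝕊).form u (𝐞 k) = J.cj bj * hsgn J k.swap := by
      simp only [hu, (𝕊).form.add_left, (𝕊).form.smul_left', form_far, hkj.symm, form_basis_swap']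
      ring
    rw [e1, e2]; module
  have key : ∀ m, Far k m → (𝕊).form u (𝐞 m) = 0 → (𝕊).form v (𝐞 m) = 0 → ∀ x : Theta 3,
      Far k x → (𝕊).form (𝐞 m) (𝐞 x) = 0 →
      bj * (J.cj (hsgn J k.swap) * (𝕊).form v (𝐞 x)) ∈ levelI hH := by
    intro m hkm hum hvm x hkx hmx
    have h1 := hH.twist_tv_mem hh (l := l) hkm hA
      (by
        simp only [hu, (𝕊).form.add_right, (𝕊).form.smul_right, form_far, Far.swap_right_iff,
          hkl.symm, hjl.symm]
        ring)
      (by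
        simp only [hu, (𝕊).form.add_right, (𝕊).form.smul_right, form_far, Far.swap_right_iff,
          Far.swap_left_iff, hkl.symm, hjl.symm]
        ring)
      (by
        simp only [hu, (𝕊).form.add_right, (𝕊).form.smul_right, ← hbi, ← hbj]
        ring)
      (by
        simp only [vec_Q, hv, (𝕊).form.add_right, (𝕊).form.smul_right, ← hbl, ← hbj]
        ring) hum hvm
      (by
        rw [hf]
        simp only [hv, (𝕊).form.add_right, (𝕊).form.smul_right, form_far, hkj, hkl,
          form_basis_self]
        simp)
      (Q_basis_mem S₀ x) (form_far hkx) hmx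
    rw [hf, (𝕊).form.add_left, form_far hkx, zero_add, (𝕊).form.smul_left', map_neg, map_mul,
      J.cj_cj, neg_mul, neg_mem_iff, mul_assoc] at h1
    exact h1
  constructor
  · have h1 := key j hkj
      (by
        simp only [hu, (𝕊).form.add_left, (𝕊).form.smul_left', form_far, Far.swap_left_iff,
          hkj, form_basis_self]
        ring)
      (by
        simp only [hv, (𝕊).form.add_left, (𝕊).form.smul_left', form_far,
          hjl.symm, form_basis_self]
        ring) l.swap hkl.swap_right (form_far hjl.swap_right)
    simp only [hv, (𝕊).form.add_left, (𝕊).form.smul_left', form_far, Far.swap_right_iff,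
      hjl, form_basis_swap] at h1
    refine (Ideal.unit_mul_mem_iff_mem _
      (((isUnit_hsgn J k.swap).map J.cj).mul (isUnit_hsgn J l))).1 ?_
    convert h1 using 1
    ring
  · have h1 := key l hkl
      (by
        simp only [hu, (𝕊).form.add_left, (𝕊).form.smul_left', form_far, Far.swap_left_iff,
          hkl, hjl]
        ring)
      (by
        simp only [hv, (𝕊).form.add_left, (𝕊).form.smul_left', form_far,
          hjl, form_basis_self]
        ring) j.swap hkj.swap_right (form_far hjl.symm.swap_right)
    simp only [hv, (𝕊).form.add_left, (𝕊).form.smul_left', form_far, Far.swap_right_iff,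
      hjl.symm, form_basis_swap, map_neg] at h1
    refine (Ideal.unit_mul_mem_iff_mem _
      (((isUnit_hsgn J k.swap).map J.cj).mul (isUnit_hsgn J j)).neg).1 ?_
    convert h1 using 1
    ring

/-- As in `pair_mem`, with the vector `v` now involving a general element `ξ` of `L`. -/
theorem gen_mem (hH : EClosed H) {h : hypU 3 S₀} (hh : h ∈ H) {k j : Theta 3} (hkj : Far k j)
    {ξ : Heis (𝕊).form} (hξ : ξ ∈ (𝕊).L) (hk : (𝕊).form (𝐞 k.swap) ξ.vec = 0)
    (hj : (𝕊).form (𝐞 j) ξ.vec = 0) :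
    (𝕊).form (h • 𝐞 k) (𝐞 j) * J.cj ((𝕊).form (h • 𝐞 k) ξ.vec) ∈ levelI hH := by
  obtain ⟨l, hkl, hjl⟩ := exists_far k j
  obtain ⟨h1, h2⟩ := hH.pair_mem hh hkj hkl hjl
  have h3 := cj_mem_levelI h2
  rw [map_mul, J.cj_cj] at h3
  set bj := (𝕊).form (h • 𝐞 k) (𝐞 j) with hbj
  set bl := (𝕊).form (h • 𝐞 k) (𝐞 l) with hbl
  set bi := (𝕊).form (h • 𝐞 k) (𝐞 k.swap) with hbi
  set c := (𝕊).form (h • 𝐞 k) ξ.vec with hc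
  set u : (Theta 3 → R) × V₀ := bj • 𝐞 k.swap + (-bi) • 𝐞 j with hu
  set η : Heis (𝕊).form := (𝕊).Q (c • 𝐞 l) + ξ.act (-bl) with hη
  have hv : η.vec = c • 𝐞 l + (-bl) • ξ.vec := rfl
  have hA : (𝕊).Adm u η :=
    ⟨Q_pair_mem hkj.swap_left.2 _ _, (𝕊).L.add_mem (Q_smul_basis_mem S₀ _ _)
      ((𝕊).act_mem _ hξ _), by
      simp only [hu, hv, (𝕊).form.add_left, (𝕊).form.add_right, (𝕊).form.smul_left',
        (𝕊).form.smul_right, form_far, Far.swap_left_iff, hkl, hjl, hk, hj]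
      ring⟩
  have e2 : (𝕊).form u (𝐞 k) = J.cj bj * hsgn J k.swap := by
    simp only [hu, (𝕊).form.add_left, (𝕊).form.smul_left', form_far, hkj.symm, form_basis_swap']
    ring
  have h4 := hH.twist_tv_mem hh (l := l) hkj hA
    (by
      simp only [hu, (𝕊).form.add_right, (𝕊).form.smul_right, form_far, Far.swap_right_iff,
        hkl.symm, hjl.symm]
      ring)
    (by
      simp only [hu, (𝕊).form.add_right, (𝕊).form.smul_right, form_far, Far.swap_right_iff,
        Far.swap_left_iff, hkl.symm, hjl.symm]
      ring)
    (by
      simp only [hu, (𝕊).form.add_right, (𝕊).form.smul_right, ← hbi, ← hbj]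
      ring)
    (by
      simp only [hv, (𝕊).form.add_right, (𝕊).form.smul_right, ← hbl, ← hc]
      ring)
    (by
      simp only [hu, (𝕊).form.add_left, (𝕊).form.smul_left', form_far, Far.swap_left_iff,
        hkj, form_basis_self]
      ring)
    (by
      simp only [hv, (𝕊).form.add_left, (𝕊).form.smul_left', form_far, hjl.symm,
        (𝕊).form.eq_zero_comm hj]
      ring)
    (by
      rw [tv_smul hA.neg, e2, Heis.vec_neg]
      have e3 : (𝕊).form (𝐞 k) u = hsgn J k * bj := by
        simp only [hu, (𝕊).form.add_right, (𝕊).form.smul_right, form_far, hkj, form_basis_swap]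
        ring
      have e4 : (𝕊).form (𝐞 k) (-η.vec) = (𝕊).form (𝐞 k) ξ.vec * bl := by
        simp only [hv, (𝕊).form.neg_right, (𝕊).form.add_right, (𝕊).form.smul_right, form_far, hkl]
        ring
      have e5 : (𝕊).form (-η.vec) (𝐞 k) = J.cj bl * (𝕊).form ξ.vec (𝐞 k) := by
        simp only [hv, (𝕊).form.neg_left, (𝕊).form.add_left, (𝕊).form.smul_left', form_far,
          hkl.symm, map_neg]
        ring
      rw [(𝕊).form.add_right, (𝕊).form.add_right, (𝕊).form.smul_right, (𝕊).form.smul_right, e3, e4,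
        e5, form_basis_self]
      -- The component of the image of `e_k` at `-k` consists of products already in the ideal.
      have e6 := (levelI hH).add_mem ((levelI hH).add_mem
        ((levelI hH).mul_mem_left (hsgn J k * J.inv1 * (𝕊).form ξ.vec (𝐞 k)) h2)
        ((levelI hH).mul_mem_left (hsgn J k * J.inv1 * (-η).scal * hsgn J k.swap) h1))
        ((levelI hH).mul_mem_left ((𝕊).form (𝐞 k) ξ.vec * hsgn J k.swap) h3)
      convert e6 using 1
      ring)
    (Q_basis_mem S₀ l.swap) (form_far hkl.swap_right) (form_far hjl.swap_right)
  have e7 : (𝕊).form u (𝐞 l.swap) = 0 := by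
    simp only [hu, (𝕊).form.add_left, (𝕊).form.smul_left', form_far, Far.swap_left_iff,
      Far.swap_right_iff, hkl, hjl]
    ring
  have e8 : (𝕊).form (-η.vec) (𝐞 l.swap) = J.cj bl * (𝕊).form ξ.vec (𝐞 l.swap) -
      J.cj c * hsgn J l := by
    simp only [hv, (𝕊).form.neg_left, (𝕊).form.add_left, (𝕊).form.smul_left', form_basis_swap,
      map_neg]
    ring
  rw [tv_smul hA.neg, e2, Heis.vec_neg, (𝕊).form.add_left, (𝕊).form.add_left,
    form_far hkl.swap_right, (𝕊).form.smul_left', (𝕊).form.smul_left', e7, e8,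
    map_mul J.cj (J.cj bj), J.cj_cj] at h4
  refine (Ideal.unit_mul_mem_iff_mem _
    (((isUnit_hsgn J k.swap).map J.cj).mul (isUnit_hsgn J l))).1 ?_
  have h5 := (levelI hH).sub_mem ((levelI hH).mul_mem_left
    (J.cj (hsgn J k.swap) * (𝕊).form ξ.vec (𝐞 l.swap)) h2) h4
  convert h5 using 1
  ring

/-- Conjugating by an elementary transformation that fixes `e_k` changes the coordinates of the
image of `e_k`. -/
theorem exists_conj (hH : EClosed H) {h : hypU 3 S₀} (hh : h ∈ H) {k a : Theta 3}
    {ξ : Heis (𝕊).form} (hA : (𝕊).Adm (𝐞 a) ξ) (hk : (𝕊).form (𝐞 a) (𝐞 k) = 0)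
    (hk' : (𝕊).form ξ.vec (𝐞 k) = 0) : ∃ h' ∈ H, ∀ w, (𝕊).form (h' • 𝐞 k) w =
      (𝕊).form (h • 𝐞 k) ((𝕊).tv (𝐞 a) ξ • w) := by
  refine ⟨_, conj_inv_mem hH (tv_mem_EU hA) hh, fun w => ?_⟩
  rw [mul_smul, mul_smul, tv_smul_eq_self hA hk hk', (𝕊).form_smul_left, inv_inv]

/-- With `x = B(h e_k, e_j)`, the products of `x` with the conjugates of `B(h e_k, e_k)`, of
`B(h e_k, e_{-j})²` and, by `gen_mem`, of `B(h e_k, ξ)` for suitable `ξ` lie in the level ideal.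
The unit `B(h e_k, h e_{-k})` is a combination of the factors, hence `x` lies in it as well. -/
theorem basis_mem_of_far (hH : EClosed H) {h : hypU 3 S₀} (hh : h ∈ H) {k j : Theta 3}
    (hkj : Far k j) : (𝕊).form (h • 𝐞 k) (𝐞 j) ∈ levelI hH := by
  obtain ⟨l, hkl, hjl⟩ := exists_far k j
  have q1 : J.cj ((𝕊).form (h • 𝐞 k) (𝐞 k)) * (𝕊).form (h • 𝐞 k) (𝐞 j) ∈ levelI hH := by
    have hA : (𝕊).Adm (𝐞 k) ((𝕊).Q (𝐞 l.swap)) := adm_basis hkl.swap_right.2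
    obtain ⟨h', hh', he⟩ := hH.exists_conj hh hA (form_basis_self S₀ k)
      (form_far hkl.symm.swap_left)
    have h1 := (hH.pair_mem hh' hkj hkl hjl).2
    have e1 : (𝕊).tv (𝐞 k) ((𝕊).Q (𝐞 l.swap)) • 𝐞 j = 𝐞 j :=
      tv_smul_eq_self hA (form_far hkj) (form_far hjl.symm.swap_left)
    have e2 : (𝕊).tv (𝐞 k) ((𝕊).Q (𝐞 l.swap)) • 𝐞 l = 𝐞 l + (J.inv1 * hsgn J l.swap) • 𝐞 k := by
      rw [tv_smul hA, vec_Q, scal_Q, form_far hkl, form_basis_swap']; module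
    rw [he, he, e1, e2, (𝕊).form.add_right, (𝕊).form.smul_right, map_add, add_mul,
      Ideal.add_mem_iff_right _ (hH.pair_mem hh hkj hkl hjl).2, map_mul] at h1
    refine (Ideal.unit_mul_mem_iff_mem _
      ((J.isUnit_inv1.mul (isUnit_hsgn J l.swap)).map J.cj)).1 ?_
    convert h1 using 1
    ring
  have q2 : J.cj ((𝕊).form (h • 𝐞 k) (𝐞 j.swap)) ^ 2 * (𝕊).form (h • 𝐞 k) (𝐞 j) ∈
      levelI hH := by
    have hA : (𝕊).Adm (𝐞 j.swap) ((𝕊).Q (𝐞 l.swap)) := adm_basis hjl.swap_left.swap_right.2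
    obtain ⟨h', hh', he⟩ := hH.exists_conj hh hA (form_far hkj.symm.swap_left)
      (form_far hkl.symm.swap_left)
    have h1 := (hH.pair_mem hh' hkj hkl hjl).2
    have e1 : (𝕊).tv (𝐞 j.swap) ((𝕊).Q (𝐞 l.swap)) • 𝐞 j = 𝐞 j + hsgn J j.swap • 𝐞 l.swap := by
      rw [tv_smul hA, vec_Q, scal_Q, form_far hjl.symm.swap_left, form_basis_swap']; module
    have e2 : (𝕊).tv (𝐞 j.swap) ((𝕊).Q (𝐞 l.swap)) • 𝐞 l =
        𝐞 l + (J.inv1 * hsgn J l.swap) • 𝐞 j.swap := by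
      rw [tv_smul hA, vec_Q, scal_Q, form_far hjl.swap_left, form_basis_swap']; module
    rw [he, he, e1, e2, (𝕊).form.add_right, (𝕊).form.add_right, (𝕊).form.smul_right,
      (𝕊).form.smul_right, map_add, map_mul] at h1
    have p1 := (hH.pair_mem hh hkj hkl hjl).2
    have p2 := (hH.pair_mem hh hkl.swap_right hkj.swap_right
      hjl.symm.swap_left.swap_right).2
    set bj := (𝕊).form (h • 𝐞 k) (𝐞 j)
    set bl := (𝕊).form (h • 𝐞 k) (𝐞 l)
    set bj' := (𝕊).form (h • 𝐞 k) (𝐞 j.swap)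
    set bl' := (𝕊).form (h • 𝐞 k) (𝐞 l.swap)
    refine (Ideal.unit_mul_mem_iff_mem _
      ((J.isUnit_inv1.mul (isUnit_hsgn J l.swap)).map J.cj)).1 ?_
    have p3 := (levelI hH).sub_mem ((levelI hH).sub_mem ((levelI hH).mul_mem_left (J.cj bj') h1)
      ((levelI hH).mul_mem_left (J.cj bj') p1)) ((levelI hH).mul_mem_left
        (J.cj bl * hsgn J j.swap + J.cj (J.inv1 * hsgn J l.swap) * J.cj bj' * hsgn J j.swap) p2)
    convert p3 using 1
    ring
  -- The vector `ξ` is `h e_{-k}` without its components at `k` and `-j`, which makes it orthogonal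
  -- to `e_{-k}` and `e_j`, as required by `gen_mem`.
  set w := h • 𝐞 k.swap with hw
  set ξ : Heis (𝕊).form := h • (𝕊).Q (𝐞 k.swap) + -(𝕊).Q (w.1 k • 𝐞 k) +
    -(𝕊).Q (w.1 j.swap • 𝐞 j.swap) with hξ
  have hv : ξ.vec = w + -(w.1 k • 𝐞 k) + -(w.1 j.swap • 𝐞 j.swap) := rfl
  have h1 := hH.gen_mem hh hkj (ξ := ξ) (Q_sub_component_mem (Q_sub_component_mem
    ((𝕊).smul_mem_L h (Q_basis_mem S₀ _)) _ _) _ _)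
    (by
      simp only [hv, (𝕊).form.add_right, (𝕊).form.neg_right, (𝕊).form.smul_right, form_far,
        form_basis_swap', Far.swap_left_iff, Far.swap_right_iff, hkj]
      rw [form_basis_left, Sum.swap_swap]; ring)
    (by
      simp only [hv, (𝕊).form.add_right, (𝕊).form.neg_right, (𝕊).form.smul_right, form_far,
        form_basis_swap, hkj.symm]
      rw [form_basis_left]; ring)
  have e1 : (𝕊).form (h • 𝐞 k) ξ.vec = hsgn J k - (𝕊).form (h • 𝐞 k) (𝐞 k) * w.1 k -
      (𝕊).form (h • 𝐞 k) (𝐞 j.swap) * w.1 j.swap := by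
    simp only [hv, (𝕊).form.add_right, (𝕊).form.neg_right, (𝕊).form.smul_right]
    rw [hw, (𝕊).form_smul_smul, form_basis_swap]; ring
  rw [e1] at h1
  simp only [map_sub, map_mul] at h1
  have hU := (isUnit_hsgn J k).map J.cj
  refine (Ideal.unit_mul_mem_iff_mem _ (hU.mul hU)).1 ?_
  set x := (𝕊).form (h • 𝐞 k) (𝐞 j)
  set y := J.cj ((𝕊).form (h • 𝐞 k) (𝐞 k))
  set z := J.cj ((𝕊).form (h • 𝐞 k) (𝐞 j.swap))
  set e := J.cj (hsgn J k)
  set c := J.cj (w.1 j.swap)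
  -- The factor `e + c z` turns the term linear in `z` into one with `z ^ 2`:
  -- `(e + c z) (e - c z) = e ^ 2 - c ^ 2 z ^ 2`.
  have h2 := (levelI hH).add_mem ((levelI hH).add_mem ((levelI hH).mul_mem_left (e + c * z) h1)
    ((levelI hH).mul_mem_left ((e + c * z) * J.cj (w.1 k)) q1))
    ((levelI hH).mul_mem_left (c * c) q2)
  convert h2 using 1
  ring

/-- Elements of an E-normal subgroup preserve orthogonality to `e_k` modulo the level ideal. -/
theorem form_mem_levelI (hH : EClosed H) {h : hypU 3 S₀} (hh : h ∈ H) {k : Theta 3}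
    {ξ : Heis (𝕊).form} (hξ : (𝕊).Adm (𝐞 k) ξ) :
    (𝕊).form (h • 𝐞 k) ξ.vec ∈ levelI hH := by
  obtain ⟨j, hkj, -⟩ := exists_far k k
  have hb := hH.basis_mem_of_far hh hkj
  have key : ∀ η : Heis (𝕊).form, η ∈ (𝕊).L → (𝕊).form (𝐞 k) η.vec = 0 →
      (𝕊).form (𝐞 j.swap) η.vec = 0 → (𝕊).form (h • 𝐞 k) η.vec ∈ levelI hH := by
    intro η hη hk hj
    have hA : (𝕊).Adm (𝐞 j.swap) η := ⟨Q_basis_mem S₀ _, hη, hj⟩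
    obtain ⟨h', hh', he⟩ := hH.exists_conj hh hA (form_far hkj.symm.swap_left)
      ((𝕊).form.eq_zero_comm hk)
    have h1 := hH.basis_mem_of_far hh' hkj
    rw [he, tv_smul hA, (𝕊).form.add_right, (𝕊).form.add_right, (𝕊).form.smul_right,
      (𝕊).form.smul_right, form_basis_swap', Ideal.add_mem_iff_right _ ((levelI hH).add_mem hb
        ((levelI hH).mul_mem_right _ (hH.basis_mem_of_far hh hkj.swap_right))), mul_comm] at h1
    exact (Ideal.unit_mul_mem_iff_mem _ (isUnit_hsgn J j.swap)).1 h1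
  -- Removing the component at `j` makes `ξ` orthogonal to `e_{-j}`; for such elements the claim
  -- follows from the previous lemma, applied to a conjugate of `h` under `T(e_{-j}, ξ)`.
  have h2 := key (ξ + -(𝕊).Q (ξ.vec.1 j • 𝐞 j)) (Q_sub_component_mem hξ.mem _ _)
    (by
      rw [Heis.vec_add, Heis.vec_neg, vec_Q, (𝕊).form.add_right, (𝕊).form.neg_right, hξ.orth,
        (𝕊).form.smul_right, form_far hkj]
      ring)
    (by
      rw [Heis.vec_add, Heis.vec_neg, vec_Q, (𝕊).form.add_right, (𝕊).form.neg_right,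
        (𝕊).form.smul_right, form_basis_swap', form_basis_left, Sum.swap_swap]
      ring)
  rw [Heis.vec_add, Heis.vec_neg, vec_Q, (𝕊).form.add_right, (𝕊).form.neg_right,
    (𝕊).form.smul_right, Ideal.add_mem_iff_left _ (neg_mem ((levelI hH).mul_mem_right _ hb))] at h2
  exact h2

end EClosed

end Images

/-! ### E-normal subgroups act by scalars modulo their level -/

section Scalars

variable {R : Type*} [CommRing R] {J : Pseudoinvolution R}
variable {V₀ : Type*} [AddCommGroup V₀] [Module R V₀] {S₀ : OddQuadraticSpace J V₀}

local notation "𝐞" => basisVec R V₀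
local notation "𝕊" => hypSpace 3 S₀

theorem Heis.act_zero {V : Type*} [AddCommGroup V] [Module R V] {B : AntiHermitianForm J V}
    (ξ : Heis B) : ξ.act 0 = 0 := by ext <;> simp

namespace EClosed

variable {H : Subgroup (hypU 3 S₀)}

/-- The coefficient of `h e_k` at `e_k` is a unit modulo the level ideal, because the unit
`B(h e_k, h e_{-k})` is congruent to a multiple of it. -/
theorem exists_inverse_coord (hH : EClosed H) {h : hypU 3 S₀} (hh : h ∈ H) (k : Theta 3) :
    ∃ c, (𝕊).form (h • 𝐞 k) (𝐞 k.swap) * c - 1 ∈ levelI hH := by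
  obtain ⟨u, hu⟩ := isUnit_hsgn J k
  set t := (h • 𝐞 k.swap).1 k.swap with ht
  have hA : (𝕊).Adm (𝐞 k) (h • (𝕊).Q (𝐞 k.swap) + -(𝕊).Q (t • 𝐞 k.swap)) :=
    ⟨Q_basis_mem S₀ k, Q_sub_component_mem ((𝕊).smul_mem_L h (Q_basis_mem S₀ _)) _ _, by
      rw [Heis.vec_add, Heis.vec_neg, vec_Q, vec_smul, vec_Q, (𝕊).form.add_right,
        (𝕊).form.neg_right, (𝕊).form.smul_right, form_basis_swap, form_basis_left]
      ring⟩
  have h1 := hH.form_mem_levelI hh hA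
  rw [Heis.vec_add, Heis.vec_neg, vec_Q, vec_smul, vec_Q, (𝕊).form.add_right,
    (𝕊).form_smul_smul, (𝕊).form.neg_right, (𝕊).form.smul_right, form_basis_swap] at h1
  refine ⟨t * ↑u⁻¹, ?_⟩
  have h2 := (levelI hH).mul_mem_left (-↑u⁻¹) h1
  convert h2 using 1
  rw [← hu]
  linear_combination u.inv_mul

set_option maxHeartbeats 1600000 in
/-- Elements of an E-normal subgroup map each `Q(e_j)` to a multiple of itself modulo the level.
The product `ρ` of `σ τ σ⁻¹` with an elementary `τ₀⁻¹` lies in `H` and fixes `e_{-i}`; here `τ`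
is a transvection which fixes `σ⁻¹ e_{-i}` and is congruent to `τ₀` modulo `H`. -/
theorem exists_scalar (hH : EClosed H) {σ : hypU 3 S₀} (hσ : σ ∈ H) (j : Theta 3) :
    ∃ a, (ext3 (level hH)).Cg (σ • (𝕊).Q (𝐞 j)) (((𝕊).Q (𝐞 j)).act a) := by
  obtain ⟨i, hji, -⟩ := exists_far j j
  obtain ⟨l, hjl, hil⟩ := exists_far j i
  have hσ' := H.inv_mem hσ
  have mj := hH.basis_mem_of_far hσ' hji.symm.swap_left
  have ml := hH.basis_mem_of_far hσ' hil.swap_left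
  obtain ⟨c, hc⟩ := hH.exists_inverse_coord hσ' i.swap
  obtain ⟨c', hc'⟩ := hH.exists_inverse_coord hσ l
  rw [Sum.swap_swap] at hc
  set p := σ⁻¹ • 𝐞 i.swap with hp
  set bi := (𝕊).form p (𝐞 i) with hbi
  set bj := (𝕊).form p (𝐞 j) with hbj
  set bl := (𝕊).form p (𝐞 l) with hbl
  -- Modulo the level, `u` and `v` are `e_j` and `e_l` up to a unit, and both are orthogonal to `p`.
  set u : (Theta 3 → R) × V₀ := bi • 𝐞 j + (-bj) • 𝐞 i with hu
  set v : (Theta 3 → R) × V₀ := bi • 𝐞 l + (-bl) • 𝐞 i with hv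
  have hjv : (𝕊).form (𝐞 j) v = 0 := by
    simp only [hv, (𝕊).form.add_right, (𝕊).form.smul_right, form_far, hjl, hji]; ring
  have hiv : (𝕊).form (𝐞 i) v = 0 := by
    simp only [hv, (𝕊).form.add_right, (𝕊).form.smul_right, form_far, hil, form_basis_self]; ring
  have Qv : (𝕊).Q v ∈ (𝕊).L := Q_pair_mem hil.symm.2 _ _
  have ajv : (𝕊).Adm (bi • 𝐞 j) ((𝕊).Q v) := Adm.smul_left ⟨Q_basis_mem S₀ j, Qv, hjv⟩ _
  have aiv0 : (𝕊).Adm (𝐞 i) ((𝕊).Q v) := ⟨Q_basis_mem S₀ i, Qv, hiv⟩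
  have aiv : (𝕊).Adm ((-bj) • 𝐞 i) ((𝕊).Q v) := aiv0.smul_left _
  have hij : (𝕊).form (bi • 𝐞 j) ((-bj) • 𝐞 i) = 0 := by
    rw [(𝕊).form.smul_left', (𝕊).form.smul_right, form_far hji]; ring
  have hA : (𝕊).Adm u ((𝕊).Q v) :=
    ⟨Q_pair_mem hji.2 _ _, Qv, by
      rw [hu, (𝕊).form.add_left, ajv.orth, aiv.orth, add_zero]⟩
  have a1 : (𝕊).Adm (bi • 𝐞 j) ((𝕊).Q (bi • 𝐞 l)) := (adm_short hjl.2 _).smul_left _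
  have a2 : (𝕊).Adm (bi • 𝐞 j) ((𝕊).Q ((-bl) • 𝐞 i)) := (adm_short hji.2 _).smul_left _
  set τ := (𝕊).tv u ((𝕊).Q v) with hτ
  set τ₀ := (𝕊).tv (bi • 𝐞 j) ((𝕊).Q (bi • 𝐞 l)) with hτ₀
  have τE : τ ∈ EU 3 S₀ := tv_mem_EU_of_orth (l := l)
    (by
      simp only [hu, (𝕊).form.add_right, (𝕊).form.smul_right, form_far, hjl.symm, hil.symm]
      ring)
    (by
      simp only [hu, (𝕊).form.add_right, (𝕊).form.smul_right, form_far, Far.swap_left_iff,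
        hjl.symm, hil.symm]
      ring) hA
  have τ₀E : τ₀ ∈ EU 3 S₀ := by
    rw [hτ₀, tv_smul_left (adm_short hjl.2 _)]
    exact tv_mem_EU ((adm_short hjl.2 _).act _)
  have h1 : τ₀⁻¹ * τ ∈ H := by
    have e1 : τ = τ₀ * ((𝕊).tv (bi • 𝐞 j) ((𝕊).Q ((-bl) • 𝐞 i)) *
        (𝕊).tv ((-bj) • 𝐞 i) ((𝕊).Q v)) := by
      rw [hτ, hu, tv_add_left ajv aiv hij, ← mul_assoc, hτ₀, ← tv_add a1 a2, hv, Q_add]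
      rw [(𝕊).form.smul_left', (𝕊).form.smul_right, form_far hil.symm]; ring
    rw [e1, inv_mul_cancel_left]
    refine H.mul_mem ?_ ?_
    · rw [tv_smul_left (adm_short hji.2 _), Q_act, smul_smul]
      exact (levelI hH).mul_mem_left _ ((levelI hH).neg_mem ml) _ _ hji
    · rw [tv_smul_left aiv0, Q_act, hv, smul_add, smul_smul, smul_smul, Q_add]
      · have e2 : J.cj (-bj) ∈ levelI hH := cj_mem_levelI ((levelI hH).neg_mem mj)
        exact ((rootSub H i).add_mem
          (Q_mem_rootSub' hil.2 ((levelI hH).mul_mem_right bi e2))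
          (Q_mem_rootSub' (Theta.ne_swap i) ((levelI hH).mul_mem_right (-bl) e2))).2
      · rw [(𝕊).form.smul_left', (𝕊).form.smul_right, form_far hil.symm]; ring
  have h2 : σ * τ * σ⁻¹ * τ₀⁻¹ ∈ H := by
    have := H.mul_mem (hH.comm_mem hσ τE) (hH τ₀ τ₀E _ h1)
    convert this using 1
    group
  set ρ := σ * τ * σ⁻¹ * τ₀⁻¹ with hρ
  have fix₀ : ∀ x : Theta 3, (𝕊).form (𝐞 j) (𝐞 x) = 0 → (𝕊).form (𝐞 l) (𝐞 x) = 0 →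
      τ₀ • 𝐞 x = 𝐞 x := fun x hx hx' => tv_smul_eq_self a1
    (by rw [(𝕊).form.smul_left', hx, mul_zero])
    (by rw [vec_Q, (𝕊).form.smul_left', hx', mul_zero])
  have fk := fix₀ i.swap (form_far hji.swap_right) (form_far hil.symm.swap_right)
  have fi := fix₀ i (form_far hji) (form_far hil.symm)
  have h3 : ρ • 𝐞 i.swap = 𝐞 i.swap := by
    have : τ₀⁻¹ • 𝐞 i.swap = 𝐞 i.swap := by rw [inv_smul_eq_iff, fk]
    rw [hρ, mul_smul, mul_smul, mul_smul, this, ← hp, tv_smul_eq_self hA, hp, smul_inv_smul]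
    · refine (𝕊).form.eq_zero_comm ?_
      simp only [hu, (𝕊).form.add_right, (𝕊).form.smul_right, ← hbi, ← hbj]
      ring
    · refine (𝕊).form.eq_zero_comm ?_
      simp only [vec_Q, hv, (𝕊).form.add_right, (𝕊).form.smul_right, ← hbi, ← hbl]
      ring
  have ak : (𝕊).Adm (𝐞 i.swap) (τ₀ • (𝕊).Q (𝐞 l.swap)) := by
    have := (adm_basis (S₀ := S₀) hil.swap_left.swap_right.2).smul τ₀
    rwa [fk] at this
  have ai : (𝕊).Adm (𝐞 i) (τ₀ • (𝕊).Q (𝐞 l.swap)) := by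
    have := (adm_basis (S₀ := S₀) hil.swap_right.2).smul τ₀
    rwa [fi] at this
  -- So the transvections `T(σ u, σ v)` and `τ₀` have congruent effects on `Q(e_{-l})`. The former
  -- changes it by a multiple of `Q(σ u)`, the latter by a multiple of `Q(e_j)`.
  have h4 := hH.fix_mem h2 h3 ak
  have h5 : (ρ • τ₀ • (𝕊).Q (𝐞 l.swap) + -(τ₀ • (𝕊).Q (𝐞 l.swap))).vec.1 i.swap ∈
      levelI hH := by
    have e1 := hH.form_mem_levelI (H.inv_mem h2) ai
    rw [(𝕊).form_smul_left, inv_inv] at e1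
    refine (Ideal.unit_mul_mem_iff_mem _ (isUnit_hsgn J i)).1 ?_
    rw [← form_basis_left (S₀ := S₀), Heis.vec_add, Heis.vec_neg, (𝕊).form.add_right,
      (𝕊).form.neg_right, ai.orth, neg_zero, add_zero]
    exact e1
  have h6 := OddFormIdeal.Cg.add_mem_left ak.mem (mem_ext3_level (hH := hH) h4 h5)
  rw [neg_add_cancel_right] at h6
  have e1 : ρ • τ₀ • (𝕊).Q (𝐞 l.swap) = (𝕊).tv (σ • u) ((𝕊).Q (σ • v)) • (𝕊).Q (𝐞 l.swap) := by
    have : ρ * τ₀ = (𝕊).tv (σ • u) (σ • (𝕊).Q v) := by rw [hρ, ← tv_conj, ← hτ]; group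
    rw [← mul_smul, this]; rfl
  have hσA : (𝕊).Adm (σ • u) ((𝕊).Q (σ • v)) := hA.smul σ
  rw [e1, tv_smul_Q hσA, hτ₀, tv_smul_Q a1] at h6
  have e2 : (𝕊).form (bi • 𝐞 j) (𝐞 l.swap) = 0 := by
    rw [(𝕊).form.smul_left', form_far hjl.swap_right, mul_zero]
  have e3 : (𝕊).form (σ • u) (𝐞 l.swap) ∈ levelI hH := by
    have : σ • u = bi • σ • 𝐞 j + (-bj) • σ • 𝐞 i := by
      rw [hu, smul_add, smul_comm σ, smul_comm σ]
    rw [this, (𝕊).form.add_left, (𝕊).form.smul_left', (𝕊).form.smul_left']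
    exact (levelI hH).add_mem
      ((levelI hH).mul_mem_left _ (hH.basis_mem_of_far hσ hjl.swap_right))
      ((levelI hH).mul_mem_left _ (hH.basis_mem_of_far hσ hil.swap_right))
  have e4 : (𝕊).form (σ • v) (𝐞 l.swap) = J.cj bi * (𝕊).form (σ • 𝐞 l) (𝐞 l.swap) -
      J.cj bl * (𝕊).form (σ • 𝐞 i) (𝐞 l.swap) := by
    have : σ • v = bi • σ • 𝐞 l + (-bl) • σ • 𝐞 i := by
      rw [hv, smul_add, smul_comm σ, smul_comm σ]
    rw [this, (𝕊).form.add_left, (𝕊).form.smul_left', (𝕊).form.smul_left', map_neg]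
    ring
  rw [e2, map_zero, zero_mul, mul_zero, map_zero, add_zero, add_zero, Heis.act_zero, add_zero,
    show (⟨0, 0⟩ : Heis (𝕊).form) = 0 from rfl, add_zero, vec_Q, (𝕊).form.smul_left',
    form_basis_swap, ← Q_act, Heis.act_act, vec_Q, scal_Q, zero_mul, add_zero] at h6
  set a := J.inv1 * (𝕊).form (σ • v) (𝐞 l.swap) with ha
  have h7 := h6.trans (ζ := (𝕊).Q (𝐞 l.swap) + ((𝕊).Q (σ • u)).act a) (by
    rw [add_assoc]
    refine (OddFormIdeal.Cg.add_mem_right ?_ ?_).symm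
    · exact (𝕊).L.add_mem (Q_basis_mem S₀ _) ((𝕊).act_mem _ hσA.iso _)
    · refine (ext3 (level hH)).M.add_mem ((ext3 (level hH)).act_mem_M hσA.mem e3)
        ((ext3 (level hH)).add_bar_mem_M ?_)
      exact Ideal.mul_mem_right _ _ ((ext3 (level hH)).cj_mem e3))
  have h8 := h7.add_left_cancel (OddFormIdeal.Cg.refl (Q_basis_mem S₀ _))
  have e5 : (𝕊).Q (σ • u) = (σ • (𝕊).Q (𝐞 j)).act bi + (σ • (𝕊).Q (𝐞 i)).act (-bj) := by
    rw [← smul_act, ← smul_act, ← smul_add, Q_act, Q_act, ← Q_add _ hij]; rfl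
  have Lj : σ • (𝕊).Q (𝐞 j) ∈ (𝕊).L := (𝕊).smul_mem_L σ (Q_basis_mem S₀ j)
  have h9 : (ext3 (level hH)).Cg ((σ • (𝕊).Q (𝐞 j)).act bi) ((𝕊).Q (σ • u)) := by
    rw [e5]
    exact OddFormIdeal.Cg.add_mem_right ((𝕊).act_mem _ Lj _) ((ext3 (level hH)).act_mem_M
      ((𝕊).smul_mem_L σ (Q_basis_mem S₀ i)) ((levelI hH).neg_mem mj))
  have h10 := ((h8.trans (h9.act a).symm).act (c * J.mu * J.cj c * c')).symm
  rw [Heis.act_act, Heis.act_act, Heis.act_act] at h10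
  refine ⟨_, (OddFormIdeal.Cg.act_one Lj ?_).symm.trans h10⟩
  change bi * (a * (c * J.mu * J.cj c * c')) - 1 ∈ levelI hH
  rw [← Ideal.Quotient.eq_zero_iff_mem] at ml hc hc' ⊢
  have hcc : Ideal.Quotient.mk (levelI hH) (J.cj bi * J.cj c - 1) = 0 := by
    rw [Ideal.Quotient.eq_zero_iff_mem] at hc ⊢
    have := cj_mem_levelI hc
    rwa [map_sub, map_mul, map_one] at this
  have hcl : Ideal.Quotient.mk (levelI hH) (J.cj bl) = 0 := by
    rw [Ideal.Quotient.eq_zero_iff_mem] at ml ⊢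
    exact cj_mem_levelI ml
  have hmu : Ideal.Quotient.mk (levelI hH) (J.mu * J.inv1 - 1) = 0 := by
    rw [J.mu_mul_inv1, sub_self, map_zero]
  -- The scalar multiplying `Q(σ e_j)` is a unit modulo the level ideal, with the given inverse.
  rw [ha, e4]
  simp only [map_sub, map_mul, map_one, hcl, zero_mul, sub_zero] at hc hc' hcc hmu ⊢
  set q := Ideal.Quotient.mk (levelI hH)
  linear_combination hc + (q bi * q c) * hcc + (q bi * q c * q (J.cj bi) * q (J.cj c)) * hc' +
    (q bi * q c * q (J.cj bi) * q (J.cj c) * q ((𝕊).form (σ • 𝐞 l) (𝐞 l.swap)) * q c') * hmu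

end EClosed

/-- If `G` is E-normal and its elements act by scalars on each `Q(e_j)`, then they act by scalars
on vectors orthogonal to a hyperbolic plane: apply the hypothesis to conjugates. -/
theorem Cg_act_of_orth {K : S₀.OddFormIdeal} {G : Subgroup (hypU 3 S₀)} (hG : EClosed G)
    (hD : ∀ σ ∈ G, ∀ j, ∃ a, (ext3 K).Cg (σ • (𝕊).Q (𝐞 j)) (((𝕊).Q (𝐞 j)).act a))
    {σ : hypU 3 S₀} (hσ : σ ∈ G) {i : Theta 3} {ζ : Heis (𝕊).form} (hζ : ζ ∈ (𝕊).L)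
    (h1 : (𝕊).form (𝐞 i) ζ.vec = 0) (h2 : (𝕊).form (𝐞 i.swap) ζ.vec = 0) {b : R}
    (hb : (ext3 K).Cg (σ • (𝕊).Q (𝐞 i.swap)) (((𝕊).Q (𝐞 i.swap)).act b)) :
    (ext3 K).Cg (σ • ζ) (ζ.act b) := by
  have hA : (𝕊).Adm (𝐞 i) ζ := ⟨Q_basis_mem S₀ i, hζ, h1⟩
  set T := (𝕊).tv (𝐞 i) ζ with hT
  have TE : T ∈ EU 3 S₀ := tv_mem_EU hA
  obtain ⟨m, hm⟩ := hD _ (EClosed.conj_inv_mem hG TE hσ) i.swap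
  obtain ⟨a, ha⟩ := hD σ hσ i
  have h3 := hm.smul (EU_smul_mem K TE)
  rw [smul_act, ← mul_smul, ← mul_assoc, ← mul_assoc, mul_inv_cancel, one_mul, mul_smul] at h3
  have e1 : T • (𝕊).Q (𝐞 i.swap) = (𝕊).Q (𝐞 i.swap) +
      (((𝕊).Q (𝐞 i)).act (J.inv1 * (ζ.scal * hsgn J i)) + ζ.act (hsgn J i)) := by
    rw [hT, tv_smul_Q hA, (𝕊).form.eq_zero_comm h2, form_basis_swap, mul_zero, map_zero, add_zero,
      zero_add, show (⟨0, 0⟩ : Heis (𝕊).form) = 0 from rfl, add_zero, add_assoc]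
  set r := J.inv1 * (ζ.scal * hsgn J i) with hr
  rw [e1, smul_add, smul_add, smul_act, smul_act, Heis.add_act, Heis.add_act, Heis.act_act,
    Heis.act_act] at h3
  have Lσζ := (𝕊).smul_mem_L σ hζ
  have coord : ∀ j : Theta 3, (∃ a, (ext3 K).Cg (σ⁻¹ • (𝕊).Q (𝐞 j)) (((𝕊).Q (𝐞 j)).act a)) →
      (𝕊).form (𝐞 j) ζ.vec = 0 → (σ • ζ).vec.1 j.swap ∈ K.I := by
    rintro j ⟨a, ha⟩ hj
    have h4 := ha.form_mem ((𝕊).mem_even_of_mem hζ)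
    rw [vec_smul, vec_Q, Heis.vec_act, vec_Q, (𝕊).form.smul_left', hj, mul_zero, sub_zero,
      (𝕊).form_smul_left, inv_inv, form_basis_left] at h4
    exact (Ideal.unit_mul_mem_iff_mem _ (isUnit_hsgn J j)).1 h4
  have c1 := coord i (hD _ (G.inv_mem hσ) i) h1
  have c2 := coord i.swap (hD _ (G.inv_mem hσ) i.swap) h2
  have z1 : ζ.vec.1 i.swap = 0 := coord_swap_eq_zero hA
  have z2 : ζ.vec.1 i = 0 := by
    have := coord_swap_eq_zero (S₀ := S₀) (k := i.swap) ⟨Q_basis_mem S₀ _, hζ, h2⟩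
    rwa [Sum.swap_swap] at this
  rw [Sum.swap_swap] at c2
  have Lζ := (𝕊).act_mem _ Lσζ (hsgn J i)
  -- Two evaluations of `σ T Q(e_{-i})`. Comparison of the coordinates at `±i` shows that the scalars
  -- agree, and what is left is the claim about `ζ`.
  have h4 := (hb.add ((ha.act r).add (OddFormIdeal.Cg.refl Lζ))).symm.trans h3
  rw [Heis.act_act] at h4
  have q1 := coord_mem_of_Cg h4 i.swap
  have q2 := coord_mem_of_Cg h4 i
  have s1 : (𝐞 i.swap).1 i.swap = (1 : R) := basis_coord_self _
  have s2 : (𝐞 i).1 i = (1 : R) := basis_coord_self _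
  have s3 : (𝐞 i).1 i.swap = (0 : R) := basis_coord_swap i
  have s4 : (𝐞 i.swap).1 i = (0 : R) := basis_coord_swap' i
  simp only [Heis.vec_add, Heis.vec_act, vec_Q, Prod.fst_add, Prod.smul_fst, Pi.add_apply,
    Pi.smul_apply, smul_eq_mul, s1, s2, s3, s4, z1, z2, mul_zero, mul_one, add_zero,
    zero_add] at q1 q2
  have r1 : b - m ∈ K.I := by
    have := K.I.sub_mem q1 (K.I.mul_mem_left (hsgn J i) c1)
    convert this using 1
    ring
  have r2 : a * r - r * m ∈ K.I := by
    have := K.I.sub_mem q2 (K.I.mul_mem_left (hsgn J i) c2)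
    convert this using 1
    ring
  have h5 := (h4.add_left_cancel (OddFormIdeal.Cg.act_right (Q_basis_mem S₀ _) r1)).add_left_cancel
    (OddFormIdeal.Cg.act_right (Q_basis_mem S₀ _) r2)
  obtain ⟨u, hu⟩ := isUnit_hsgn J i
  have h6 := h5.act (↑u⁻¹)
  rw [Heis.act_act, Heis.act_act, ← hu, Units.mul_inv, mul_right_comm, Units.mul_inv, one_mul,
    show (σ • ζ).act 1 = σ • ζ by ext <;> simp [J.mul_inv1]] at h6
  refine h6.trans (OddFormIdeal.Cg.act_right hζ ?_)
  have := K.I.neg_mem r1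
  rwa [neg_sub] at this

/-- The scalars belonging to the `Q(e_j)` agree modulo `I`, and `L` is generated by multiples of the
`Q(e_j)` and elements orthogonal to a hyperbolic plane. -/
theorem exists_Scal_of_basis {K : S₀.OddFormIdeal} {G : Subgroup (hypU 3 S₀)} (hG : EClosed G)
    (hD : ∀ σ ∈ G, ∀ j, ∃ a, (ext3 K).Cg (σ • (𝕊).Q (𝐞 j)) (((𝕊).Q (𝐞 j)).act a))
    {σ : hypU 3 S₀} (hσ : σ ∈ G) : ∃ a, (ext3 K).Scal σ a := by
  choose a ha using hD σ hσ
  have key : ∀ {i : Theta 3} {ζ : Heis (𝕊).form}, ζ ∈ (𝕊).L → (𝕊).form (𝐞 i) ζ.vec = 0 →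
      (𝕊).form (𝐞 i.swap) ζ.vec = 0 → (ext3 K).Cg (σ • ζ) (ζ.act (a i)) := by
    intro i ζ hζ h1 h2
    have h3 := ha i
    rw [← Sum.swap_swap i] at h3 h1
    have := Cg_act_of_orth hG hD hσ hζ h2 h1 h3
    rwa [Sum.swap_swap] at this
  have far : ∀ i j : Theta 3, Far i j → a j - a i ∈ K.I := by
    intro i j hij
    have h1 := (ha j).symm.trans (key (i := i) (Q_basis_mem S₀ j) (form_far hij)
      (form_far hij.swap_left))
    have := coord_mem_of_Cg h1 j
    simpa only [Heis.vec_act, vec_Q, Prod.smul_fst, Pi.smul_apply, basis_coord_self, smul_eq_mul,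
      mul_one] using this
  set i₀ : Theta 3 := Sum.inl 0 with hi₀
  have all : ∀ j, a j - a i₀ ∈ K.I := by
    intro j
    obtain ⟨l, hl, hl'⟩ := exists_far i₀ j
    have := K.I.add_mem (far l j hl'.symm) (far i₀ l hl)
    simpa using this
  let D : AddSubgroup (Heis (𝕊).form) :=
    { carrier := {ξ | (ext3 K).Cg (σ • ξ) (ξ.act (a i₀))}
      zero_mem' := by
        change (ext3 K).Cg (σ • 0) (Heis.act 0 (a i₀))
        rw [smul_zero, Heis.zero_act]; exact OddFormIdeal.Cg.refl (𝕊).L.zero_mem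
      add_mem' := fun {x y} hx hy => by
        change (ext3 K).Cg (σ • (x + y)) (Heis.act (x + y) (a i₀))
        rw [smul_add, Heis.add_act]; exact OddFormIdeal.Cg.add hx hy
      neg_mem' := fun {x} hx => by
        change (ext3 K).Cg (σ • -x) (Heis.act (-x) (a i₀))
        rw [smul_neg, Heis.neg_act]; exact OddFormIdeal.Cg.neg hx }
  refine ⟨a i₀, fun ξ hξ => ?_⟩
  change ξ ∈ D
  refine mem_of_components S₀ (fun j => ?_) ?_
  · change (ext3 K).Cg _ _
    have h1 := ((ha j).trans (OddFormIdeal.Cg.act_right (Q_basis_mem S₀ j) (all j))).act (ξ.vec.1 j)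
    rwa [← smul_act, Heis.act_act, mul_comm, ← Heis.act_act, Q_act] at h1
  · exact key (inr0_mem_L S₀ ((mem_L_iff S₀).1 hξ)) (by rw [form_basis_left]; simp)
      (by rw [form_basis_left]; simp)

/-- Every element of an E-normal subgroup acts on `L` as a scalar modulo the level. -/
theorem EClosed.exists_Scal {H : Subgroup (hypU 3 S₀)} (hH : EClosed H) {σ : hypU 3 S₀}
    (hσ : σ ∈ H) : ∃ a, (ext3 (level hH)).Scal σ a :=
  exists_Scal_of_basis hH (fun _ hσ j => hH.exists_scalar hσ j) hσ

end Scalars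

/-! ### Commutators of elementary transvections with congruence scalars -/

section Commutators

variable {R : Type*} [CommRing R] {J : Pseudoinvolution R}
variable {V₀ : Type*} [AddCommGroup V₀] [Module R V₀] {S₀ : OddQuadraticSpace J V₀}

local notation "𝐞" => basisVec R V₀
local notation "𝕊" => hypSpace 3 S₀

variable {K : S₀.OddFormIdeal}

variable (K) in
/-- The elementary `T` which commute with `σ` modulo the relative elementary subgroup. They form a
subgroup for arbitrary `σ`, as the relative elementary subgroup is normal in the elementary one. -/
def commSub (σ : hypU 3 S₀) : Subgroup (hypU 3 S₀) where
  carrier := {T | T ∈ EU 3 S₀ ∧ σ * T * σ⁻¹ * T⁻¹ ∈ relEU 3 K}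
  one_mem' := ⟨Subgroup.one_mem _, by simp⟩
  mul_mem' := by
    rintro a b ⟨h1, h2⟩ ⟨h3, h4⟩
    refine ⟨Subgroup.mul_mem _ h1 h3, ?_⟩
    have := Subgroup.mul_mem _ h2 (conj_mem_relEU K h1 h4)
    convert this using 1
    group
  inv_mem' := by
    rintro a ⟨h1, h2⟩
    refine ⟨Subgroup.inv_mem _ h1, ?_⟩
    have := conj_mem_relEU K (Subgroup.inv_mem _ h1) (Subgroup.inv_mem _ h2)
    convert this using 1
    group

theorem mem_commSub_of_mem {σ T : hypU 3 S₀} (h : T ∈ relEU 3 K)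
    (h' : σ * T * σ⁻¹ ∈ relEU 3 K) : T ∈ commSub K σ :=
  ⟨relEU_le_EU K h, Subgroup.mul_mem _ h' (Subgroup.inv_mem _ h)⟩

theorem conj_mem_of_mem_commSub {σ T : hypU 3 S₀} (h : T ∈ commSub K σ)
    (h' : T ∈ relEU 3 K) : σ * T * σ⁻¹ ∈ relEU 3 K := by
  simpa using Subgroup.mul_mem _ h.2 h'

/-- Multiplying `σ` by relative elementary elements does not matter. Together with `Scal_inv_mul`
this permits replacing `σ` by `η⁻¹ σ`. -/
theorem commSub_inv_mul_le {σ η : hypU 3 S₀} (hη : η ∈ relEU 3 K) :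
    commSub K (η⁻¹ * σ) ≤ commSub K σ := by
  rintro T ⟨h1, h2⟩
  refine ⟨h1, ?_⟩
  have := Subgroup.mul_mem _ (Subgroup.mul_mem _ hη h2)
    (conj_mem_relEU K h1 (Subgroup.inv_mem _ hη))
  convert this using 1
  group

theorem Scal_inv_mul {σ η : hypU 3 S₀} (hη : η ∈ relEU 3 K) {a : R} (h : (ext3 K).Scal σ a) :
    (ext3 K).Scal (η⁻¹ * σ) a := fun ξ hξ => by
  have h1 := mem_relU_iff.1 (relEU_le_relU K (Subgroup.inv_mem _ hη)) _ (h ξ hξ).left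
  rw [mul_smul]
  exact h1.symm.trans (h ξ hξ)

theorem Q_add_mem_L {V : Type*} [AddCommGroup V] [Module R V] {S : OddQuadraticSpace J V}
    {v w : V} (hv : S.Q v ∈ S.L) (hw : S.Q w ∈ S.L) (h : S.form v w = 0) :
    S.Q (v + w) ∈ S.L := by
  rw [Q_add _ h]; exact S.L.add_mem hv hw

section Triple

/-- No two of the basis vectors with the given three indices pair non-trivially. -/
def IsotropicTriple (t : Fin 3 → Theta 3) : Prop := ∀ a b, t b ≠ (t a).swap

/-- The combination of three basis vectors with given coefficients. -/
def comb (R : Type*) [CommRing R] (V₀ : Type*) [AddCommGroup V₀] [Module R V₀]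
    (t : Fin 3 → Theta 3) (u : Fin 3 → R) : (Theta 3 → R) × V₀ := ∑ a, u a • basisVec R V₀ (t a)

variable {t : Fin 3 → Theta 3}

theorem comb_eq (u : Fin 3 → R) : comb R V₀ t u = u 0 • 𝐞 (t 0) + u 1 • 𝐞 (t 1) +
    u 2 • 𝐞 (t 2) := Fin.sum_univ_three _

theorem comb_add (u v : Fin 3 → R) : comb R V₀ t (u + v) = comb R V₀ t u + comb R V₀ t v := by
  simp only [comb_eq, Pi.add_apply]; module

theorem comb_smul (r : R) (u : Fin 3 → R) : comb R V₀ t (r • u) = r • comb R V₀ t u := by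
  simp only [comb_eq, Pi.smul_apply, smul_eq_mul]; module

theorem form_comb_comb (ht : IsotropicTriple t) (u v : Fin 3 → R) :
    (𝕊).form (comb R V₀ t u) (comb R V₀ t v) = 0 := by
  have h : ∀ a b, (𝕊).form (𝐞 (t a)) (𝐞 (t b)) = 0 := fun a b => form_basis S₀ (ht a b)
  simp only [comb_eq, (𝕊).form.add_left, (𝕊).form.add_right, (𝕊).form.smul_left',
    (𝕊).form.smul_right, h]
  simp

theorem form_comb_basis (ht : IsotropicTriple t) (u : Fin 3 → R) (b : Fin 3) :
    (𝕊).form (comb R V₀ t u) (𝐞 (t b)) = 0 := by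
  have h : ∀ a b, (𝕊).form (𝐞 (t a)) (𝐞 (t b)) = 0 := fun a b => form_basis S₀ (ht a b)
  simp only [comb_eq, (𝕊).form.add_left, (𝕊).form.smul_left', h]
  simp

theorem Q_comb_mem (ht : IsotropicTriple t)
    {D : AddSubgroup (Heis (𝕊).form)} {u : Fin 3 → R}
    (h : ∀ a, (𝕊).Q (u a • 𝐞 (t a)) ∈ D) : (𝕊).Q (comb R V₀ t u) ∈ D := by
  have h0 : ∀ a b, (𝕊).form (𝐞 (t a)) (𝐞 (t b)) = 0 := fun a b => form_basis S₀ (ht a b)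
  rw [comb_eq, Q_add, Q_add]
  · exact D.add_mem (D.add_mem (h 0) (h 1)) (h 2)
  all_goals
    simp only [(𝕊).form.add_left, (𝕊).form.smul_left', (𝕊).form.smul_right, h0]
    simp

theorem adm_comb (ht : IsotropicTriple t) (u : Fin 3 → R) (b : Fin 3) (c : R) :
    (𝕊).Adm (comb R V₀ t u) ((𝕊).Q (c • 𝐞 (t b))) :=
  ⟨Q_comb_mem ht fun _ => Q_smul_basis_mem S₀ _ _, Q_smul_basis_mem S₀ _ _, by
    rw [vec_Q, (𝕊).form.smul_right, form_comb_basis ht, zero_mul]⟩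

theorem tv_comb_mem (ht : IsotropicTriple t) {G : Subgroup (hypU 3 S₀)} {u : Fin 3 → R}
    {b : Fin 3} {c : R}
    (h : ∀ a, (𝕊).tv (𝐞 (t a)) ((𝕊).Q ((J.cj (u a) * c) • 𝐞 (t b))) ∈ G) :
    (𝕊).tv (comb R V₀ t u) ((𝕊).Q (c • 𝐞 (t b))) ∈ G := by
  have h0 : ∀ a b, (𝕊).form (𝐞 (t a)) (𝐞 (t b)) = 0 := fun a b => form_basis S₀ (ht a b)
  have h1 : ∀ a, (𝕊).Adm (𝐞 (t a)) ((𝕊).Q (c • 𝐞 (t b))) := fun a => adm_short (ht a b) c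
  have h2 : ∀ a, (𝕊).Adm (u a • 𝐞 (t a)) ((𝕊).Q (c • 𝐞 (t b))) := fun a => (h1 a).smul_left _
  have h3 : ∀ a, (𝕊).tv (u a • 𝐞 (t a)) ((𝕊).Q (c • 𝐞 (t b))) ∈ G := fun a => by
    rw [tv_smul_left (h1 a), Q_act, smul_smul]; exact h a
  have e1 : (𝕊).form (u 0 • 𝐞 (t 0)) (u 1 • 𝐞 (t 1)) = 0 := by
    simp only [(𝕊).form.smul_left', (𝕊).form.smul_right, h0]; simp
  have e2 : (𝕊).form (u 0 • 𝐞 (t 0) + u 1 • 𝐞 (t 1)) (u 2 • 𝐞 (t 2)) = 0 := by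
    simp only [(𝕊).form.add_left, (𝕊).form.smul_left', (𝕊).form.smul_right, h0]; simp
  have h4 : (𝕊).Adm (u 0 • 𝐞 (t 0) + u 1 • 𝐞 (t 1)) ((𝕊).Q (c • 𝐞 (t b))) :=
    ⟨Q_add_mem_L (h2 0).iso (h2 1).iso e1, (h2 0).mem, by
      rw [(𝕊).form.add_left, (h2 0).orth, (h2 1).orth, add_zero]⟩
  rw [comb_eq, tv_add_left h4 (h2 2) e2, tv_add_left (h2 0) (h2 1) e1]
  exact G.mul_mem (G.mul_mem (h3 0) (h3 1)) (h3 2)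

variable (K) in
/-- The coefficient vectors `u` such that the transvections `T(∑ u_a e_{t_a}, e_{t_b} c)`, for all `b`
and `c`, commute with `σ` modulo the relative elementary subgroup. -/
noncomputable def commVec (ht : IsotropicTriple t) (σ : hypU 3 S₀) : Submodule R (Fin 3 → R) where
  carrier := {u | ∀ b c, (𝕊).tv (comb R V₀ t u) ((𝕊).Q (c • 𝐞 (t b))) ∈ commSub K σ}
  zero_mem' := fun b c => tv_comb_mem ht fun a => by
    rw [Pi.zero_apply, map_zero, zero_mul, zero_smul, Q_zero, tv_zero]; exact Subgroup.one_mem _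
  add_mem' := fun {u v} hu hv b c => by
    rw [comb_add, tv_add_left (adm_comb ht u b c) (adm_comb ht v b c) (form_comb_comb ht u v)]
    exact Subgroup.mul_mem _ (hu b c) (hv b c)
  smul_mem' := fun r u hu b c => by
    rw [comb_smul, tv_smul_left (adm_comb ht u b c), Q_act, smul_smul]
    exact hu b _

variable (S₀ t) in
/-- The pairings of a vector with the images of the three basis vectors under `σ`. -/
noncomputable def pairing (σ : hypU 3 S₀) (w : (Theta 3 → R) × V₀) : Fin 3 → R :=
  fun a => (𝕊).form w (σ • 𝐞 (t a))

theorem pairing_add (σ : hypU 3 S₀) (v w : (Theta 3 → R) × V₀) :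
    pairing S₀ t σ (v + w) = pairing S₀ t σ v + pairing S₀ t σ w :=
  funext fun _ => (𝕊).form.add_left _ _ _

theorem pairing_smul (σ : hypU 3 S₀) (c : R) (w : (Theta 3 → R) × V₀) :
    pairing S₀ t σ (c • w) = J.cj c • pairing S₀ t σ w :=
  funext fun _ => (𝕊).form.smul_left' _ _ _

theorem pairing_inv_mul (σ η : hypU 3 S₀) (w : (Theta 3 → R) × V₀) :
    pairing S₀ t (η⁻¹ * σ) w = pairing S₀ t σ (η • w) :=
  funext fun a => by
    change (𝕊).form w ((η⁻¹ * σ) • 𝐞 (t a)) = (𝕊).form (η • w) (σ • 𝐞 (t a))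
    rw [(𝕊).form_smul_left, mul_smul]

theorem form_smul_comb (σ : hypU 3 S₀) (w : (Theta 3 → R) × V₀) (u : Fin 3 → R) :
    (𝕊).form w (σ • comb R V₀ t u) = pairing S₀ t σ w ⬝ᵥ u := by
  rw [comb_eq, smul_add, smul_add, smul_comm σ, smul_comm σ, smul_comm σ]
  simp only [(𝕊).form.add_right, (𝕊).form.smul_right, dotProduct, Fin.sum_univ_three, pairing]

open Matrix

/-- Let `u` be the cross product of the pairings with `e_k` and `e_{-k}`. Then `u` vanishes
modulo `I`, and `σ u` is orthogonal to `H_k`. Hence a transvection along `u` and its conjugate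
under `σ` both lie in the relative elementary subgroup. -/
theorem cross_mem_commVec (ht : IsotropicTriple t) {σ : hypU 3 S₀} {r : R}
    (hσ : (ext3 K).Scal σ r) (k : Theta 3) :
    pairing S₀ t σ (𝐞 k) ⨯₃ pairing S₀ t σ (𝐞 k.swap) ∈ commVec K ht σ := by
  set u := pairing S₀ t σ (𝐞 k) ⨯₃ pairing S₀ t σ (𝐞 k.swap) with hu
  have small : ∀ k : Theta 3, ∀ a, t a ≠ k.swap → pairing S₀ t σ (𝐞 k) a ∈ K.I := by
    intro k a h
    have h1 := (hσ _ (Q_basis_mem S₀ (t a))).form_mem' (basis_mem_even S₀ k)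
    rwa [Heis.vec_act, vec_Q, (𝕊).form.smul_right, form_basis S₀ h, zero_mul, sub_zero] at h1
  have prod : ∀ a b, pairing S₀ t σ (𝐞 k) a * pairing S₀ t σ (𝐞 k.swap) b ∈ K.I := by
    intro a b
    by_cases h : t a = k.swap
    · refine K.I.mul_mem_left _ (small _ _ ?_)
      rw [← h]; exact ht a b
    · exact K.I.mul_mem_right _ (small _ _ h)
  have hI : ∀ a, u a ∈ K.I := by
    have e : u = ![_, _, _] := cross_apply _ _
    intro a
    rw [e]
    fin_cases a
    · exact K.I.sub_mem (prod 1 2) (prod 2 1)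
    · exact K.I.sub_mem (prod 2 0) (prod 0 2)
    · exact K.I.sub_mem (prod 0 1) (prod 1 0)
  have hM : σ • (𝕊).Q (comb R V₀ t u) ∈ (ext3 K).M :=
    hσ.smul_mem (Q_comb_mem ht fun a => Q_smul_basis_mem_ext3 K (hI a) _)
  have e1 : (𝕊).form (𝐞 k) (σ • comb R V₀ t u) = 0 := by
    rw [form_smul_comb, hu, dot_self_cross]
  have e2 : (𝕊).form (𝐞 k.swap) (σ • comb R V₀ t u) = 0 := by
    rw [form_smul_comb, hu, dot_cross_self]
  intro b c
  refine mem_commSub_of_mem (tv_comb_mem ht fun a => ?_) ?_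
  · exact tv_mem_relEU K (adm_short (ht a b) _)
      (Q_smul_basis_mem_ext3 K (K.I.mul_mem_right _ (K.cj_mem (hI a))) _)
  · rw [tv_conj]
    have hA := (adm_comb (S₀ := S₀) ht u b c).smul σ
    have key : ∀ k : Theta 3, (𝕊).form (𝐞 k) (σ • comb R V₀ t u) = 0 → ∀ d : R,
        (𝕊).tv (𝐞 k) ((𝕊).Q (d • σ • comb R V₀ t u)) ∈ relEU 3 K := by
      intro k hk d
      refine tv_mem_relEU K (Adm.smul_right ⟨Q_basis_mem S₀ k, hA.iso, hk⟩ d) ?_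
      rw [← Q_act]
      exact (ext3 K).act_mem _ hM d
    exact (EClosed_relEU K).tv_mem e1 e2 (key k e1) (key k.swap e2) hA

theorem commVec_inv_mul_le (ht : IsotropicTriple t) {σ η : hypU 3 S₀} (hη : η ∈ relEU 3 K) :
    commVec K ht (η⁻¹ * σ) ≤ commVec K ht σ := fun _ hu b c =>
  commSub_inv_mul_le hη (hu b c)

/-- Apply `cross_mem_commVec` to `η⁻¹ σ`, where `η = T(e_k, ζ)` fixes `e_k` and maps `e_{-k}` to a
combination of `e_{-k}`, `e_k` and `ζ`; then subtract the original statement. -/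
theorem cross_orth_mem_commVec (ht : IsotropicTriple t) {σ : hypU 3 S₀} {r : R}
    (hσ : (ext3 K).Scal σ r) {k : Theta 3} {ζ : Heis (𝕊).form} (hζ : ζ ∈ (ext3 K).M)
    (h1 : (𝕊).form (𝐞 k) ζ.vec = 0) (h2 : (𝕊).form (𝐞 k.swap) ζ.vec = 0) :
    pairing S₀ t σ (𝐞 k) ⨯₃ pairing S₀ t σ ζ.vec ∈ commVec K ht σ := by
  have hA : (𝕊).Adm (𝐞 k) ζ := ⟨Q_basis_mem S₀ k, (ext3 K).mem_L hζ, h1⟩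
  have hη := tv_mem_relEU K hA hζ
  have h3 := commVec_inv_mul_le ht hη (cross_mem_commVec ht (Scal_inv_mul hη hσ) k)
  rw [pairing_inv_mul, pairing_inv_mul, tv_smul_eq_self hA (form_basis_self S₀ k) hA.orth',
    tv_smul hA, form_basis_swap, (𝕊).form.eq_zero_comm h2, pairing_add, pairing_add, pairing_smul,
    pairing_smul, map_add, map_add, map_smul, map_smul, cross_self, smul_zero, add_zero] at h3
  have h4 := (Submodule.add_mem_iff_right _ (cross_mem_commVec ht hσ k)).1 h3
  obtain ⟨u, hu⟩ := (isUnit_hsgn J k).map J.cj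
  rw [← hu] at h4
  exact (Submodule.smul_mem_iff_of_isUnit _ u.isUnit).1 h4

/-- The second polarization, with `η = T(e_{-k}, ζ')`, which moves `e_k` by `ζ'`. -/
theorem cross_orth_orth_mem_commVec (ht : IsotropicTriple t) {σ : hypU 3 S₀} {r : R}
    (hσ : (ext3 K).Scal σ r) {k : Theta 3} {ζ ζ' : Heis (𝕊).form} (hζ : ζ ∈ (ext3 K).M)
    (h1 : (𝕊).form (𝐞 k) ζ.vec = 0) (h2 : (𝕊).form (𝐞 k.swap) ζ.vec = 0)
    (hζ' : ζ' ∈ (ext3 K).M)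
    (h1' : (𝕊).form (𝐞 k) ζ'.vec = 0) (h2' : (𝕊).form (𝐞 k.swap) ζ'.vec = 0) :
    pairing S₀ t σ ζ'.vec ⨯₃ pairing S₀ t σ ζ.vec ∈ commVec K ht σ := by
  have hA : (𝕊).Adm (𝐞 k.swap) ζ' := ⟨Q_basis_mem S₀ _, (ext3 K).mem_L hζ', h2'⟩
  have hη := tv_mem_relEU K hA hζ'
  have h3 := commVec_inv_mul_le ht hη
    (cross_orth_mem_commVec ht (Scal_inv_mul hη hσ) hζ h1 h2)
  have p1 := cross_orth_mem_commVec ht hσ hζ h1 h2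
  have p2 := cross_orth_mem_commVec (k := k.swap) ht hσ hζ h2 (by rwa [Sum.swap_swap])
  have p3 := cross_orth_mem_commVec (k := k.swap) ht hσ hζ' h2' (by rwa [Sum.swap_swap])
  have p4 := cross_mem_commVec ht hσ k
  rw [pairing_inv_mul, pairing_inv_mul, tv_smul hA, tv_smul hA, form_basis_swap',
    (𝕊).form.eq_zero_comm h1', h2, zero_smul, add_zero] at h3
  simp only [pairing_add, pairing_smul, map_add, map_smul, LinearMap.add_apply,
    LinearMap.smul_apply, cross_self, smul_zero, add_zero] at h3
  rw [← cross_anticomm] at p3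
  have p3' := Submodule.neg_mem _ p3
  rw [neg_neg] at p3'
  rw [Submodule.add_mem_iff_left _ (Submodule.smul_mem _ _ (Submodule.add_mem _ p4
    (Submodule.smul_mem _ _ p3'))), Submodule.add_mem_iff_right _ (Submodule.add_mem _ p1
    (Submodule.smul_mem _ _ p2))] at h3
  exact (Submodule.smul_mem_iff_of_isUnit _ ((isUnit_hsgn J k.swap).map J.cj)).1 h3

/-- All elements of `M` are reached by splitting off their components in one hyperbolic plane. -/
theorem cross_mem_commVec_of_mem (ht : IsotropicTriple t) {σ : hypU 3 S₀} {r : R}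
    (hσ : (ext3 K).Scal σ r) {ζ ζ' : Heis (𝕊).form} (hζ : ζ ∈ (ext3 K).M)
    (hζ' : ζ' ∈ (ext3 K).M) :
    pairing S₀ t σ ζ.vec ⨯₃ pairing S₀ t σ ζ'.vec ∈ commVec K ht σ := by
  have anti : ∀ {v w : Fin 3 → R}, v ⨯₃ w ∈ commVec K ht σ → w ⨯₃ v ∈ commVec K ht σ :=
    fun h => by rw [← cross_anticomm]; exact Submodule.neg_mem _ h
  obtain ⟨k, hk⟩ : ∃ k : Theta 3, k = Sum.inl 0 := ⟨_, rfl⟩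
  have dec : ∀ ζ : Heis (𝕊).form, ζ ∈ (ext3 K).M → ∃ η ∈ (ext3 K).M, ∃ a b : R,
      (𝕊).form (𝐞 k) η.vec = 0 ∧ (𝕊).form (𝐞 k.swap) η.vec = 0 ∧
      ζ.vec = η.vec + (a • 𝐞 k + b • 𝐞 k.swap) := by
    intro ζ hζ
    have hI := ((mem_ext3_iff K).1 hζ).1
    refine ⟨ζ + -(𝕊).Q (ζ.vec.1 k • 𝐞 k) + -(𝕊).Q (ζ.vec.1 k.swap • 𝐞 k.swap),
      (ext3 K).M.add_mem ((ext3 K).M.add_mem hζ ((ext3 K).M.neg_mem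
        (Q_smul_basis_mem_ext3 K (hI _) _))) ((ext3 K).M.neg_mem
        (Q_smul_basis_mem_ext3 K (hI _) _)), ζ.vec.1 k, ζ.vec.1 k.swap, ?_, ?_, ?_⟩
    · simp only [Heis.vec_add, Heis.vec_neg, vec_Q, (𝕊).form.add_right, (𝕊).form.neg_right,
        (𝕊).form.smul_right, form_basis_self, form_basis_swap]
      rw [form_basis_left]; ring
    · simp only [Heis.vec_add, Heis.vec_neg, vec_Q, (𝕊).form.add_right, (𝕊).form.neg_right,
        (𝕊).form.smul_right, form_basis_self, form_basis_swap']
      rw [form_basis_left, Sum.swap_swap]; ring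
    · simp only [Heis.vec_add, Heis.vec_neg, vec_Q]; abel
  obtain ⟨η, hη, a, b, h1, h2, e⟩ := dec ζ hζ
  obtain ⟨η', hη', a', b', h1', h2', e'⟩ := dec ζ' hζ'
  have p0 := cross_mem_commVec ht hσ k
  have q1 := cross_orth_mem_commVec ht hσ hη h1 h2
  have q2 := cross_orth_mem_commVec (k := k.swap) ht hσ hη h2 (by rwa [Sum.swap_swap])
  have q1' := cross_orth_mem_commVec ht hσ hη' h1' h2'
  have q2' := cross_orth_mem_commVec (k := k.swap) ht hσ hη' h2' (by rwa [Sum.swap_swap])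
  have q3 := cross_orth_orth_mem_commVec ht hσ hη' h1' h2' hη h1 h2
  rw [e, e']
  simp only [pairing_add, pairing_smul, map_add, map_smul, LinearMap.add_apply,
    LinearMap.smul_apply, cross_self, smul_zero, add_zero, zero_add]
  repeat' first
    | apply Submodule.add_mem
    | apply Submodule.smul_mem
    | assumption
    | exact anti (by assumption)

theorem IsotropicTriple.of_far (hf : ∀ a b, a ≠ b → Far (t a) (t b)) : IsotropicTriple t := by
  intro a b
  by_cases h : a = b
  · rw [h]; exact Theta.ne_swap _
  · exact (hf a b h).2

/-- The images under `σ` of the vectors `e_{-t_a}`, multiplied by elements of `I`, have coordinate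
vectors as pairings. -/
theorem single_mem_commVec (hf : ∀ a b, a ≠ b → Far (t a) (t b)) {σ : hypU 3 S₀} {r : R}
    (hσ : (ext3 K).Scal σ r) (c : Fin 3) {x y : R} (hx : x ∈ K.I) (hy : y ∈ K.I) :
    Pi.single c (x * y) ∈ commVec K (IsotropicTriple.of_far hf) σ := by
  have e1 : ∀ a, pairing S₀ t σ (σ • 𝐞 (t a).swap) = Pi.single a (hsgn J (t a).swap) := by
    intro a
    ext d
    change (𝕊).form _ _ = _
    rw [(𝕊).form_smul_smul]
    by_cases h : d = a
    · rw [h, form_basis_swap', Pi.single_eq_same]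
    · rw [form_far (hf a d (Ne.symm h)).swap_left, Pi.single_eq_of_ne h]
  have e2 : ∀ a, ∀ z ∈ K.I, (σ • (𝕊).Q (𝐞 (t a).swap)).act z ∈ (ext3 K).M := fun a z hz =>
    (ext3 K).act_mem_M ((𝕊).smul_mem_L σ (Q_basis_mem S₀ _)) hz
  have h1 := cross_mem_commVec_of_mem (IsotropicTriple.of_far hf) hσ
    (e2 (c + 1) _ (K.cj_mem hx)) (e2 (c + 2) _ (K.cj_mem hy))
  have e3 : ∀ v w : R, (Pi.single (c + 1) v : Fin 3 → R) ⨯₃ Pi.single (c + 2) w =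
      Pi.single c (v * w) := by
    intro v w
    fin_cases c <;> ext i <;> fin_cases i <;> simp [cross_apply, Pi.single_apply]
  rw [Heis.vec_act, Heis.vec_act, OddQuadraticSpace.vec_smul, OddQuadraticSpace.vec_smul, vec_Q,
    vec_Q, pairing_smul, pairing_smul, e1, e1, J.cj_cj, J.cj_cj, map_smul, map_smul,
    LinearMap.smul_apply, e3] at h1
  refine (Submodule.smul_mem_iff_of_isUnit _
    ((isUnit_hsgn J (t (c + 1)).swap).mul (isUnit_hsgn J (t (c + 2)).swap))).1 ?_
  convert h1 using 1
  ext d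
  simp only [Pi.smul_apply, Pi.single_apply, smul_eq_mul]
  split_ifs <;> ring

theorem exists_triple {i j : Theta 3} (h : Far i j) : ∃ t : Fin 3 → Theta 3,
    (∀ a b, a ≠ b → Far (t a) (t b)) ∧ t 0 = i ∧ t 1 = j := by
  obtain ⟨l, hl, hl'⟩ := exists_far i j
  refine ⟨![i, j, l], fun a b hab => ?_, rfl, rfl⟩
  fin_cases a <;> fin_cases b <;> first
    | exact absurd rfl hab
    | exact h
    | exact h.symm
    | exact hl
    | exact hl.symm
    | exact hl'
    | exact hl'.symm

end Triple

/-- Transvections whose coefficients are products of two elements of `I` commute with `σ` modulo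
the relative elementary subgroup. -/
theorem mul_mem_commSub {σ : hypU 3 S₀} {r : R} (hσ : (ext3 K).Scal σ r) {i j : Theta 3}
    (hij : j ≠ i.swap) {x y : R} (hx : x ∈ K.I) (hy : y ∈ K.I) (d : R) :
    (𝕊).tv (𝐞 i) ((𝕊).Q ((x * y * d) • 𝐞 j)) ∈ commSub K σ := by
  obtain ⟨t, hf, a, b, rfl, rfl⟩ : ∃ t : Fin 3 → Theta 3, (∀ a b, a ≠ b → Far (t a) (t b)) ∧
      ∃ a b, t a = i ∧ t b = j := by
    by_cases h : j = i
    · obtain ⟨l, hl, -⟩ := exists_far i i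
      obtain ⟨t, hf, h0, -⟩ := exists_triple hl
      exact ⟨t, hf, 0, 0, h0, by rw [h0, h]⟩
    · obtain ⟨t, hf, h0, h1⟩ := exists_triple ⟨h, hij⟩
      exact ⟨t, hf, 0, 1, h0, h1⟩
  have h1 := single_mem_commVec hf hσ a (K.cj_mem hx) (K.cj_mem hy) b d
  have e : comb R V₀ t (Pi.single a (J.cj x * J.cj y)) = (J.cj x * J.cj y) • 𝐞 (t a) := by
    rw [comb, Finset.sum_eq_single a, Pi.single_eq_same]
    · intro b _ hb; rw [Pi.single_eq_of_ne hb, zero_smul]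
    · simp
  rw [e, tv_smul_left (adm_short hij d), Q_act, smul_smul, map_mul, J.cj_cj, J.cj_cj] at h1
  exact h1

end Commutators

/-! ### Scalars commute with elementary transformations modulo the relative subgroup -/

section Bootstrap

variable {R : Type*} [CommRing R] {J : Pseudoinvolution R}
variable {V₀ : Type*} [AddCommGroup V₀] [Module R V₀] {S₀ : OddQuadraticSpace J V₀}

local notation "𝐞" => basisVec R V₀
local notation "𝕊" => hypSpace 3 S₀

variable {K : S₀.OddFormIdeal}

variable (K) in
/-- Congruence of elementary transformations modulo the relative elementary subgroup. -/
def ECong (a b : hypU 3 S₀) : Prop := a ∈ EU 3 S₀ ∧ b ∈ EU 3 S₀ ∧ a * b⁻¹ ∈ relEU 3 K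

namespace ECong

variable {a b c d : hypU 3 S₀}

theorem mul (h : ECong K a b) (h' : ECong K c d) : ECong K (a * c) (b * d) := by
  refine ⟨Subgroup.mul_mem _ h.1 h'.1, Subgroup.mul_mem _ h.2.1 h'.2.1, ?_⟩
  have := Subgroup.mul_mem _ (conj_mem_relEU K h.1 h'.2.2) h.2.2
  convert this using 1
  group

theorem inv (h : ECong K a b) : ECong K a⁻¹ b⁻¹ := by
  refine ⟨Subgroup.inv_mem _ h.1, Subgroup.inv_mem _ h.2.1, ?_⟩
  have := conj_mem_relEU K (Subgroup.inv_mem _ h.1) (Subgroup.inv_mem _ h.2.2)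
  convert this using 1
  group

theorem tv {k : Theta 3} {ξ η : Heis (𝕊).form} (h : (𝕊).Adm (𝐞 k) ξ) (h' : (𝕊).Adm (𝐞 k) η)
    (hc : (ext3 K).Cg ξ η) : ECong K ((𝕊).tv (𝐞 k) ξ) ((𝕊).tv (𝐞 k) η) := by
  refine ⟨tv_mem_EU h, tv_mem_EU h', ?_⟩
  rw [← tv_neg h', ← tv_add h h'.neg]
  have := hc.neg.mem
  rw [neg_neg] at this
  exact tv_mem_relEU K (h.add h'.neg) this

end ECong

/-- A transvection along a totally isotropic plane orthogonal to `H_k` is a commutator. -/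
theorem tv_eq_commutator {k : Theta 3} {x y : (Theta 3 → R) × V₀} (hA : (𝕊).Adm x ((𝕊).Q y))
    (hx : (𝕊).form (𝐞 k) x = 0) (hx' : (𝕊).form (𝐞 k.swap) x = 0)
    (hy : (𝕊).form (𝐞 k) y = 0) (hy' : (𝕊).form (𝐞 k.swap) y = 0) {u : Rˣ}
    (hu : (u : R) = hsgn J k) : (𝕊).tv x ((𝕊).Q y) =
      ((𝕊).tv (𝐞 k.swap) ((𝕊).Q y))⁻¹ * ((𝕊).tv (𝐞 k) ((𝕊).Q ((↑u⁻¹ : R) • x)) *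
        (𝕊).tv (𝐞 k.swap) ((𝕊).Q y) * ((𝕊).tv (𝐞 k) ((𝕊).Q ((↑u⁻¹ : R) • x)))⁻¹) := by
  have a1 : (𝕊).Adm (𝐞 k) ((𝕊).Q ((↑u⁻¹ : R) • x)) :=
    Adm.smul_right ⟨Q_basis_mem S₀ k, hA.iso, hx⟩ _
  have a2 : (𝕊).Adm (𝐞 k.swap) ((𝕊).Q y) := ⟨Q_basis_mem S₀ _, hA.mem, hy'⟩
  have r1 : (𝕊).tv (𝐞 k) ((𝕊).Q ((↑u⁻¹ : R) • x)) • 𝐞 k.swap = 𝐞 k.swap + x := by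
    rw [tv_smul a1, vec_Q, scal_Q, form_basis_swap, smul_smul, ← hu,
      Units.mul_inv, (𝕊).form.smul_left', (𝕊).form.eq_zero_comm hx']
    simp
  have r2 : (𝕊).tv (𝐞 k) ((𝕊).Q ((↑u⁻¹ : R) • x)) • (𝕊).Q y = (𝕊).Q y := by
    ext1
    · exact tv_smul_eq_self a1 hy (by
        have := hA.orth
        rw [vec_Q] at this
        rw [vec_Q, vec_Q, (𝕊).form.smul_left', this, mul_zero])
    · rfl
  rw [tv_conj, r1, r2, tv_add_left a2 hA hx', inv_mul_cancel_left]

/-- Congruent totally isotropic planes orthogonal to `H_k` have congruent transvections: this holds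
for transvections based at `e_k` and `e_{-k}`, of which they are commutators. -/
theorem tv_ECong_of_orth {k : Theta 3} {x y x' y' : (Theta 3 → R) × V₀}
    (hA : (𝕊).Adm x ((𝕊).Q y)) (hx : (𝕊).form (𝐞 k) x = 0) (hx₁ : (𝕊).form (𝐞 k.swap) x = 0)
    (hy : (𝕊).form (𝐞 k) y = 0) (hy₁ : (𝕊).form (𝐞 k.swap) y = 0)
    (hA' : (𝕊).Adm x' ((𝕊).Q y')) (hx' : (𝕊).form (𝐞 k) x' = 0)
    (hx₁' : (𝕊).form (𝐞 k.swap) x' = 0) (hy' : (𝕊).form (𝐞 k) y' = 0)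
    (hy₁' : (𝕊).form (𝐞 k.swap) y' = 0) (hxx : (ext3 K).Cg ((𝕊).Q x) ((𝕊).Q x'))
    (hyy : (ext3 K).Cg ((𝕊).Q y) ((𝕊).Q y')) :
    ECong K ((𝕊).tv x ((𝕊).Q y)) ((𝕊).tv x' ((𝕊).Q y')) := by
  obtain ⟨u, hu⟩ := isUnit_hsgn J k
  rw [tv_eq_commutator hA hx hx₁ hy hy₁ hu, tv_eq_commutator hA' hx' hx₁' hy' hy₁' hu]
  have h1 : ECong K ((𝕊).tv (𝐞 k) ((𝕊).Q ((↑u⁻¹ : R) • x)))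
      ((𝕊).tv (𝐞 k) ((𝕊).Q ((↑u⁻¹ : R) • x'))) :=
    ECong.tv (Adm.smul_right ⟨Q_basis_mem S₀ k, hA.iso, hx⟩ _)
      (Adm.smul_right ⟨Q_basis_mem S₀ k, hA'.iso, hx'⟩ _) (by
        rw [← Q_act, ← Q_act]; exact hxx.act _)
  have h2 : ECong K ((𝕊).tv (𝐞 k.swap) ((𝕊).Q y)) ((𝕊).tv (𝐞 k.swap) ((𝕊).Q y')) :=
    ECong.tv ⟨Q_basis_mem S₀ _, hA.mem, hy₁⟩ ⟨Q_basis_mem S₀ _, hA'.mem, hy₁'⟩ hyy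
  exact h2.inv.mul ((h1.mul h2).mul h1.inv)

/-- As `tv_ECong_of_orth`, where one of the two planes is only orthogonal to `e_k`. -/
theorem tv_ECong {k : Theta 3} {x y x' y' : (Theta 3 → R) × V₀}
    (hA : (𝕊).Adm x ((𝕊).Q y)) (hx : (𝕊).form (𝐞 k) x = 0) (hy : (𝕊).form (𝐞 k) y = 0)
    (hA' : (𝕊).Adm x' ((𝕊).Q y')) (hx' : (𝕊).form (𝐞 k) x' = 0)
    (hx₁' : (𝕊).form (𝐞 k.swap) x' = 0) (hy' : (𝕊).form (𝐞 k) y' = 0)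
    (hy₁' : (𝕊).form (𝐞 k.swap) y' = 0) (hxx : (ext3 K).Cg ((𝕊).Q x) ((𝕊).Q x'))
    (hyy : (ext3 K).Cg ((𝕊).Q y) ((𝕊).Q y')) :
    (𝕊).tv x ((𝕊).Q y) * ((𝕊).tv x' ((𝕊).Q y'))⁻¹ ∈ relEU 3 K := by
  -- A vector orthogonal to `e_k` and congruent to one orthogonal to `H_k` becomes orthogonal to `H_k`
  -- when a multiple of `e_k` with coefficient in `I` is removed.
  have red : ∀ {z z' : (Theta 3 → R) × V₀}, (𝕊).form (𝐞 k) z = 0 →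
      (𝕊).form (𝐞 k.swap) z' = 0 → (ext3 K).Cg ((𝕊).Q z) ((𝕊).Q z') → ∃ z₀, ∃ a ∈ K.I,
      z = z₀ + a • 𝐞 k ∧ (𝕊).form (𝐞 k) z₀ = 0 ∧ (𝕊).form (𝐞 k.swap) z₀ = 0 ∧
      (ext3 K).Cg ((𝕊).Q z₀) ((𝕊).Q z') := by
    intro z z' hz hz' hzz
    have hc := coord_mem_of_Cg hzz k
    have h0 : z'.1 k = 0 := by
      rw [form_basis_left, Sum.swap_swap] at hz'
      exact (isUnit_hsgn J k.swap).mul_right_eq_zero.1 hz'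
    rw [vec_Q, vec_Q, h0, sub_zero] at hc
    have ho : (𝕊).form z (-(z.1 k) • 𝐞 k) = 0 := by
      rw [(𝕊).form.smul_right, (𝕊).form.eq_zero_comm hz, zero_mul]
    refine ⟨z + -(z.1 k) • 𝐞 k, z.1 k, hc, by module, ?_, ?_, ?_⟩
    · rw [(𝕊).form.add_right, hz, (𝕊).form.smul_right, form_basis_self]; ring
    · rw [(𝕊).form.add_right, form_basis_left, Sum.swap_swap, (𝕊).form.smul_right,
        form_basis_swap']
      ring
    · rw [Q_add _ ho]
      exact (OddFormIdeal.Cg.add_mem_right hzz.left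
        (Q_smul_basis_mem_ext3 K (K.I.neg_mem hc) k)).symm.trans hzz
  obtain ⟨x₀, a, ha, ex, x1, x2, hxx₀⟩ := red hx hx₁' hxx
  obtain ⟨y₀, b, hb, ey, y1, y2, hyy₀⟩ := red hy hy₁' hyy
  have a1 : (𝕊).Adm (𝐞 k) ((𝕊).Q y) := ⟨Q_basis_mem S₀ k, hA.mem, hy⟩
  have a2 : (𝕊).Adm x₀ ((𝕊).Q y) := ⟨hxx₀.left, hA.mem, by
    have := hA.orth
    rwa [ex, (𝕊).form.add_left, (𝕊).form.smul_left', a1.orth, mul_zero, add_zero] at this⟩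
  have a3 : (𝕊).Adm (𝐞 k) ((𝕊).Q x₀) := ⟨Q_basis_mem S₀ k, hxx₀.left, x1⟩
  have a4 : (𝕊).Adm x₀ ((𝕊).Q (b • 𝐞 k)) := a3.symm.smul_right b
  have a5 : (𝕊).Adm x₀ ((𝕊).Q y₀) := ⟨hxx₀.left, hyy₀.left, by
    have h1 := a2.orth
    have h2 := a4.orth
    rw [vec_Q] at h1 h2
    rwa [ey, (𝕊).form.add_right, h2, add_zero] at h1⟩
  have hyk : (𝕊).form y₀ (b • 𝐞 k) = 0 := by
    rw [(𝕊).form.smul_right, (𝕊).form.eq_zero_comm y1, zero_mul]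
  have e1 : (𝕊).tv x ((𝕊).Q y) = (𝕊).tv x₀ ((𝕊).Q y₀) * ((𝕊).tv x₀ ((𝕊).Q (b • 𝐞 k)) *
      (𝕊).tv (a • 𝐞 k) ((𝕊).Q y)) := by
    have hxk : (𝕊).form x₀ (a • 𝐞 k) = 0 := by
      rw [(𝕊).form.smul_right, (𝕊).form.eq_zero_comm x1, zero_mul]
    rw [← mul_assoc, ← tv_add a5 a4, ← Q_add _ hyk, ← ey, ← tv_add_left a2 (a1.smul_left a) hxk,
      ← ex]
  have n1 : (𝕊).tv (a • 𝐞 k) ((𝕊).Q y) ∈ relEU 3 K := by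
    rw [tv_smul_left a1]
    exact tv_mem_relEU K (a1.act _) ((ext3 K).act_mem_M hA.mem (K.cj_mem ha))
  have n2 : (𝕊).tv x₀ ((𝕊).Q (b • 𝐞 k)) ∈ relEU 3 K := by
    rw [tv_swap a4, tv_smul_left (a3.smul_right _), Q_act, smul_smul, ← Q_act]
    exact tv_mem_relEU K (a3.act _) ((ext3 K).act_mem_M hxx₀.left
      (K.I.mul_mem_right _ (K.cj_mem hb)))
  have h1 := tv_ECong_of_orth a5 x1 x2 y1 y2 hA' hx' hx₁' hy' hy₁' hxx₀ hyy₀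
  have h2 := Subgroup.mul_mem _ (conj_mem_relEU K h1.1 (Subgroup.mul_mem _ n2 n1)) h1.2.2
  rw [e1]
  convert h2 using 1
  group

/-- The scalar of a unitary transformation is unitary modulo `I`, since `B(e_l, e_{-l})` is a unit. -/
theorem Scal_mul_cj {σ : hypU 3 S₀} {r : R} (hσ : (ext3 K).Scal σ r) :
    J.cj r * r - 1 ∈ K.I := by
  obtain ⟨l, hl⟩ : ∃ l : Theta 3, l = Sum.inl 0 := ⟨_, rfl⟩
  have h1 := (hσ _ (Q_basis_mem S₀ l)).form_mem
    ((𝕊).mem_even_of_mem ((𝕊).smul_mem_L σ (Q_basis_mem S₀ l.swap)))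
  have h2 := (hσ _ (Q_basis_mem S₀ l.swap)).form_mem' (basis_mem_even S₀ l)
  simp only [vec_smul, vec_Q, Heis.vec_act, (𝕊).form_smul_smul, (𝕊).form.smul_left',
    (𝕊).form.smul_right, form_basis_swap] at h1 h2
  have h3 := K.I.add_mem h1 (K.I.mul_mem_left (J.cj r) h2)
  refine (Ideal.unit_mul_mem_iff_mem _ (isUnit_hsgn J l)).1 ?_
  have h4 := K.I.neg_mem h3
  convert h4 using 1
  ring

set_option maxHeartbeats 1600000 in
/-- The step from coefficients in `c I` to the coefficient `c`. With `β_x = B(e_{-l}, σ e_x)`, the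
transvection along the plane spanned by `u = β_l e_a - β_a e_l` and `v = β_l e_b - β_b e_l` is
congruent to one along `e_a` and `e_b`, and so is its conjugate under `σ`, since `σ u` and `σ v` are
orthogonal to `e_{-l}`. -/
theorem mem_commSub_of_mul_mem {σ : hypU 3 S₀} {r : R} (hσ : (ext3 K).Scal σ r) {c : R}
    (h : ∀ i j, Far i j → ∀ x ∈ K.I, (𝕊).tv (𝐞 i) ((𝕊).Q ((c * x) • 𝐞 j)) ∈ commSub K σ)
    {a b : Theta 3} (hab : Far a b) : (𝕊).tv (𝐞 a) ((𝕊).Q (c • 𝐞 b)) ∈ commSub K σ := by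
  obtain ⟨l, hal, hbl⟩ := exists_far a b
  have pair : ∀ x : Theta 3, (𝕊).form (𝐞 l.swap) (σ • 𝐞 x) -
      (𝕊).form (𝐞 l.swap) (𝐞 x) * r ∈ K.I := fun x => by
    have := (hσ _ (Q_basis_mem S₀ x)).form_mem' (basis_mem_even S₀ l.swap)
    rwa [vec_smul, vec_Q, Heis.vec_act, vec_Q, (𝕊).form.smul_right] at this
  have ma := pair a
  have mb := pair b
  have ml := pair l
  rw [form_far hal.symm.swap_left, zero_mul, sub_zero] at ma
  rw [form_far hbl.symm.swap_left, zero_mul, sub_zero] at mb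
  rw [form_basis_swap'] at ml
  set ba := (𝕊).form (𝐞 l.swap) (σ • 𝐞 a) with hba
  set bb := (𝕊).form (𝐞 l.swap) (σ • 𝐞 b) with hbb
  set bl := (𝕊).form (𝐞 l.swap) (σ • 𝐞 l) with hbl'
  obtain ⟨e, he⟩ := ((isUnit_hsgn J l.swap).map J.cj).mul (isUnit_hsgn J l.swap)
  have hr := Scal_mul_cj hσ
  have hbe : J.cj bl * bl * ↑e⁻¹ - 1 ∈ K.I := by
    have h1 := K.cj_mem ml
    rw [map_sub, map_mul] at h1
    have h2 := K.I.add_mem (K.I.add_mem (K.I.mul_mem_right (bl * ↑e⁻¹) h1)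
      (K.I.mul_mem_left (J.cj (hsgn J l.swap) * J.cj r * ↑e⁻¹) ml)) hr
    convert h2 using 1
    linear_combination (J.cj r * r) * e.mul_inv - (J.cj r * r * ↑e⁻¹) * he
  -- `β_l` is a unit modulo `I`. The factor `d` normalizes the coefficient of the transvection to `c`
  -- up to an element of `c I`.
  set d := J.cj (c * ↑e⁻¹) with hd
  have hcd : J.cj d = c * ↑e⁻¹ := by rw [hd, J.cj_cj]
  set u : (Theta 3 → R) × V₀ := bl • 𝐞 a + (-ba) • 𝐞 l with hu
  set v : (Theta 3 → R) × V₀ := bl • 𝐞 b + (-bb) • 𝐞 l with hv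
  have Qu : (𝕊).Q u ∈ (𝕊).L := Q_pair_mem hal.2 _ _
  have Qv : (𝕊).Q v ∈ (𝕊).L := Q_pair_mem hbl.2 _ _
  have hlv : (𝕊).form (𝐞 l) v = 0 := by
    simp only [hv, (𝕊).form.add_right, (𝕊).form.smul_right, form_far, hbl.symm, form_basis_self]
    ring
  have hav : (𝕊).form (𝐞 a) v = 0 := by
    simp only [hv, (𝕊).form.add_right, (𝕊).form.smul_right, form_far, hal, hab]
    ring
  have alv : (𝕊).Adm (𝐞 l) ((𝕊).Q v) := ⟨Q_basis_mem S₀ l, Qv, hlv⟩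
  have aav : (𝕊).Adm (𝐞 a) ((𝕊).Q v) := ⟨Q_basis_mem S₀ a, Qv, hav⟩
  have hA : (𝕊).Adm (d • u) ((𝕊).Q v) := Adm.smul_left ⟨Qu, Qv, by
    rw [vec_Q, hu, (𝕊).form.add_left, (𝕊).form.smul_left', (𝕊).form.smul_left', hav, hlv]
    ring⟩ d
  have aab : ∀ x : R, (𝕊).Adm (𝐞 a) ((𝕊).Q (x • 𝐞 b)) := adm_short hab.2
  have hvo : (𝕊).form (bl • 𝐞 b) ((-bb) • 𝐞 l) = 0 := by
    rw [(𝕊).form.smul_left', (𝕊).form.smul_right, form_far hbl]; ring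
  -- The part `X` collects the terms of `T(u d, v)` that involve `β_a` or `β_b`, which lie in `I`.
  set T₁ := (𝕊).tv ((d * bl) • 𝐞 a) ((𝕊).Q (bl • 𝐞 b)) with hT₁
  set X := (𝕊).tv ((d * bl) • 𝐞 a) ((𝕊).Q ((-bb) • 𝐞 l)) *
    (𝕊).tv ((-(d * ba)) • 𝐞 l) ((𝕊).Q v) with hX
  have hT : (𝕊).tv (d • u) ((𝕊).Q v) = T₁ * X := by
    have e1 : d • u = (d * bl) • 𝐞 a + (-(d * ba)) • 𝐞 l := by rw [hu]; module
    rw [e1, tv_add_left (aav.smul_left _) (alv.smul_left _), hX, ← mul_assoc, hT₁,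
      ← tv_add ((aab _).smul_left _) ((adm_short hal.2 _).smul_left _), ← Q_add _ hvo]
    rw [(𝕊).form.smul_left', (𝕊).form.smul_right, form_far hal]; ring
  have hX1 : X ∈ commSub K σ ⊓ relEU 3 K := by
    rw [hX, tv_smul_left (adm_short hal.2 _), tv_smul_left alv, Q_act, smul_smul, Q_act, hv,
      smul_add, smul_smul, smul_smul, Q_add, tv_add (adm_short hbl.symm.2 _)
        (adm_short (Theta.ne_swap l) _)]
    · have hba' := K.cj_mem ma
      refine Subgroup.mul_mem _ ⟨?_, ?_⟩ (Subgroup.mul_mem _ ⟨?_, ?_⟩ ⟨?_, ?_⟩)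
      · have := h a l hal (↑e⁻¹ * J.cj bl * -bb) (K.I.mul_mem_left _ (K.I.neg_mem mb))
        rwa [show c * (↑e⁻¹ * J.cj bl * -bb) = J.cj (d * bl) * -bb by
          rw [map_mul, hcd]; ring] at this
      · exact tv_mem_relEU K (adm_short hal.2 _) (Q_smul_basis_mem_ext3 K
          (K.I.mul_mem_left _ (K.I.neg_mem mb)) _)
      · have := h l b hbl.symm (-(↑e⁻¹ * J.cj ba * bl))
          (K.I.neg_mem (K.I.mul_mem_right _ (K.I.mul_mem_left _ hba')))
        rwa [show c * (-(↑e⁻¹ * J.cj ba * bl)) = J.cj (-(d * ba)) * bl by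
          rw [map_neg, map_mul, hcd]; ring] at this
      · refine tv_mem_relEU K (adm_short hbl.symm.2 _) (Q_smul_basis_mem_ext3 K ?_ _)
        rw [map_neg, map_mul]
        exact K.I.mul_mem_right _ (K.I.neg_mem (K.I.mul_mem_left _ hba'))
      · have := mul_mem_commSub hσ (Theta.ne_swap l) hba' mb (c * ↑e⁻¹)
        rwa [show J.cj ba * bb * (c * ↑e⁻¹) = J.cj (-(d * ba)) * -bb by
          rw [map_neg, map_mul, hcd]; ring] at this
      · exact tv_mem_relEU K (adm_short (Theta.ne_swap l) _) (Q_smul_basis_mem_ext3 K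
          (K.I.mul_mem_left _ (K.I.neg_mem mb)) _)
    · rw [(𝕊).form.smul_left', (𝕊).form.smul_right, form_far hbl]; ring
  have su : σ • u = bl • σ • 𝐞 a + (-ba) • σ • 𝐞 l := by
    rw [hu, smul_add, smul_comm σ, smul_comm σ]
  have sv : σ • v = bl • σ • 𝐞 b + (-bb) • σ • 𝐞 l := by
    rw [hv, smul_add, smul_comm σ, smul_comm σ]
  -- The images `σ u` and `σ v` are congruent to multiples of `e_a` and `e_b`.
  have hσA : (𝕊).Adm (d • σ • u) ((𝕊).Q (σ • v)) := by
    have := hA.smul σ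
    rwa [smul_comm σ] at this
  have cong : ∀ {x : Theta 3} {w : R}, Far l x → w ∈ K.I →
      (ext3 K).Cg ((𝕊).Q (σ • (bl • 𝐞 x + (-w) • 𝐞 l))) ((𝕊).Q ((bl * r) • 𝐞 x)) := by
    intro x w hx hw
    have ho : (𝕊).form (bl • 𝐞 x) ((-w) • 𝐞 l) = 0 := by
      rw [(𝕊).form.smul_left', (𝕊).form.smul_right, form_far hx.symm]; ring
    have h1 := hσ _ (Q_pair_mem (S₀ := S₀) hx.symm.2 bl (-w))
    have h2 := (OddFormIdeal.Cg.add_mem_right (Q_smul_basis_mem S₀ bl x)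
      (Q_smul_basis_mem_ext3 K (K.I.neg_mem hw) l)).symm.act r
    rw [← Q_add _ ho, (𝕊).Q_act (bl • 𝐞 x), smul_smul, mul_comm r] at h2
    exact h1.trans h2
  have hab' : (𝕊).Adm ((d * bl * r) • 𝐞 a) ((𝕊).Q ((bl * r) • 𝐞 b)) := (aab _).smul_left _
  have n1 : (𝕊).tv (d • σ • u) ((𝕊).Q (σ • v)) *
      ((𝕊).tv ((d * bl * r) • 𝐞 a) ((𝕊).Q ((bl * r) • 𝐞 b)))⁻¹ ∈ relEU 3 K := by
    refine tv_ECong (k := l.swap) hσA ?_ ?_ hab' ?_ ?_ ?_ ?_ ?_ (cong hbl.symm mb)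
    · simp only [su, (𝕊).form.add_right, (𝕊).form.smul_right, ← hba, ← hbl']; ring
    · simp only [sv, (𝕊).form.add_right, (𝕊).form.smul_right, ← hbb, ← hbl']; ring
    · rw [(𝕊).form.smul_right, form_far hal.symm.swap_left, zero_mul]
    · rw [(𝕊).form.smul_right, Sum.swap_swap, form_far hal.symm, zero_mul]
    · rw [(𝕊).form.smul_right, form_far hbl.symm.swap_left, zero_mul]
    · rw [(𝕊).form.smul_right, Sum.swap_swap, form_far hbl.symm, zero_mul]
    · have := (cong hal.symm ma).act d
      rwa [Q_act, Q_act, smul_smul, ← mul_assoc] at this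
  have eT₁ : T₁ = (𝕊).tv (𝐞 a) ((𝕊).Q ((J.cj (d * bl) * bl) • 𝐞 b)) := by
    rw [hT₁, tv_smul_left (aab _), Q_act, smul_smul]
  have T₁E : T₁ ∈ EU 3 S₀ := by rw [eT₁]; exact tv_mem_EU (aab _)
  have n2 : (𝕊).tv ((d * bl * r) • 𝐞 a) ((𝕊).Q ((bl * r) • 𝐞 b)) * T₁⁻¹ ∈ relEU 3 K := by
    rw [tv_smul_left (aab _), Q_act, smul_smul, eT₁]
    refine (ECong.tv (aab _) (aab _) ?_).2.2
    rw [← Q_act, ← Q_act]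
    refine OddFormIdeal.Cg.act_right (Q_basis_mem S₀ b) ?_
    have := K.I.mul_mem_left (J.cj (d * bl) * bl) hr
    change _ ∈ K.I
    convert this using 1
    rw [map_mul J.cj (d * bl)]; ring
  have hT₁X : T₁ ∈ commSub K σ := by
    refine ⟨T₁E, ?_⟩
    have n3 := conj_mem_of_mem_commSub hX1.1 hX1.2
    have e1 : σ * (T₁ * X) * σ⁻¹ = (𝕊).tv (d • σ • u) ((𝕊).Q (σ • v)) := by
      rw [← hT, tv_conj, smul_comm σ]; rfl
    have n4 := Subgroup.mul_mem _ (Subgroup.mul_mem _ n1 n2)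
      (conj_mem_relEU K T₁E (Subgroup.inv_mem _ n3))
    rw [← e1] at n4
    convert n4 using 1
    group
  -- The coefficient of `T₁` differs from `c` by an element of `c I`.
  have fin := Subgroup.mul_mem _ hT₁X (h a b hab (-(J.cj bl * bl * ↑e⁻¹ - 1))
    (K.I.neg_mem hbe))
  rw [eT₁, ← tv_add (aab _) (aab _), ← Q_add, ← add_smul, map_mul, hcd] at fin
  · rwa [show c * ↑e⁻¹ * J.cj bl * bl + c * -(J.cj bl * bl * ↑e⁻¹ - 1) = c by ring] at fin
  · rw [(𝕊).form.smul_left', (𝕊).form.smul_right, form_basis_self]; ring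

/-- All short root elements commute with `σ` modulo the relative elementary subgroup: products of
two elements of `I` are known as coefficients, and each factor is removed in turn. -/
theorem short_mem_commSub {σ : hypU 3 S₀} {r : R} (hσ : (ext3 K).Scal σ r) {a b : Theta 3}
    (hab : Far a b) (c : R) : (𝕊).tv (𝐞 a) ((𝕊).Q (c • 𝐞 b)) ∈ commSub K σ := by
  refine mem_commSub_of_mul_mem hσ (fun i j hij x hx => ?_) hab
  refine mem_commSub_of_mul_mem hσ (fun i' j' hij' y hy => ?_) hij
  have := mul_mem_commSub hσ hij'.2 hx hy c
  convert this using 4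
  ring

variable (K) in
/-- The elementary transformations which commute, modulo the relative elementary subgroup, with
all transformations acting by a scalar modulo `K`. -/
def commSubAll : Subgroup (hypU 3 S₀) where
  carrier := {T | T ∈ EU 3 S₀ ∧ ∀ σ r, (ext3 K).Scal σ r → T ∈ commSub K σ}
  one_mem' := ⟨Subgroup.one_mem _, fun _ _ _ => Subgroup.one_mem _⟩
  mul_mem' := fun h h' => ⟨Subgroup.mul_mem _ h.1 h'.1, fun σ r hσ =>
    Subgroup.mul_mem _ (h.2 σ r hσ) (h'.2 σ r hσ)⟩
  inv_mem' := fun h => ⟨Subgroup.inv_mem _ h.1, fun σ r hσ => Subgroup.inv_mem _ (h.2 σ r hσ)⟩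

theorem EClosed_commSubAll : EClosed (commSubAll K) := by
  rintro τ hτ T ⟨h1, h2⟩
  refine ⟨EClosed_EU τ hτ T h1, fun σ r hσ => ⟨EClosed_EU τ hτ T h1, ?_⟩⟩
  have hσ' : (ext3 K).Scal (τ⁻¹ * σ * τ) r := fun ξ hξ => by
    have h3 := (hσ _ ((𝕊).smul_mem_L τ hξ)).smul (EU_smul_mem K (Subgroup.inv_mem _ hτ))
    rw [smul_act, inv_smul_smul] at h3
    rwa [mul_smul, mul_smul]
  have := conj_mem_relEU K hτ (h2 _ _ hσ').2
  convert this using 1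
  group

/-- Elementary transformations commute, modulo the relative elementary subgroup, with those
transformations that act by a scalar. The subgroup `commSubAll` is normal in the elementary group
and its level contains `1`. -/
theorem Scal_comm_mem {σ : hypU 3 S₀} {r : R} (hσ : (ext3 K).Scal σ r) {τ : hypU 3 S₀}
    (hτ : τ ∈ EU 3 S₀) : σ * τ * σ⁻¹ * τ⁻¹ ∈ relEU 3 K := by
  have h1 : (1 : R) ∈ EClosed.levelI (EClosed_commSubAll (K := K)) := fun i j hij =>
    ⟨tv_mem_EU (adm_short hij.2 _), fun σ r hσ => short_mem_commSub hσ hij 1⟩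
  have h2 : ∀ x : R, x ∈ (EClosed.level (EClosed_commSubAll (K := K))).I := fun x => by
    have := Ideal.mul_mem_left (EClosed.levelI (EClosed_commSubAll (K := K))) x h1
    rwa [mul_one] at this
  have h3 : EU 3 S₀ ≤ preEU 3 (EClosed.level (EClosed_commSubAll (K := K))) := by
    refine Subgroup.closure_mono ?_
    rintro σ (⟨i, j, hij, hij', x, rfl⟩ | ⟨i, ξ, hξ, rfl⟩)
    · exact Or.inl ⟨i, j, hij, hij', x, h2 x, rfl⟩
    · refine Or.inr ⟨i, ξ, hξ, ?_, rfl⟩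
      have := OddFormIdeal.act_mem_M _ hξ (h2 1)
      rwa [show ξ.act 1 = ξ by ext <;> simp [J.mul_inv1]] at this
  exact ((EClosed.relEU_level_le _ (preEU_le_relEU _ (h3 hτ))).2 σ r hσ).2

end Bootstrap

/-! ### The full congruence subgroup and the sandwich classification -/

section Sandwich

variable {R : Type*} [CommRing R] {J : Pseudoinvolution R}
variable {V₀ : Type*} [AddCommGroup V₀] [Module R V₀] {S₀ : OddQuadraticSpace J V₀}

local notation "𝐞" => basisVec R V₀
local notation "𝕊" => hypSpace 3 S₀

variable {K : S₀.OddFormIdeal}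

theorem relU_le_CU (K : S₀.OddFormIdeal) : relU 3 K ≤ CU 3 K := fun ρ hρ => by
  refine ⟨Subgroup.le_normalizer hρ, fun τ hτ => ?_⟩
  have := Subgroup.mul_mem _ hρ (conj_mem_relU hτ (Subgroup.inv_mem _ hρ))
  convert this using 1
  group

theorem EClosed_CU (K : S₀.OddFormIdeal) : EClosed (CU 3 K) := fun τ hτ σ hσ => by
  have := Subgroup.mul_mem _ (Subgroup.inv_mem _ (relU_le_CU K (hσ.2 τ hτ))) hσ
  convert this using 1
  group

/-- Elements of the full congruence subgroup commute with elementary transformations modulo `M`. -/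
theorem Cg_of_mem_CU {σ τ : hypU 3 S₀} (hσ : σ ∈ CU 3 K) (hτ : τ ∈ EU 3 S₀)
    {ξ : Heis (𝕊).form} (hξ : ξ ∈ (𝕊).L) : (ext3 K).Cg (τ • σ • ξ) (σ • τ • ξ) := by
  have := mem_relU_iff.1 (hσ.2 τ hτ) _ ((𝕊).smul_mem_L τ ((𝕊).smul_mem_L σ hξ))
  rwa [mul_smul, mul_smul, mul_smul, inv_smul_smul, inv_smul_smul] at this

/-- The scalar is read off from the commutation of `σ` with `T(e_k, e_j)`, evaluated at `Q(e_{-k})`. -/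
theorem exists_scalar_of_mem_CU {σ : hypU 3 S₀} (hσ : σ ∈ CU 3 K) (j : Theta 3) :
    ∃ a, (ext3 K).Cg (σ • (𝕊).Q (𝐞 j)) (((𝕊).Q (𝐞 j)).act a) := by
  obtain ⟨k, hjk, -⟩ := exists_far j j
  obtain ⟨l, hjl, hkl⟩ := exists_far j k
  -- Commutation with `T(e_j, e_l)`, which fixes `e_{-k}`, bounds the pairing of `σ e_{-k}` with
  -- `e_j`, so that the other terms produced by `T(e_k, e_j)` vanish modulo `M`.
  have hb : (𝕊).form (𝐞 j) (σ • 𝐞 k.swap) ∈ K.I := by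
    have hA : (𝕊).Adm (𝐞 j) ((𝕊).Q (𝐞 l)) := adm_basis hjl.2
    have h1 := Cg_of_mem_CU hσ (tv_mem_EU hA) (Q_basis_mem S₀ k.swap)
    rw [smul_Q, smul_Q, smul_Q, smul_Q, tv_smul_eq_self hA (form_far hjk.swap_right)
      (form_far hkl.symm.swap_right)] at h1
    have h2 := h1.form_mem' (basis_mem_even S₀ l.swap)
    rw [vec_Q, vec_Q, tv_smul hA, vec_Q, scal_Q, (𝕊).form.add_right, (𝕊).form.add_right,
      (𝕊).form.smul_right, (𝕊).form.smul_right, form_far hjl.symm.swap_left, form_basis_swap'] at h2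
    refine (Ideal.unit_mul_mem_iff_mem _ (isUnit_hsgn J l.swap)).1 ?_
    change _ ∈ K.I at h2
    convert h2 using 1
    ring
  have hA : (𝕊).Adm (𝐞 k) ((𝕊).Q (𝐞 j)) := adm_basis hjk.symm.2
  have h1 := Cg_of_mem_CU hσ (tv_mem_EU hA) (Q_basis_mem S₀ k.swap)
  have e1 : (𝕊).tv (𝐞 k) ((𝕊).Q (𝐞 j)) • (𝕊).Q (𝐞 k.swap) =
      (𝕊).Q (𝐞 k.swap) + ((𝕊).Q (𝐞 j)).act (hsgn J k) := by
    rw [smul_Q, tv_smul hA, vec_Q, scal_Q, form_far hjk.swap_right, form_basis_swap, Q_act, ← Q_add]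
    · simp
    · rw [(𝕊).form.smul_right, form_far hjk.symm.swap_left, zero_mul]
  rw [e1, tv_smul_heis hA, smul_add, smul_act] at h1
  have h2 := h1.add_left_cancel
    (OddFormIdeal.Cg.refl ((𝕊).smul_mem_L σ (Q_basis_mem S₀ k.swap)))
  have h3 := ((𝕊).act_mem _ (Q_basis_mem S₀ j)) ((𝕊).form (𝐞 k) (σ • 𝐞 k.swap))
  have m1 : ((𝕊).Q (𝐞 k)).act (J.inv1 * ((𝕊).form (𝐞 j) (σ • 𝐞 k.swap) +
      0 * (𝕊).form (𝐞 k) (σ • 𝐞 k.swap))) ∈ (ext3 K).M :=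
    (ext3 K).act_mem_M (Q_basis_mem S₀ k)
      (K.I.mul_mem_left _ (by rwa [zero_mul, add_zero]))
  have m2 := (ext3 K).add_bar_mem_M
    (K.I.mul_mem_left (J.cj ((𝕊).form (𝐞 k) (σ • 𝐞 k.swap))) hb)
  have h4 := (OddFormIdeal.Cg.add_mem_left h3 m1).trans
    (OddFormIdeal.Cg.add_mem_right ((𝕊).L.add_mem ((ext3 K).mem_L m1) h3) m2)
  obtain ⟨u, hu⟩ := isUnit_hsgn J k
  have h5 := (h4.trans h2).symm.act (↑u⁻¹ : R)
  rw [Heis.act_act, Heis.act_act, ← hu, Units.mul_inv] at h5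
  refine ⟨_, OddFormIdeal.Cg.trans ?_ h5⟩
  exact (OddFormIdeal.Cg.act_one ((𝕊).smul_mem_L σ (Q_basis_mem S₀ j))
    (by rw [sub_self]; exact K.I.zero_mem)).symm

theorem exists_Scal_of_mem_CU {σ : hypU 3 S₀} (hσ : σ ∈ CU 3 K) : ∃ a, (ext3 K).Scal σ a :=
  exists_Scal_of_basis (EClosed_CU K) (fun _ h j => exists_scalar_of_mem_CU h j) hσ

theorem mem_CU_of_Scal {σ : hypU 3 S₀} {a b : R} (h : (ext3 K).Scal σ a)
    (h' : (ext3 K).Scal σ⁻¹ b) : σ ∈ CU 3 K := by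
  refine ⟨OddFormIdeal.normalizer_of_smul_mem _ (fun _ => h.smul_mem) (fun _ => h'.smul_mem),
    fun τ hτ => mem_relU_iff.2 fun ξ hξ => ?_⟩
  have h0 : σ⁻¹ • τ⁻¹ • ξ ∈ (𝕊).L := (𝕊).smul_mem_L _ ((𝕊).smul_mem_L _ hξ)
  have h1 := h _ ((𝕊).smul_mem_L τ h0)
  have h2 := (h _ h0).smul (EU_smul_mem K hτ)
  rw [smul_act] at h2
  have h3 := h2.trans h1.symm
  rwa [smul_inv_smul, smul_inv_smul, ← mul_smul, ← mul_smul, ← mul_smul] at h3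

theorem EClosed.le_CU {H : Subgroup (hypU 3 S₀)} (hH : EClosed H) : H ≤ CU 3 (level hH) :=
  fun σ hσ => by
    obtain ⟨a, ha⟩ := hH.exists_Scal hσ
    obtain ⟨b, hb⟩ := hH.exists_Scal (Subgroup.inv_mem _ hσ)
    exact mem_CU_of_Scal ha hb

/-- By `Scal_comm_mem`, the commutators of `H` with elementary transformations lie in the lower end
of the sandwich. -/
theorem IsSandwiched.eClosed {H : Subgroup (hypU 3 S₀)} (h : IsSandwiched H K) : EClosed H := by
  intro τ hτ σ hσ
  obtain ⟨a, ha⟩ := exists_Scal_of_mem_CU (h.2 hσ)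
  have := H.mul_mem (H.inv_mem (h.1 (Scal_comm_mem ha hτ))) hσ
  convert this using 1
  group

/-- A short root element acting by a scalar maps `e_{-i}` to a vector whose coordinate at `j` is a
unit multiple of its parameter, and must lie in `I`. -/
theorem mem_I_of_tv_mem_CU {i j : Theta 3} (hij : Far i j) {c : R}
    (h : (𝕊).tv (𝐞 i) ((𝕊).Q (c • 𝐞 j)) ∈ CU 3 K) : c ∈ K.I := by
  obtain ⟨a, ha⟩ := exists_Scal_of_mem_CU h
  have h1 := (ha _ (Q_basis_mem S₀ i.swap)).form_mem' (basis_mem_even S₀ j.swap)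
  rw [vec_smul, Heis.vec_act, vec_Q, tv_smul (adm_short hij.2 c), (𝕊).form.add_right,
    (𝕊).form.add_right, (𝕊).form.smul_right, (𝕊).form.smul_right, (𝕊).form.smul_right, vec_Q,
    (𝕊).form.smul_right, form_far hij.symm.swap_left, form_far hij.symm.swap_left.swap_right,
    form_basis_swap, form_basis_swap'] at h1
  refine (Ideal.unit_mul_mem_iff_mem _ (isUnit_hsgn J i)).1
    ((Ideal.unit_mul_mem_iff_mem _ (isUnit_hsgn J j.swap)).1 ?_)
  change _ ∈ K.I at h1
  convert h1 using 1
  ring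

/-- The image of `Q(e_{-i})` shows that the scalar is `1`, then that the component along `e_i` is
in `I`, and finally that the component `η` in `V₀`, up to a unit, is in `M₀`. -/
theorem mem_M_of_tv_mem_CU {i : Theta 3} {η : Heis S₀.form} (hη : η ∈ S₀.L)
    (h : (𝕊).tv (𝐞 i) (inr0 S₀ η) ∈ CU 3 K) : η ∈ K.M := by
  obtain ⟨a, ha⟩ := exists_Scal_of_mem_CU h
  have hA := adm_extra i hη
  have h0 := ha _ (Q_basis_mem S₀ i.swap)
  have ei : (𝕊).form (inr0 S₀ η).vec (𝐞 i.swap) = 0 := by rw [form_basis_right]; simp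
  have ea : a - 1 ∈ K.I := by
    have h1 := h0.form_mem' (basis_mem_even S₀ i)
    rw [vec_smul, Heis.vec_act, vec_Q, tv_smul hA, (𝕊).form.add_right,
      (𝕊).form.add_right, (𝕊).form.smul_right, (𝕊).form.smul_right, (𝕊).form.smul_right,
      form_basis_self, form_basis_swap, hA.orth] at h1
    refine (Ideal.unit_mul_mem_iff_mem _ (isUnit_hsgn J i)).1 ?_
    have h2 := K.I.neg_mem h1
    convert h2 using 1
    ring
  have h1 := h0.trans (OddFormIdeal.Cg.act_one (Q_basis_mem S₀ i.swap) ea)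
  rw [tv_smul_heis hA] at h1
  have h2 : (ext3 K).Cg ((𝕊).Q (𝐞 i.swap)) ((𝕊).Q (𝐞 i.swap) + 0) := by
    rw [add_zero]; exact OddFormIdeal.Cg.refl (Q_basis_mem S₀ _)
  have h3 := (h2.symm.trans h1.symm).add_left_cancel
    (OddFormIdeal.Cg.refl (Q_basis_mem S₀ i.swap))
  obtain ⟨u, hu⟩ := isUnit_hsgn J i
  rw [vec_Q, ei, form_basis_swap, mul_zero, map_zero, add_zero, zero_add, ← hu] at h3
  have h4 : ((𝕊).Q (𝐞 i)).act (J.inv1 * ((inr0 S₀ η).scal * ↑u)) +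
      (inr0 S₀ η).act ↑u ∈ (ext3 K).M := by
    have := h3.mem
    rw [neg_zero, zero_add] at this
    convert this using 1
    exact (add_zero _).symm
  obtain ⟨h5, -⟩ := (mem_ext3_iff K).1 h4
  have h6 := h5 i
  have h7 : (((𝕊).Q (𝐞 i)).act (J.inv1 * ((inr0 S₀ η).scal * ↑u)) +
      (inr0 S₀ η).act ↑u).vec.1 i = J.inv1 * ((inr0 S₀ η).scal * ↑u) := by
    simp [inr0_act, basis_coord_self]
  rw [h7] at h6
  have h8 := ((ext3 K).M.add_mem_cancel_left ((ext3 K).act_mem_M (Q_basis_mem S₀ i) h6)).1 h4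
  have h9 := ((mem_ext3_iff K).1 ((ext3 K).act_mem _ h8 (↑u⁻¹ : R))).2
  rwa [Heis.act_act, Units.mul_inv, inr0_act, pi0_inr0,
    show η.act 1 = η by ext <;> simp [J.mul_inv1]] at h9

theorem IsSandwiched.isLevel {H : Subgroup (hypU 3 S₀)} (h : IsSandwiched H K) : IsLevel H K := by
  have hle : preEU 3 K ≤ H := (preEU_le_relEU K).trans h.1
  constructor
  · refine Set.Subset.antisymm (fun x hx => ?_) ?_
    · exact ⟨Sum.inl 0, Sum.inl 1, by decide, by decide, hle (Subgroup.subset_closure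
        (Or.inl ⟨_, _, _, _, x, hx, rfl⟩))⟩
    · rintro x ⟨i, j, hij, hij', hx⟩
      rw [shortT_eq_tv] at hx
      have h1 := mem_I_of_tv_mem_CU ⟨hij', by simpa using hij⟩ (h.2 hx)
      have h2 := K.I.neg_mem h1
      rw [neg_neg, mul_comm] at h2
      exact (Ideal.unit_mul_mem_iff_mem _ (isUnit_eps j)).1 h2
  · refine Set.Subset.antisymm (fun ξ hξ => ?_) ?_
    · exact ⟨K.mem_L hξ, Sum.inl 0, hle (Subgroup.subset_closure
        (Or.inr ⟨_, ξ, K.mem_L hξ, hξ, rfl⟩))⟩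
    · rintro ξ ⟨hξ, i, hx⟩
      rw [extraT_eq_tv] at hx
      obtain ⟨u, hu⟩ := isUnit_eps (J := J) i.swap
      have h1 := K.act_mem _ (mem_M_of_tv_mem_CU (S₀.act_mem _ hξ _) (h.2 hx)) (↑u⁻¹ : R)
      rwa [Heis.act_act, ← hu, Units.mul_inv,
        show ξ.act 1 = ξ by ext <;> simp [J.mul_inv1]] at h1

theorem IsLevel.unique {H : Subgroup (hypU 3 S₀)} {K' : S₀.OddFormIdeal} (h : IsLevel H K)
    (h' : IsLevel H K') : K = K' :=
  OddFormIdeal.ext (SetLike.coe_injective (h.1.trans h'.1.symm))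
    (SetLike.coe_injective (h.2.trans h'.2.symm))

end Sandwich

end OddUnitary

theorem mainTheorem1 {R : Type*} [CommRing R] (J : OddUnitary.Pseudoinvolution R)
    {V₀ : Type*} [AddCommGroup V₀] [Module R V₀] (S₀ : OddUnitary.OddQuadraticSpace J V₀)
    (H : Subgroup (OddUnitary.hypU 3 S₀)) :
    (OddUnitary.IsENormal H ↔ ∃ K : S₀.OddFormIdeal, OddUnitary.IsSandwiched H K) ∧
    (∀ K K' : S₀.OddFormIdeal,
      OddUnitary.IsSandwiched H K → OddUnitary.IsSandwiched H K' → K = K') ∧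
    (∀ K : S₀.OddFormIdeal, OddUnitary.IsSandwiched H K → OddUnitary.IsLevel H K) := by
  refine ⟨?_, fun _ _ h h' => h.isLevel.unique h'.isLevel, fun _ h => h.isLevel⟩
  rw [OddUnitary.isENormal_iff]
  exact ⟨fun h => ⟨h.level, h.relEU_level_le, h.le_CU⟩, fun ⟨_, h⟩ => h.eClosed⟩
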